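/- **Conventions.** Let $(M,J)$ be a complex manifold of complex dimension $n\ge 0$. A *special Kähler manifold* $(M,J,\nabla,\omega)$ is $(M,J)$ together with a smooth, flat, torsion-free connection $\nabla$ on its real tangent bundle such that $d^\nabla J=0$, i.e. $(\nabla_XJ)Y=(\nabla_YJ)X$ for all vector fields $X,Y$, and a symplectic form $\omega$ that is $\nabla$-parallel and $J$-invariant, $\omega(JX,JY)=\omega(X,Y)$. (The metric $g=\omega(J\cdot,\cdot)$ may be indefinite.) Let $U\subseteq\mathbb C^n$ be open. A holomorphic function $F:U\to\mathbb C$ is *nondegenerate* if the real matrix $\operatorname{Im}\frac{\partial^2F}{\partial z^i\partial z^j}(z)$ is invertible for every $z\in U$. Regard $dF$ as the map $\phi:U\to T^*\mathbb C^n=\mathbb C^{2n}$, $z\mapsto(z,w)$ with $w_i=\partial F/\partial z^i$, and put $x^i=\operatorname{Re}z^i$, $y_i=\operatorname{Re}\,\partial F/\partial z^i$ on $U$. A connection $\nabla$ and a 2-form $\omega$ on $U$ are *induced by $dF$* if the differentials of the functions $x^1,\dots,x^n,y_1,\dots,y_n$ are linearly independent at every point of $U$ (so that these functions are local coordinates),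 each of these functions is $\nabla$-affine ($\nabla dx^i=\nabla dy_i=0$), and $\omega=2\sum_i dx^i\wedge dy_i$. **Corollary.** (1) For every nondegenerate holomorphic function $F$ on an open set $U\subseteq\mathbb C^n$ there is a unique pair $(\nabla,\omega)$ on $U$ induced by $dF$, and $(U,J,\nabla,\omega)$, with $J$ the standard complex structure of $U$, is a special Kähler manifold of complex dimension $n$. (2) Conversely, every special Kähler manifold $(M,J,\nabla,\omega)$ of complex dimension $n$ is locally obtained in this way: for every $p\in M$ there are an open set $U\subseteq\mathbb C^n$, a nondegenerate holomorphic function $F$ on $U$, and a biholomorphic map $\psi$ from $U$ onto an open neighbourhood of $p$ in $M$, such that $\psi$ identifies the connection and the symplectic form on $U$ induced by $dF$ with the restrictions of $\nabla$ and $\omega$ to $\psi(U)$. -/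

import Mathlib

open scoped Manifold ContDiff Bundle Topology

noncomputable section

namespace SpecialKahler

/-- A complex manifold of dimension `n` (holomorphic atlas with values in `ℂⁿ`) is in particular
a real-analytic, hence smooth, manifold modelled on the real vector space underlying `ℂⁿ`. -/
instance isManifold_real {n : ℕ} {M : Type*} [TopologicalSpace M] [ChartedSpace (Fin n → ℂ) M]
    [h : IsManifold 𝓘(ℂ, Fin n → ℂ) ω M] : IsManifold 𝓘(ℝ, Fin n → ℂ) ω M := by
  refine isManifold_of_contDiffOn _ _ _ fun e e' he he' => ?_
  have hc := (contDiffGroupoid ω 𝓘(ℂ, Fin n → ℂ)).compatible he he'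
  rw [contDiffGroupoid, mem_groupoid_of_pregroupoid] at hc
  have h1 : ContDiffOn ℂ ω (e.symm ≫ₕ e') (e.symm ≫ₕ e').source := by
    simpa [contDiffPregroupoid] using hc.1
  simpa using h1.restrict_scalars ℝ

section Structures

variable {n : ℕ} {M : Type*} [TopologicalSpace M] [ChartedSpace (Fin n → ℂ) M]

variable (n M) in
/-- A (not necessarily continuous) vector field: a section of the real tangent bundle of `M`. -/
abbrev VField : Type _ := (x : M) → TangentSpace 𝓘(ℝ, Fin n → ℂ) x

/-- A real vector field is smooth. -/
def IsSmoothField [IsManifold 𝓘(ℂ, Fin n → ℂ) ω M] (X : VField n M) : Prop :=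
  ContMDiff 𝓘(ℝ, Fin n → ℂ) (𝓘(ℝ, Fin n → ℂ).prod 𝓘(ℝ, Fin n → ℂ)) ∞
    (fun x => (⟨x, X x⟩ : TangentBundle 𝓘(ℝ, Fin n → ℂ) M))

/-- The differential of a real function, as a real 1-form. -/
def dReal (f : M → ℝ) (x : M) : TangentSpace 𝓘(ℝ, Fin n → ℂ) x →L[ℝ] ℝ :=
  mfderiv 𝓘(ℝ, Fin n → ℂ) 𝓘(ℝ, ℝ) f x

/-- The derivative `X f` of a real function along a vector field. -/
def along (X : VField n M) (f : M → ℝ) (x : M) : ℝ := dReal (n := n) f x (X x)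

variable (n) in
/-- The complex structure `J` of the complex manifold `M`, acting on the real tangent space at `x`.
The tangent space at `x` is `ℂⁿ`, a tangent vector being read in the preferred holomorphic chart
at `x`; so `J` is multiplication by `i` (and the same holds in any other holomorphic chart). -/
def J (x : M) :
    TangentSpace 𝓘(ℝ, Fin n → ℂ) x →L[ℝ] TangentSpace 𝓘(ℝ, Fin n → ℂ) x :=
  (Complex.I • ContinuousLinearMap.id ℝ (Fin n → ℂ) : (Fin n → ℂ) →L[ℝ] (Fin n → ℂ))

/-- The Lie bracket `[X, Y]`. -/
def bracket (X Y : VField n M) : VField n M := VectorField.mlieBracket 𝓘(ℝ, Fin n → ℂ) X Y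

variable (n M) in
/-- A field of real bilinear forms on the tangent spaces of `M`. -/
abbrev BilinField : Type _ :=
  (x : M) → TangentSpace 𝓘(ℝ, Fin n → ℂ) x →L[ℝ] TangentSpace 𝓘(ℝ, Fin n → ℂ) x →L[ℝ] ℝ

/-- The function `w(X, Y)`. -/
def eval (w : BilinField n M) (X Y : VField n M) (x : M) : ℝ := w x (X x) (Y x)

variable [IsManifold 𝓘(ℂ, Fin n → ℂ) ω M]

variable (n M) in
/-- A connection on the real tangent bundle of `M`. -/
abbrev Connection : Type _ :=
  CovariantDerivative 𝓘(ℝ, Fin n → ℂ) (Fin n → ℂ)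
    (TangentSpace 𝓘(ℝ, Fin n → ℂ) : M → Type _)

/-- `nabla D X Y` is the vector field `∇_X Y`. -/
def nabla (D : Connection n M) (X Y : VField n M) : VField n M := fun x => D Y x (X x)

/-- The connection has zero curvature: `∇_X ∇_Y Z - ∇_Y ∇_X Z - ∇_[X,Y] Z = 0`. -/
def IsFlat (D : Connection n M) : Prop :=
  ∀ X Y Z : VField n M, IsSmoothField X → IsSmoothField Y → IsSmoothField Z →
    nabla D X (nabla D Y Z) - nabla D Y (nabla D X Z) - nabla D (bracket X Y) Z = 0

/-- `(∇_X J) Y = ∇_X (J Y) - J (∇_X Y)`. -/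
def nablaJ (D : Connection n M) (X Y : VField n M) : VField n M :=
  fun x => nabla D X (fun y => J n y (Y y)) x - J n x (nabla D X Y x)

/-- A special complex manifold `(M, J, ∇)`: the smooth connection `∇` is flat and torsionfree, and
`d^∇ J = 0`, where `(d^∇ J)(X, Y) = (∇_X J) Y - (∇_Y J) X`. -/
structure IsSpecialComplex (D : Connection n M) : Prop where
  smooth : D.ContMDiffCovariantDerivative ∞
  flat : IsFlat D
  torsionfree : D.torsion = 0
  dJ_eq_zero : ∀ X Y : VField n M, IsSmoothField X → IsSmoothField Y →
    nablaJ D X Y - nablaJ D Y X = 0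

/-- A symplectic form: a smooth, closed, nondegenerate 2-form. Closedness is the vanishing of
`dw(X,Y,Z) = X w(Y,Z) + Y w(Z,X) + Z w(X,Y) - w([X,Y],Z) - w([Y,Z],X) - w([Z,X],Y)`. -/
structure IsSymplectic (w : BilinField n M) : Prop where
  alternating : ∀ (x : M) (u : TangentSpace 𝓘(ℝ, Fin n → ℂ) x), w x u u = 0
  smooth : ∀ X Y : VField n M, IsSmoothField X → IsSmoothField Y →
    ContMDiff 𝓘(ℝ, Fin n → ℂ) 𝓘(ℝ, ℝ) ∞ (eval w X Y)
  nondegenerate : ∀ (x : M) (u : TangentSpace 𝓘(ℝ, Fin n → ℂ) x),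
    (∀ v : TangentSpace 𝓘(ℝ, Fin n → ℂ) x, w x u v = 0) → u = 0
  closed : ∀ X Y Z : VField n M, IsSmoothField X → IsSmoothField Y → IsSmoothField Z → ∀ x : M,
    along X (eval w Y Z) x + along Y (eval w Z X) x + along Z (eval w X Y) x
      - eval w (bracket X Y) Z x - eval w (bracket Y Z) X x - eval w (bracket Z X) Y x = 0

/-- The 2-form is `∇`-parallel: `X w(Y,Z) = w(∇_X Y, Z) + w(Y, ∇_X Z)`. -/
def IsParallel (D : Connection n M) (w : BilinField n M) : Prop :=
  ∀ X Y Z : VField n M, IsSmoothField X → IsSmoothField Y → IsSmoothField Z → ∀ x : M,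
    along X (eval w Y Z) x = eval w (nabla D X Y) Z x + eval w Y (nabla D X Z) x

/-- A special Kähler manifold `(M, J, ∇, w)`: a special complex manifold together with a
`∇`-parallel, `J`-invariant symplectic form `w`. (The metric `w(J·,·)` may be indefinite.) -/
structure IsSpecialKahler (D : Connection n M) (w : BilinField n M) : Prop where
  specialComplex : IsSpecialComplex D
  symplectic : IsSymplectic w
  parallel : IsParallel D w
  invariant : ∀ (x : M) (u v : TangentSpace 𝓘(ℝ, Fin n → ℂ) x),
    w x (J n x u) (J n x v) = w x u v

/-- The smooth function `f` is `∇`-affine, i.e. `∇ df = 0`: `X (Y f) = df (∇_X Y)`. -/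
def IsAffineFun (D : Connection n M) (f : M → ℝ) : Prop :=
  ContMDiff 𝓘(ℝ, Fin n → ℂ) 𝓘(ℝ, ℝ) ∞ f ∧
  ∀ X Y : VField n M, IsSmoothField X → IsSmoothField Y → ∀ x : M,
    along X (along Y f) x = along (nabla D X Y) f x

/-- The connection `D` and the 2-form `w` are induced by the map `φ = (z, p)` from `M` to
`T*ℂⁿ = ℂⁿ × ℂⁿ`: the real part `(Re z, Re p)` is an immersion (so that the functions
`xⁱ = Re zⁱ` and `yᵢ = Re pᵢ` are local coordinates), these functions are `D`-affine,
and `w = 2 ∑ dxⁱ ∧ dyᵢ`. -/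
structure IsInducedBy (φ : M → (Fin n → ℂ) × (Fin n → ℂ)) (D : Connection n M)
    (w : BilinField n M) : Prop where
  immersion : ∀ (q : M) (u : TangentSpace 𝓘(ℝ, Fin n → ℂ) q),
    (∀ i, dReal (n := n) (fun q' => ((φ q').1 i).re) q u = 0) →
    (∀ i, dReal (n := n) (fun q' => ((φ q').2 i).re) q u = 0) → u = 0
  affine_x : ∀ i, IsAffineFun D (fun q => ((φ q).1 i).re)
  affine_y : ∀ i, IsAffineFun D (fun q => ((φ q).2 i).re)
  form : ∀ (q : M) (u v : TangentSpace 𝓘(ℝ, Fin n → ℂ) q),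
    w q u v = 2 * ∑ i,
      (dReal (n := n) (fun q' => ((φ q').1 i).re) q u *
          dReal (n := n) (fun q' => ((φ q').2 i).re) q v -
        dReal (n := n) (fun q' => ((φ q').1 i).re) q v *
          dReal (n := n) (fun q' => ((φ q').2 i).re) q u)

/-- `ψ : N → M` identifies the complex manifold `N`, with connection `D'` and form `w'`, with an
open subset of `M` carrying the restrictions of `J`, `D` and `w`: it is a biholomorphic map onto
its open image, `D' (ψ^* Y) = ψ^* (D Y)`, and `w' = ψ^* w`. -/
structure IsOpenIsomorphism {N : Type*} [TopologicalSpace N] [ChartedSpace (Fin n → ℂ) N]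
    [IsManifold 𝓘(ℂ, Fin n → ℂ) ω N] (D' : Connection n N) (w' : BilinField n N)
    (D : Connection n M) (w : BilinField n M) (ψ : N → M) : Prop where
  injective : Function.Injective ψ
  biholomorphic : IsLocalDiffeomorph 𝓘(ℂ, Fin n → ℂ) 𝓘(ℂ, Fin n → ℂ) ω ψ
  connection : ∀ Y : VField n M, IsSmoothField Y →
    ∀ (x : N) (u : TangentSpace 𝓘(ℝ, Fin n → ℂ) x),
      mfderiv 𝓘(ℝ, Fin n → ℂ) 𝓘(ℝ, Fin n → ℂ) ψ x
        (D' (VectorField.mpullback 𝓘(ℝ, Fin n → ℂ) 𝓘(ℝ, Fin n → ℂ) ψ Y) x u) =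
      D Y (ψ x) (mfderiv 𝓘(ℝ, Fin n → ℂ) 𝓘(ℝ, Fin n → ℂ) ψ x u)
  form : ∀ (x : N) (u v : TangentSpace 𝓘(ℝ, Fin n → ℂ) x),
    w' x u v = w (ψ x) (mfderiv 𝓘(ℝ, Fin n → ℂ) 𝓘(ℝ, Fin n → ℂ) ψ x u)
      (mfderiv 𝓘(ℝ, Fin n → ℂ) 𝓘(ℝ, Fin n → ℂ) ψ x v)

end Structures

/-- The partial derivative `∂F/∂zⁱ`. -/
def partialC {n : ℕ} (F : (Fin n → ℂ) → ℂ) (i : Fin n) (z : Fin n → ℂ) : ℂ :=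
  fderiv ℂ F z (Pi.single i 1)

/-- `F` is a nondegenerate holomorphic function on the open set `U ⊆ ℂⁿ`: the real matrix
`Im ∂²F/∂zⁱ∂zʲ` is invertible at every point of `U`. -/
structure IsNondegenerateHolomorphic {n : ℕ} (U : TopologicalSpace.Opens (Fin n → ℂ))
    (F : (Fin n → ℂ) → ℂ) : Prop where
  holomorphic : DifferentiableOn ℂ F U
  nondegenerate : ∀ z ∈ U,
    IsUnit (Matrix.of fun i j : Fin n => (partialC (partialC F i) j z).im)

/-- The holomorphic 1-form `dF`, as a section `z ↦ (z, (∂F/∂zⁱ)ᵢ)` of `T*ℂⁿ = ℂⁿ × ℂⁿ`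
over `U`. -/
def dSection {n : ℕ} (U : TopologicalSpace.Opens (Fin n → ℂ)) (F : (Fin n → ℂ) → ℂ)
    (z : U) : (Fin n → ℂ) × (Fin n → ℂ) :=
  (z, fun i => partialC F i z)

end SpecialKahler

end

noncomputable section

namespace SpecialKahler

/-! Direct part. Let Φ = (x, y) be the real part of dF. Its differential is injective exactly when
Im ∂²F is invertible (`injective_re_gradGraphDeriv`, `isUnit_of_injective_re_gradGraphDeriv`), so Φ
is a local diffeomorphism to ℝ²ⁿ, along which the flat connection and twice the standard symplectic
form are pulled back. Flatness and vanishing torsion both reduce to df([X,Y]) = X(df Y) - Y(df X)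
for vector-valued f (`mvfderiv_mlieBracket`). The same identity for the holomorphic map dF, of which
Φ is the real part, gives d^∇J = 0 (`isSpecialComplex_flatConnection`). Symmetry of the Hessian
makes the graph of dF complex Lagrangian, which yields J-invariance
(`stdForm_gradGraphDeriv_I_smul`). The pair is unique because affine functions with jointly
injective differentials determine ∇.

Converse. In a holomorphic chart at p the connection is a Christoffel symbol Γ, and the hypotheses
say that its curvature vanishes, that Γ(u,v) = Γ(v,u), and that Γ(u,iv) = Γ(v,iu). Vanishing
curvature allows dA = AΓ to be solved with A = 1 at p (`exists_hasFDerivAt_of_curvature_eq_zero`).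
Composing A with Darboux coordinates of ω at p gives a parallel coframe β in which ω is standard
(`exists_parallel_darboux_coframe`). The two symmetries of Γ say that β and β ∘ i are closed, so β
is the real part of dζ for a holomorphic ζ = (z, w) (`exists_holomorphic_primitive`).

The Darboux coordinates come from diagonalizing a Hermitian form (`exists_adapted_darboux_basis`),
which makes dz injective at p, so that z is a local holomorphic coordinate. J-invariance of ω says
that the real part of Σ dzⁱ ∧ dwᵢ vanishes on the image of dζ. That image is a complex subspace, so
the whole form vanishes and Σ wᵢ dzⁱ is closed, hence equal to dF (`exists_prepotential`).
Nondegeneracy of ω makes β injective, which is the nondegeneracy of F. -/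

lemma eventually_norm_le_of_continuousAt {X F : Type*} [TopologicalSpace X] [NormedAddCommGroup F] {f : X → F} {x : X}
    (hf : ContinuousAt f x) : ∃ C, ∀ᶠ y in 𝓝 x, ‖f y‖ ≤ C :=
  ⟨‖f x‖ + 1, (hf.norm.eventually (gt_mem_nhds (lt_add_one _))).mono fun _ h => le_of_lt h⟩

/-! ### Linear total differential equations: the Frobenius theorem. -/

section Frobenius

open Set Metric

variable {E 𝔸 : Type*} [NormedAddCommGroup E] [NormedSpace ℝ E]
  [NormedRing 𝔸] [NormedAlgebra ℝ 𝔸]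

/-- A linear equation along a segment has a solution, if the segment is short enough. -/
lemma exists_solution_along_ray [CompleteSpace 𝔸] {Γ : E → E →L[ℝ] 𝔸} {x₀ x : E} {C r : ℝ}
    (hΓc : ContinuousOn Γ (ball x₀ r)) (hC : ∀ z ∈ ball x₀ r, ‖Γ z‖ ≤ C)
    (hx : x ∈ ball x₀ r) (hCx : C * ‖x - x₀‖ ≤ 1 / 2) (a₀ : 𝔸) :
    ∃ a : ℝ → 𝔸, a 0 = a₀ ∧ ∀ t ∈ Icc (0 : ℝ) 1,
      HasDerivWithinAt a (a t * Γ (x₀ + t • (x - x₀)) (x - x₀)) (Icc 0 1) t := by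
  have hmem : ∀ t ∈ Icc (0 : ℝ) 1, x₀ + t • (x - x₀) ∈ ball x₀ r := fun t ht =>
    (convex_ball x₀ r).add_smul_sub_mem (mem_ball_self (dist_nonneg.trans_lt hx)) hx ht
  have hnorm : ∀ t ∈ Icc (0 : ℝ) 1, ‖Γ (x₀ + t • (x - x₀)) (x - x₀)‖ ≤ 1 / 2 := fun t ht =>
    ((Γ _).le_opNorm _).trans ((mul_le_mul_of_nonneg_right (hC _ (hmem t ht))
      (norm_nonneg _)).trans hCx)
  -- On the ball of radius ‖a₀‖ + 1 about `a₀` the speed is at most (2‖a₀‖ + 1)/2 ≤ ‖a₀‖ + 1, so a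
  -- solution cannot leave this ball in unit time. The factor 1/2 from `hCx` makes both constants
  -- fit.
  have hpl : IsPicardLindelof (fun t w => w * Γ (x₀ + t • (x - x₀)) (x - x₀))
      (tmin := 0) (tmax := 1) ⟨0, by simp⟩ a₀ (‖a₀‖₊ + 1) 0 (‖a₀‖₊ + 1) 1 :=
    { lipschitzOnWith := fun t ht => by
        refine (LipschitzWith.of_dist_le_mul fun w w' => ?_).lipschitzOnWith
        rw [dist_eq_norm, dist_eq_norm, ← sub_mul, NNReal.coe_one, one_mul]
        refine (norm_mul_le _ _).trans (mul_le_of_le_one_right (norm_nonneg _) ?_)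
        exact (hnorm t ht).trans (by norm_num)
      continuousOn := fun w _ => by
        have h1 : ContinuousOn (fun t : ℝ => Γ (x₀ + t • (x - x₀))) (Icc 0 1) :=
          hΓc.comp (by fun_prop) hmem
        exact continuousOn_const.mul (h1.clm_apply continuousOn_const)
      norm_le := fun t ht w hw => by
        have h1 : ‖w‖ ≤ ‖a₀‖ + (‖a₀‖ + 1) := by
          have := norm_le_norm_add_norm_sub' w a₀
          have h2 : ‖w - a₀‖ ≤ ‖a₀‖ + 1 := by simpa [dist_eq_norm] using hw
          linarith
        have h2 := (norm_mul_le w (Γ (x₀ + t • (x - x₀)) (x - x₀))).trans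
          (mul_le_mul h1 (hnorm t ht) (norm_nonneg _) (by positivity))
        refine h2.trans ?_
        simp only [NNReal.coe_add, coe_nnnorm, NNReal.coe_one]
        linarith
      mul_max_le := by simp }
  obtain ⟨a, ha0, ha⟩ := hpl.exists_eq_forall_mem_Icc_hasDerivWithinAt (x := a₀) (by simp)
  exact ⟨a, ha0, ha⟩

/-- A first-order Taylor estimate for a function with Lipschitz derivative. -/
lemma norm_taylor_le {F : Type*} [NormedAddCommGroup F] [NormedSpace ℝ F] {f : E → F}
    {f' : E → E →L[ℝ] F} {s : Set E} (hs : Convex ℝ s) {C : ℝ} (hC : 0 ≤ C)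
    (hf : ∀ z ∈ s, HasFDerivAt f (f' z) z)
    (hlip : ∀ z ∈ s, ∀ z' ∈ s, dist (f' z) (f' z') ≤ C * dist z z') {z k : E}
    (hz : z ∈ s) (hzk : z + k ∈ s) :
    ‖f (z + k) - f z - f' z k‖ ≤ C * ‖k‖ ^ 2 := by
  have hseg : segment ℝ z (z + k) ⊆ s := hs.segment_subset hz hzk
  have := (convex_segment (𝕜 := ℝ) z (z + k)).norm_image_sub_le_of_norm_hasFDerivWithin_le'
    (f := f) (f' := f') (φ := f' z) (C := C * ‖k‖)
    (fun y hy => (hf y (hseg hy)).hasFDerivWithinAt) (fun y hy => by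
      rw [← dist_eq_norm]
      refine (hlip y (hseg hy) _ hz).trans ?_
      gcongr
      have := segment_subset_closedBall_left (E := E) z (z + k) hy
      simpa [dist_eq_norm, norm_sub_rev] using this)
    (left_mem_segment _ _ _) (right_mem_segment _ _ _)
  simp only [add_sub_cancel_left] at this
  rwa [pow_two, ← mul_assoc]

/-- The comparison estimate: the first-order variation of a solution of the equation along the
segment from `x₀` to `x` solves the equation along the segment from `x₀` to `x + h` up to
a quadratic error. -/
lemma norm_solution_sub_le {Γ : E → E →L[ℝ] 𝔸}
    {Γ' : E → E →L[ℝ] E →L[ℝ] 𝔸} {x₀ x h : E} {C r N : ℝ} (hC1 : 0 < C)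
    (hr1 : r ≤ 1)
    (hΓ : ∀ z ∈ ball x₀ r, HasFDerivAt Γ (Γ' z) z)
    (hC : ∀ z ∈ ball x₀ r, ‖Γ z‖ ≤ C) (hC' : ∀ z ∈ ball x₀ r, ‖Γ' z‖ ≤ C)
    (hlip : ∀ z ∈ ball x₀ r, ∀ z' ∈ ball x₀ r, dist (Γ' z) (Γ' z') ≤ C * dist z z')
    (hcurv : ∀ z ∈ ball x₀ r, ∀ u v, Γ' z u v + Γ z u * Γ z v = Γ' z v u + Γ z v * Γ z u)
    (hx : x ∈ ball x₀ r) (hxh : x + h ∈ ball x₀ r) (hh : ‖h‖ ≤ 1) {a₀ : 𝔸} {a g : ℝ → 𝔸}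
    (ha0 : a 0 = a₀) (hg0 : g 0 = a₀)
    (ha : ∀ t ∈ Icc (0 : ℝ) 1,
      HasDerivWithinAt a (a t * Γ (x₀ + t • (x - x₀)) (x - x₀)) (Icc 0 1) t)
    (hg : ∀ t ∈ Icc (0 : ℝ) 1,
      HasDerivWithinAt g (g t * Γ (x₀ + t • (x + h - x₀)) (x + h - x₀)) (Icc 0 1) t)
    (hN : ∀ t ∈ Icc (0 : ℝ) 1, ‖a t‖ ≤ N) :
    ‖g 1 - a 1 - a 1 * Γ x h‖ ≤
      (C * (C * N) + C * (C * N) + C * (N + C * N) + C * 2 * (N + C * N)) /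
        (2 * C) * (Real.exp (2 * C) - 1) * ‖h‖ ^ 2 := by
  set y := x - x₀ with hy
  set c : ℝ → E := fun t => x₀ + t • y with hc
  have hN0 : 0 ≤ N := (norm_nonneg _).trans (hN 0 (by simp))
  have hx0 : x₀ ∈ ball x₀ r := mem_ball_self (dist_nonneg.trans_lt hx)
  have e' : x + h - x₀ = y + h := by simp only [hy]; abel
  have e : ∀ t : ℝ, x₀ + t • (y + h) = c t + t • h := fun t => by simp only [hc]; module
  simp only [e', e] at hg
  have hcm : ∀ t ∈ Icc (0 : ℝ) 1, c t ∈ ball x₀ r := fun t ht =>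
    (convex_ball x₀ r).add_smul_sub_mem hx0 hx ht
  have hcm' : ∀ t ∈ Icc (0 : ℝ) 1, c t + t • h ∈ ball x₀ r := fun t ht => by
    have := (convex_ball x₀ r).add_smul_sub_mem hx0 hxh ht
    rwa [e', e] at this
  have hth : ∀ t ∈ Icc (0 : ℝ) 1, ‖t • h‖ ≤ ‖h‖ := fun t ht => by
    rw [norm_smul, Real.norm_of_nonneg ht.1]
    exact mul_le_of_le_one_left (norm_nonneg _) ht.2
  have hyn : ‖y‖ ≤ 1 := by
    have : ‖x - x₀‖ < r := by simpa [dist_eq_norm] using hx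
    exact this.le.trans hr1
  have hyhn : ‖y + h‖ ≤ 2 := (norm_add_le _ _).trans (by linarith)
  have htaylor : ∀ t ∈ Icc (0 : ℝ) 1,
      ‖Γ (c t + t • h) - Γ (c t) - Γ' (c t) (t • h)‖ ≤ C * ‖h‖ ^ 2 := fun t ht => by
    refine (norm_taylor_le (convex_ball x₀ r) hC1.le hΓ hlip (hcm t ht) (hcm' t ht)).trans ?_
    gcongr
    exact hth t ht
  -- The expected first-order change: if `A` solved dA = AΓ, moving from `c t` by `t • h` would
  -- change its value by `a t * Γ (c t) (t • h)` to first order.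
  set b : ℝ → 𝔸 := fun t => a t + a t * Γ (c t) (t • h) with hb
  set b' : ℝ → 𝔸 := fun t => a t * Γ (c t) y + (a t * Γ (c t) y * Γ (c t) (t • h) +
    a t * (Γ' (c t) y (t • h) + Γ (c t) h)) with hb'
  have hcd : ∀ t, HasDerivAt c y t := fun t => by
    simpa [hc] using ((hasDerivAt_id t).smul_const y).const_add x₀
  have hbd : ∀ t ∈ Icc (0 : ℝ) 1, HasDerivWithinAt b (b' t) (Icc 0 1) t := fun t ht => by
    have h1 : HasDerivWithinAt (fun t => Γ (c t)) (Γ' (c t) y) (Icc 0 1) t :=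
      ((hΓ _ (hcm t ht)).comp_hasDerivAt t (hcd t)).hasDerivWithinAt
    have h2 : HasDerivWithinAt (fun t : ℝ => t • h) h (Icc 0 1) t := by
      simpa using ((hasDerivAt_id t).smul_const h).hasDerivWithinAt
    exact (ha t ht).add ((ha t ht).mul (h1.clm_apply h2))
  have hconv : ∀ {f : ℝ → 𝔸} {f' : ℝ → 𝔸}, (∀ t ∈ Icc (0 : ℝ) 1, HasDerivWithinAt f (f' t)
      (Icc 0 1) t) → ContinuousOn f (Icc 0 1) ∧
      ∀ t ∈ Ico (0 : ℝ) 1, HasDerivWithinAt f (f' t) (Ici t) t := fun {f f'} hf =>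
    ⟨fun t ht => (hf t ht).continuousWithinAt, fun t ht =>
      (hf t (Ico_subset_Icc_self ht)).mono_of_mem_nhdsWithin (Icc_mem_nhdsGE_of_mem ht)⟩
  set Q := C * (C * N) + C * (C * N) + C * (N + C * N) + C * 2 * (N + C * N) with hQ
  have hlipv : ∀ t ∈ Ico (0 : ℝ) 1,
      LipschitzOnWith (2 * C).toNNReal (fun w => w * Γ (c t + t • h) (y + h)) univ := fun t ht => by
    refine (LipschitzWith.of_dist_le_mul fun w w' => ?_).lipschitzOnWith
    rw [dist_eq_norm, dist_eq_norm, ← sub_mul, Real.coe_toNNReal _ (by positivity), mul_comm (2 * C)]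
    refine (norm_mul_le _ _).trans (mul_le_mul_of_nonneg_left ?_ (norm_nonneg _))
    refine ((Γ _).le_opNorm _).trans ?_
    rw [mul_comm 2]
    exact mul_le_mul (hC _ (hcm' t (Ico_subset_Icc_self ht))) hyhn (norm_nonneg _) hC1.le
  have hbound : ∀ t ∈ Ico (0 : ℝ) 1,
      dist (b' t) (b t * Γ (c t + t • h) (y + h)) ≤ Q * ‖h‖ ^ 2 := fun t ht => by
    have ht := Ico_subset_Icc_self ht
    obtain ⟨R, hR⟩ : ∃ R, R = Γ (c t + t • h) - Γ (c t) - Γ' (c t) (t • h) := ⟨_, rfl⟩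
    have hΓR : Γ (c t + t • h) = Γ (c t) + Γ' (c t) (t • h) + R := by rw [hR]; abel
    have hRn : ‖R‖ ≤ C * ‖h‖ ^ 2 := by rw [hR]; exact htaylor t ht
    have hla : ‖a t * Γ (c t) (t • h)‖ ≤ C * N * ‖h‖ := by
      refine (norm_mul_le _ _).trans ?_
      calc ‖a t‖ * ‖Γ (c t) (t • h)‖ ≤ N * (C * ‖h‖) := by
            refine mul_le_mul (hN t ht) (((Γ (c t)).le_opNorm _).trans ?_) (norm_nonneg _) hN0
            exact mul_le_mul (hC _ (hcm t ht)) (hth t ht) (norm_nonneg _) hC1.le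
        _ = C * N * ‖h‖ := by ring
    have hbn : ‖b t‖ ≤ N + C * N := by
      refine (norm_add_le _ _).trans (add_le_add (hN t ht) (hla.trans ?_))
      exact mul_le_of_le_one_right (by positivity) hh
    -- Zero curvature exchanges the two arguments of Γ' at the cost of a commutator. All terms of
    -- order zero and one in `h` then cancel, and each of the four that remain is quadratic in `h`.
    have hdiff : b' t - b t * Γ (c t + t • h) (y + h) =
        - ((a t * Γ (c t) (t • h)) * Γ' (c t) (t • h) y) - (a t * Γ (c t) (t • h)) * Γ (c t) h
          - b t * Γ' (c t) (t • h) h - b t * R (y + h) := by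
      have hcv := hcurv (c t) (hcm t ht) y (t • h)
      have hcv' : Γ' (c t) y (t • h) = Γ' (c t) (t • h) y + Γ (c t) (t • h) * Γ (c t) y
          - Γ (c t) y * Γ (c t) (t • h) := eq_sub_of_add_eq hcv
      rw [hΓR]
      simp only [hb', hb, add_apply, map_add, hcv']
      noncomm_ring
    have hΓ'n : ∀ k : E, ‖Γ' (c t) (t • h) k‖ ≤ C * ‖h‖ * ‖k‖ := fun k => by
      refine ((Γ' (c t)).le_opNorm₂ _ _).trans ?_
      exact mul_le_mul_of_nonneg_right (mul_le_mul (hC' _ (hcm t ht)) (hth t ht) (norm_nonneg _)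
        hC1.le) (norm_nonneg _)
    have i1 : ‖(a t * Γ (c t) (t • h)) * Γ' (c t) (t • h) y‖ ≤ C * N * ‖h‖ * (C * ‖h‖ * 1) := by
      refine (norm_mul_le _ _).trans (mul_le_mul hla ((hΓ'n y).trans ?_) (norm_nonneg _)
        (by positivity))
      gcongr
    have i2 : ‖(a t * Γ (c t) (t • h)) * Γ (c t) h‖ ≤ C * N * ‖h‖ * (C * ‖h‖) := by
      refine (norm_mul_le _ _).trans (mul_le_mul hla (((Γ (c t)).le_opNorm _).trans ?_)
        (norm_nonneg _) (by positivity))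
      exact mul_le_mul_of_nonneg_right (hC _ (hcm t ht)) (norm_nonneg _)
    have i3 : ‖b t * Γ' (c t) (t • h) h‖ ≤ (N + C * N) * (C * ‖h‖ * ‖h‖) :=
      (norm_mul_le _ _).trans (mul_le_mul hbn (hΓ'n h) (norm_nonneg _) (by positivity))
    have i4 : ‖b t * R (y + h)‖ ≤ (N + C * N) * (C * ‖h‖ ^ 2 * 2) :=
      (norm_mul_le _ _).trans (mul_le_mul hbn ((R.le_opNorm _).trans
        (mul_le_mul hRn hyhn (norm_nonneg _) (by positivity))) (norm_nonneg _) (by positivity))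
    rw [dist_eq_norm, hdiff]
    refine (norm_sub_le _ _).trans ((add_le_add (norm_sub_le _ _) le_rfl).trans
      ((add_le_add (add_le_add (norm_sub_le _ _) le_rfl) le_rfl).trans ?_))
    rw [norm_neg]
    have : Q * ‖h‖ ^ 2 = C * N * ‖h‖ * (C * ‖h‖ * 1) + C * N * ‖h‖ * (C * ‖h‖) +
      (N + C * N) * (C * ‖h‖ * ‖h‖) + (N + C * N) * (C * ‖h‖ ^ 2 * 2) := by rw [hQ]; ring
    rw [this]
    exact add_le_add (add_le_add (add_le_add i1 i2) i3) i4
  -- Grönwall's inequality: `g` is an exact solution, `b` an approximate one with error `Q * ‖h‖ ^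
  -- 2`, and both start at `a₀`. The Lipschitz constant is 2C because ‖y + h‖ ≤ 2.
  have key := dist_le_of_approx_trajectories_ODE_of_mem (a := 0) (b := 1)
    (v := fun t w => w * Γ (c t + t • h) (y + h)) (s := fun _ => univ)
    (f := b) (f' := b') (g := g) (εf := Q * ‖h‖ ^ 2) (εg := 0) (δ := 0)
    hlipv (hconv hbd).1 (hconv hbd).2 hbound
    (fun _ _ => trivial) (hconv hg).1 (hconv hg).2 (fun t _ => by simp) (fun _ _ => trivial)
    (by simp [hb, ha0, hg0]) 1 (by simp)
  rw [Real.coe_toNNReal _ (by positivity : (0 : ℝ) ≤ 2 * C),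
    gronwallBound_of_K_ne_0 (by positivity), dist_eq_norm, norm_sub_rev] at key
  have e1 : c 1 = x := by simp [hc, hy]
  have e2 : g 1 - b 1 = g 1 - a 1 - a 1 * Γ x h := by
    simp only [hb, e1, one_smul]; abel
  rw [e2] at key
  refine key.trans (le_of_eq ?_)
  simp only [sub_zero, mul_one, zero_mul, zero_add, add_zero]
  ring

set_option synthInstance.maxHeartbeats 200000 in
/-- The Frobenius theorem for linear total differential equations: if the connection form `Γ` has
no curvature, then the equation `dA = A Γ` has a solution near `x₀` with any given value
at `x₀`. -/
theorem exists_hasFDerivAt_of_curvature_eq_zero [CompleteSpace 𝔸] {Γ : E → E →L[ℝ] 𝔸}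
    {x₀ : E} (hΓ : ContDiffAt ℝ 2 Γ x₀)
    (hcurv : ∀ᶠ x in 𝓝 x₀, ∀ u v, fderiv ℝ Γ x u v + Γ x u * Γ x v =
      fderiv ℝ Γ x v u + Γ x v * Γ x u) (a₀ : 𝔸) :
    ∃ A : E → 𝔸, A x₀ = a₀ ∧ ∀ᶠ x in 𝓝 x₀,
      HasFDerivAt A (ContinuousLinearMap.mul ℝ 𝔸 (A x) ∘L Γ x) x := by
  have hd : ∀ᶠ x in 𝓝 x₀, HasFDerivAt Γ (fderiv ℝ Γ x) x := by
    filter_upwards [hΓ.eventually (by simp)] with x hx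
    exact (hx.differentiableAt (by simp)).hasFDerivAt
  have hΓ1 : ContDiffAt ℝ 1 (fderiv ℝ Γ) x₀ := hΓ.fderiv_right (by norm_num [one_add_one_eq_two])
  obtain ⟨K, s, hs, hlip⟩ := hΓ1.exists_lipschitzOnWith
  obtain ⟨C₁, hC₁⟩ := eventually_norm_le_of_continuousAt hΓ.continuousAt
  obtain ⟨C₂, hC₂⟩ := eventually_norm_le_of_continuousAt hΓ1.continuousAt
  obtain ⟨r₀, hr₀, hball⟩ := Metric.eventually_nhds_iff_ball.1
    (hd.and (hcurv.and (hC₁.and (hC₂.and hs))))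
  obtain ⟨C, hCdef⟩ : ∃ C : ℝ, C = max (max C₁ C₂) (max K 1) := ⟨_, rfl⟩
  have hC1 : 0 < C := by
    rw [hCdef]
    exact zero_lt_one.trans_le ((le_max_right _ _).trans (le_max_right _ _))
  -- The bound 1 is for the comparison estimate, the bound 1/(2C) for solvability along the segments
  -- up to time 1.
  obtain ⟨r, hr⟩ : ∃ r : ℝ, r = min (min r₀ 1) (1 / (2 * C)) := ⟨_, rfl⟩
  have hrpos : 0 < r := by rw [hr]; positivity
  have hrr : r ≤ r₀ ∧ r ≤ 1 ∧ r ≤ 1 / (2 * C) := by simp [hr]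
  have hCC : C₁ ≤ C ∧ C₂ ≤ C ∧ K ≤ C := by simp [hCdef]
  have hsub : ball x₀ r ⊆ ball x₀ r₀ := ball_subset_ball hrr.1
  have hCn : ∀ z ∈ ball x₀ r, ‖Γ z‖ ≤ C := fun z hz =>
    (hball z (hsub hz)).2.2.1.trans hCC.1
  have hdr : ∀ z ∈ ball x₀ r, HasFDerivAt Γ (fderiv ℝ Γ z) z := fun z hz => (hball z (hsub hz)).1
  have hsol : ∀ x : E, ∃ a : ℝ → 𝔸, x ∈ ball x₀ r → a 0 = a₀ ∧ ∀ t ∈ Icc (0 : ℝ) 1,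
      HasDerivWithinAt a (a t * Γ (x₀ + t • (x - x₀)) (x - x₀)) (Icc 0 1) t := fun x => by
    by_cases hx : x ∈ ball x₀ r
    · obtain ⟨a, ha⟩ := exists_solution_along_ray
        (fun z hz => (hdr z hz).continuousAt.continuousWithinAt) hCn hx (by
          have h1 : ‖x - x₀‖ ≤ 1 / (2 * C) :=
            (by simpa [dist_eq_norm] using hx : ‖x - x₀‖ < r).le.trans hrr.2.2
          calc C * ‖x - x₀‖ ≤ C * (1 / (2 * C)) := by gcongr
            _ = 1 / 2 := by field_simp) a₀
      exact ⟨a, fun _ => ha⟩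
    · exact ⟨0, fun h => (hx h).elim⟩
  choose a ha using hsol
  refine ⟨fun x => a x 1, ?_, ?_⟩
  -- The segment from `x₀` to itself is constant, so the equation along it has zero right-hand side.
  · have h := (ha x₀ (mem_ball_self hrpos))
    have := constant_of_has_deriv_right_zero (f := a x₀) (a := 0) (b := 1)
      (fun t ht => (h.2 t ht).continuousWithinAt) (fun t ht => by
        have := (h.2 t (Ico_subset_Icc_self ht)).mono_of_mem_nhdsWithin (Icc_mem_nhdsGE_of_mem ht)
        simpa using this) 1 (by simp)
    exact this.trans h.1
  · filter_upwards [isOpen_ball.mem_nhds (mem_ball_self hrpos : x₀ ∈ ball x₀ r)] with x hx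
    obtain ⟨N, hN⟩ : ∃ N, ∀ t ∈ Icc (0 : ℝ) 1, ‖a x t‖ ≤ N := by
      have hcont : ContinuousOn (a x) (Icc 0 1) :=
        fun t ht => ((ha x hx).2 t ht).continuousWithinAt
      exact isCompact_Icc.exists_bound_of_continuousOn hcont
    -- A quadratic remainder gives differentiability of the endpoint value and identifies its
    -- derivative as AΓ, without differentiating the flow in its parameters.
    have hO : (fun x' => a x' 1 - a x 1 - a x 1 * Γ x (x' - x)) =O[𝓝 x]
        fun x' => ‖x' - x‖ ^ 2 := by
      refine Asymptotics.IsBigO.of_bound ((C * (C * N) + C * (C * N) + C * (N + C * N) +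
        C * 2 * (N + C * N)) / (2 * C) * (Real.exp (2 * C) - 1)) ?_
      filter_upwards [isOpen_ball.mem_nhds hx, ball_mem_nhds x one_pos] with x' hx' hx'1
      rw [Real.norm_of_nonneg (by positivity : (0 : ℝ) ≤ ‖x' - x‖ ^ 2)]
      refine norm_solution_sub_le (x := x) (h := x' - x) (g := a x') (a := a x) hC1
        hrr.2.1 hdr hCn
        (fun z hz => (hball z (hsub hz)).2.2.2.1.trans hCC.2.1)
        (fun z hz z' hz' => ?_) (fun z hz => (hball z (hsub hz)).2.1) hx (by simpa using hx')
        (by simpa [dist_eq_norm] using le_of_lt (mem_ball.1 hx'1)) (ha x hx).1 (ha x' hx').1 (ha x hx).2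
        (by simpa using (ha x' hx').2) hN
      refine (hlip.dist_le_mul _ (hball z (hsub hz)).2.2.2.2 _ (hball z' (hsub hz')).2.2.2.2).trans ?_
      exact mul_le_mul_of_nonneg_right hCC.2.2 dist_nonneg
    have h0 := hO.hasFDerivAt (𝕜 := ℝ) one_lt_two
    have h1 := (ContinuousLinearMap.mul ℝ 𝔸 (a x 1) ∘L Γ x).hasFDerivAt (x := x)
    have h2 := (h0.add (h1.sub_const (a x 1 * Γ x x))).add_const (a x 1)
    rw [zero_add] at h2
    refine h2.congr_of_eventuallyEq (Filter.Eventually.of_forall fun x' => ?_)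
    simp [mul_sub]

end Frobenius

/-! ### Differentials of vector-valued functions on manifolds. -/

section ManifoldCalculus

open Set VectorField

variable {E V : Type*} [NormedAddCommGroup E] [NormedSpace ℝ E]
  [NormedAddCommGroup V] [NormedSpace ℝ V]
  {M : Type*} [TopologicalSpace M] [ChartedSpace E M]

lemma mvfderiv_congr {f g : M → V} {x : M} (h : f =ᶠ[𝓝 x] g) :
    mvfderiv 𝓘(ℝ, E) f x = mvfderiv 𝓘(ℝ, E) g x := by
  have h1 : mfderiv 𝓘(ℝ, E) 𝓘(ℝ, V) f x = mfderiv 𝓘(ℝ, E) 𝓘(ℝ, V) g x := h.mfderiv_eq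
  ext v
  exact congr($h1 v)

lemma mvfderiv_comp_fderiv {W : Type*} [NormedAddCommGroup W] [NormedSpace ℝ W] {g : V → W}
    {f : M → V} {x : M} (hg : DifferentiableAt ℝ g (f x)) (hf : MDiffAt f x)
    (v : TangentSpace 𝓘(ℝ, E) x) :
    mvfderiv 𝓘(ℝ, E) (g ∘ f) x v = fderiv ℝ g (f x) (mvfderiv 𝓘(ℝ, E) f x v) := by
  have h1 := mfderiv_comp_apply x hg.mdifferentiableAt hf v
  rw [mfderiv_eq_fderiv] at h1
  exact h1

variable [IsManifold 𝓘(ℝ, E) ω M]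

lemma contMDiffAt_mvfderiv_apply {f : M → V} {Y : (x : M) → TangentSpace 𝓘(ℝ, E) x} {x : M}
    {m k : ℕ∞ω} (hf : CMDiffAt k f x) (hY : CMDiffAt m (T% Y) x) (hmk : m + 1 ≤ k) :
    CMDiffAt m (fun y => mvfderiv 𝓘(ℝ, E) f y (Y y)) x := by
  have h1 := ContMDiffAt.mfderiv_const hf hmk
  have h2 := ContMDiffAt.clm_apply_of_inCoordinates h1 hY (hf.of_le (le_self_add.trans hmk))
  exact ((contMDiff_snd_tangentBundle_modelSpace V 𝓘(ℝ, V)).contMDiffAt).comp x h2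

lemma mdifferentiableAt_mvfderiv_apply {f : M → V} {Y : (x : M) → TangentSpace 𝓘(ℝ, E) x} {x : M}
    (hf : CMDiffAt 2 f x) (hY : MDiffAt (T% Y) x) :
    MDiffAt (fun y => mvfderiv 𝓘(ℝ, E) f y (Y y)) x := by
  have h1 := (ContMDiffAt.mfderiv_const (m := 1) hf (by norm_num [one_add_one_eq_two])
    ).mdifferentiableAt (by simp)
  have h2 := MDifferentiableAt.clm_apply_of_inCoordinates h1 hY (hf.mdifferentiableAt (by simp))
  exact (((contMDiff_snd_tangentBundle_modelSpace V 𝓘(ℝ, V) (n := 1)).contMDiffAt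
    ).mdifferentiableAt (by simp)).comp x h2

/-- The differential of a function, evaluated on a vector field, read in a chart. -/
lemma mvfderiv_eq_fderiv_comp_extChartAt_symm {f : M → V} {x y : M}
    (hy : y ∈ (extChartAt 𝓘(ℝ, E) x).source) (hf : MDiffAt f y) (v : TangentSpace 𝓘(ℝ, E) y) :
    mvfderiv 𝓘(ℝ, E) f y v =
      fderiv ℝ (f ∘ (extChartAt 𝓘(ℝ, E) x).symm) (extChartAt 𝓘(ℝ, E) x y)
        (mvfderiv 𝓘(ℝ, E) (extChartAt 𝓘(ℝ, E) x) y v) := by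
  set c := extChartAt 𝓘(ℝ, E) x with hc
  have hcy : c.symm (c y) = y := c.left_inv hy
  have hcs : MDiffAt c.symm (c y) :=
    (contMDiffOn_extChartAt_symm (n := ω) x).contMDiffAt
      ((isOpen_extChartAt_target x).mem_nhds (c.map_source hy)) |>.mdifferentiableAt (by simp)
  have hcd : MDiffAt c y :=
    (contMDiffAt_extChartAt' (n := ω) (by simpa [hc] using hy)).mdifferentiableAt (by simp)
  have hfc : MDiffAt (f ∘ c.symm) (c y) := MDifferentiableAt.comp (c y) (by rwa [hcy]) hcs
  have heq : f =ᶠ[𝓝 y] (f ∘ c.symm) ∘ c := by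
    filter_upwards [(isOpen_extChartAt_source x).mem_nhds hy] with z hz
    simp [c.left_inv hz]
  rw [mvfderiv_congr heq, mvfderiv_comp_fderiv hfc.differentiableAt hcd]

/-- In a chart, each iterated derivative is a second derivative of `f` plus the first derivative of
`f` applied to the derivative of the field. The second derivatives cancel by symmetry. This identity
is the source of flatness, vanishing torsion and d^∇J = 0 in the local model, and of the vanishing
brackets of coordinate fields. -/
theorem mvfderiv_mlieBracket [CompleteSpace E] {f : M → V}
    {X Y : (x : M) → TangentSpace 𝓘(ℝ, E) x} {x : M}
    (hf : CMDiffAt 2 f x) (hX : MDiffAt (T% X) x) (hY : MDiffAt (T% Y) x) :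
    mvfderiv 𝓘(ℝ, E) f x (mlieBracket 𝓘(ℝ, E) X Y x) =
      mvfderiv 𝓘(ℝ, E) (fun y => mvfderiv 𝓘(ℝ, E) f y (Y y)) x (X x) -
        mvfderiv 𝓘(ℝ, E) (fun y => mvfderiv 𝓘(ℝ, E) f y (X y)) x (Y x) := by
  set c := extChartAt 𝓘(ℝ, E) x with hc
  set F := f ∘ c.symm with hF
  have hcs : CMDiffAt ω c.symm (c x) :=
    (contMDiffOn_extChartAt_symm (n := ω) x).contMDiffAt (extChartAt_target_mem_nhds x)
  have hF2 : ContDiffAt ℝ 2 F (c x) := by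
    rw [← contMDiffAt_iff_contDiffAt]
    refine ContMDiffAt.comp (c x) ?_ (hcs.of_le le_top)
    rwa [c.left_inv (mem_extChartAt_source x)]
  -- The coordinate expression of `Z`; near `x` it is the differential of the chart applied to `Z`.
  let hat : ((x : M) → TangentSpace 𝓘(ℝ, E) x) → E → E := fun Z =>
    mpullbackWithin 𝓘(ℝ, E) 𝓘(ℝ, E) c.symm Z (range 𝓘(ℝ, E))
  have hhat : ∀ Z : (x : M) → TangentSpace 𝓘(ℝ, E) x, ∀ᶠ y in 𝓝 x,
      hat Z (c y) = mvfderiv 𝓘(ℝ, E) c y (Z y) := fun Z => by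
    filter_upwards [eventuallyEq_mpullback_mpullbackWithin_extChartAt (I := 𝓘(ℝ, E)) (s := univ)
      (x := x) Z |>.filter_mono (by simp), extChartAt_source_mem_nhds (I := 𝓘(ℝ, E)) x] with y hy hys
    have hinv : (mfderiv 𝓘(ℝ, E) 𝓘(ℝ, E) c y).IsInvertible :=
      isInvertible_mfderiv_extChartAt hys
    have h1 : mfderiv 𝓘(ℝ, E) 𝓘(ℝ, E) c y (Z y) =
        mfderiv 𝓘(ℝ, E) 𝓘(ℝ, E) c y ((mfderiv 𝓘(ℝ, E) 𝓘(ℝ, E) c y).inverse (hat Z (c y))) := by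
      conv_lhs => rw [hy]
      rfl
    rw [hinv.self_apply_inverse] at h1
    exact h1.symm
  have hdiff : ∀ Z : (x : M) → TangentSpace 𝓘(ℝ, E) x, MDiffAt (T% Z) x →
      DifferentiableAt ℝ (hat Z) (c x) := fun Z hZ => by
    have := MDifferentiableWithinAt.differentiableWithinAt_mpullbackWithin_vectorField
      (s := univ) hZ.mdifferentiableWithinAt
    exact DifferentiableWithinAt.differentiableAt this (by simp)
  have hcd : MDiffAt c x := (contMDiffAt_extChartAt (n := ω)).mdifferentiableAt (by simp)
  have hd : ∀ Z : (x : M) → TangentSpace 𝓘(ℝ, E) x, MDiffAt (T% Z) x →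
      ∀ v, mvfderiv 𝓘(ℝ, E) (fun y => mvfderiv 𝓘(ℝ, E) f y (Z y)) x v =
        fderiv ℝ (fderiv ℝ F) (c x) (mvfderiv 𝓘(ℝ, E) c x v) (hat Z (c x)) +
        fderiv ℝ F (c x) (fderiv ℝ (hat Z) (c x) (mvfderiv 𝓘(ℝ, E) c x v)) := fun Z hZ v => by
    have heq : (fun y => mvfderiv 𝓘(ℝ, E) f y (Z y)) =ᶠ[𝓝 x]
        (fun z => fderiv ℝ F z (hat Z z)) ∘ c := by
      filter_upwards [hhat Z, (contMDiffAt_iff_contMDiffAt_nhds (by simp)).1 hf, extChartAt_source_mem_nhds (I := 𝓘(ℝ, E)) x]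
        with y hy hfy hys
      rw [mvfderiv_eq_fderiv_comp_extChartAt_symm hys (hfy.mdifferentiableAt (by simp)), ← hc, ← hy]
      rfl
    have hF1 : DifferentiableAt ℝ (fderiv ℝ F) (c x) :=
      (hF2.fderiv_right (m := 1) (by norm_num [one_add_one_eq_two])).differentiableAt (by simp)
    have hg := hF1.hasFDerivAt.clm_apply (hdiff Z hZ).hasFDerivAt
    rw [mvfderiv_congr heq, mvfderiv_comp_fderiv hg.differentiableAt hcd, hg.fderiv]
    simp [add_comm]
  rw [hd X hX, hd Y hY, ← (hhat X).self_of_nhds, ← (hhat Y).self_of_nhds]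
  have hsymm := (hF2.isSymmSndFDerivAt (by simp)) (hat X (c x)) (hat Y (c x))
  rw [hsymm, mvfderiv_eq_fderiv_comp_extChartAt_symm (mem_extChartAt_source x)
    (hf.mdifferentiableAt (by simp))]
  have hbr : mvfderiv 𝓘(ℝ, E) c x (mlieBracket 𝓘(ℝ, E) X Y x) =
      lieBracket ℝ (hat X) (hat Y) (c x) := by
    have hinv : (mfderiv 𝓘(ℝ, E) 𝓘(ℝ, E) c x).IsInvertible :=
      isInvertible_mfderiv_extChartAt (mem_extChartAt_source x)
    change mfderiv 𝓘(ℝ, E) 𝓘(ℝ, E) c x (mlieBracketWithin 𝓘(ℝ, E) X Y univ x) = _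
    rw [mlieBracketWithin_apply]
    refine (hinv.self_apply_inverse _).trans ?_
    change lieBracketWithin ℝ (hat X) (hat Y) (c.symm ⁻¹' univ ∩ range 𝓘(ℝ, E)) (c x) = _
    rw [show c.symm ⁻¹' univ ∩ range 𝓘(ℝ, E) = univ by simp, lieBracketWithin_univ]
  rw [← hc, hbr, lieBracket_eq]
  simp only [map_sub]
  abel

end ManifoldCalculus

/-! ### The flat connection pulled back by a local diffeomorphism. -/

section FlatConnection

open Set VectorField

variable {E V : Type*} [NormedAddCommGroup E] [NormedSpace ℝ E]
  [NormedAddCommGroup V] [NormedSpace ℝ V]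
  {M : Type*} [TopologicalSpace M] [ChartedSpace E M]

/-- The flat connection pulled back from the vector space `V` by a local diffeomorphism `Φ`. -/
def flatCov (Φ : M → V) (Y : (x : M) → TangentSpace 𝓘(ℝ, E) x) (x : M) :
    TangentSpace 𝓘(ℝ, E) x →L[ℝ] TangentSpace 𝓘(ℝ, E) x :=
  (mvfderiv 𝓘(ℝ, E) Φ x).inverse ∘L
    mvfderiv 𝓘(ℝ, E) (fun y => mvfderiv 𝓘(ℝ, E) Φ y (Y y)) x

lemma mvfderiv_flatCov {Φ : M → V} {x : M} (h : (mvfderiv 𝓘(ℝ, E) Φ x).IsInvertible)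
    (Y : (x : M) → TangentSpace 𝓘(ℝ, E) x) (v : TangentSpace 𝓘(ℝ, E) x) :
    mvfderiv 𝓘(ℝ, E) Φ x (flatCov Φ Y x v) =
      mvfderiv 𝓘(ℝ, E) (fun y => mvfderiv 𝓘(ℝ, E) Φ y (Y y)) x v :=
  h.self_apply_inverse _

variable [IsManifold 𝓘(ℝ, E) ω M]

/-- Applying the injective dΦ turns both axioms into the sum and product rules for the vector-valued
function dΦ(Y). -/
theorem isCovariantDerivativeOn_flatCov {Φ : M → V} {s : Set M} (hΦ : ∀ x ∈ s, CMDiffAt 2 Φ x)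
    (h : ∀ x ∈ s, (mvfderiv 𝓘(ℝ, E) Φ x).IsInvertible) :
    IsCovariantDerivativeOn E (I := 𝓘(ℝ, E)) (flatCov Φ) s where
  add {σ σ' x} hσ hσ' hx := by
    ext v
    apply (h x hx).injective
    change mvfderiv 𝓘(ℝ, E) Φ x (flatCov Φ (σ + σ') x v) =
      mvfderiv 𝓘(ℝ, E) Φ x (flatCov Φ σ x v + flatCov Φ σ' x v)
    rw [map_add, mvfderiv_flatCov (h x hx), mvfderiv_flatCov (h x hx), mvfderiv_flatCov (h x hx)]
    have := mvfderiv_add (mdifferentiableAt_mvfderiv_apply (hΦ x hx) hσ)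
      (mdifferentiableAt_mvfderiv_apply (hΦ x hx) hσ')
    rw [show (fun y => mvfderiv 𝓘(ℝ, E) Φ y ((σ + σ') y)) =
      (fun y => mvfderiv 𝓘(ℝ, E) Φ y (σ y)) + (fun y => mvfderiv 𝓘(ℝ, E) Φ y (σ' y)) by
        ext y; exact map_add _ _ _, this]
    rfl
  leibniz {σ g x} hσ hg hx := by
    ext v
    apply (h x hx).injective
    change mvfderiv 𝓘(ℝ, E) Φ x (flatCov Φ (g • σ) x v) =
      mvfderiv 𝓘(ℝ, E) Φ x (g x • flatCov Φ σ x v + (mvfderiv 𝓘(ℝ, E) g x v) • σ x)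
    rw [map_add, map_smul, map_smul, mvfderiv_flatCov (h x hx), mvfderiv_flatCov (h x hx)]
    have := mvfderiv_smul hg (mdifferentiableAt_mvfderiv_apply (hΦ x hx) hσ)
    rw [show (fun y => mvfderiv 𝓘(ℝ, E) Φ y ((g • σ) y)) =
      g • (fun y => mvfderiv 𝓘(ℝ, E) Φ y (σ y)) by
        ext y; exact map_smul _ _ _, this]
    rfl

/-- Trivialized at `x₀`, the differentials of Φ and of dΦ(Y) become smooth families `P` and `Q` of
linear maps, and the covariant derivative becomes P⁻¹Q. Inversion is smooth at an invertible map. -/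
theorem contMDiffAt_flatCov [FiniteDimensional ℝ E] {Φ : M → V} {x₀ : M} (hΦ : CMDiffAt ∞ Φ x₀)
    (h : (mvfderiv 𝓘(ℝ, E) Φ x₀).IsInvertible)
    {Y : (x : M) → TangentSpace 𝓘(ℝ, E) x} (hY : CMDiffAt ∞ (T% Y) x₀) :
    ContMDiffAt 𝓘(ℝ, E) (𝓘(ℝ, E).prod 𝓘(ℝ, E →L[ℝ] E)) ∞
      (fun x => (⟨x, flatCov Φ Y x⟩ : Bundle.TotalSpace (E →L[ℝ] E)
        fun x : M => TangentSpace 𝓘(ℝ, E) x →L[ℝ] TangentSpace 𝓘(ℝ, E) x)) x₀ := by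
  rw [contMDiffAt_hom_bundle]
  refine ⟨contMDiffAt_id, ?_⟩
  set s : M → V := fun y => mvfderiv 𝓘(ℝ, E) Φ y (Y y) with hs
  have hsm : CMDiffAt ∞ s x₀ := contMDiffAt_mvfderiv_apply hΦ hY (by simp)
  have hP := ContMDiffAt.mfderiv_const (m := ∞) hΦ (by simp)
  have hQ := ContMDiffAt.mfderiv_const (m := ∞) hsm (by simp)
  -- `K` passes from the preferred chart at `x` to the one at `x₀`, and `K'` passes back. The
  -- trivialized covariant derivative is its conjugate by these two.
  let K : M → E →L[ℝ] E := fun x =>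
    (tangentBundleCore 𝓘(ℝ, E) M).coordChange (achart E x) (achart E x₀) x
  let K' : M → E →L[ℝ] E := fun x =>
    (tangentBundleCore 𝓘(ℝ, E) M).coordChange (achart E x₀) (achart E x) x
  have hKK : ∀ x ∈ (chartAt E x₀).source, ∀ v, K x (K' x v) = v := fun x hx v => by
    have := (tangentBundleCore 𝓘(ℝ, E) M).coordChange_comp (achart E x₀) (achart E x)
      (achart E x₀) x ⟨⟨hx, mem_chart_source E x⟩, hx⟩ v
    refine this.trans ?_
    exact (tangentBundleCore 𝓘(ℝ, E) M).coordChange_self (achart E x₀) x hx v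
  have hKK' : ∀ x ∈ (chartAt E x₀).source, ∀ v, K' x (K x v) = v := fun x hx v => by
    have := (tangentBundleCore 𝓘(ℝ, E) M).coordChange_comp (achart E x) (achart E x₀)
      (achart E x) x ⟨⟨mem_chart_source E x, hx⟩, mem_chart_source E x⟩ v
    refine this.trans ?_
    exact (tangentBundleCore 𝓘(ℝ, E) M).coordChange_self (achart E x) x (mem_chart_source E x) v
  have hcoord : ∀ f : M → V, ∀ x ∈ (chartAt E x₀).source,
      inTangentCoordinates 𝓘(ℝ, E) 𝓘(ℝ, V) id f (mfderiv 𝓘(ℝ, E) 𝓘(ℝ, V) f) x₀ x =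
        (mvfderiv 𝓘(ℝ, E) f x : E →L[ℝ] V) ∘L K' x := fun f x hx => by
    refine (inTangentCoordinates_eq id f _ hx (mem_chart_source V (f x))).trans ?_
    ext1 v
    exact (tangentBundleCore 𝓘(ℝ, V) V).coordChange_self (achart V (f x)) (f x)
      (mem_chart_source V (f x)) _
  have hsrc : ∀ᶠ x in 𝓝 x₀, x ∈ (chartAt E x₀).source := chart_source_mem_nhds E x₀
  set P := inTangentCoordinates 𝓘(ℝ, E) 𝓘(ℝ, V) id Φ (mfderiv 𝓘(ℝ, E) 𝓘(ℝ, V) Φ) x₀ with hPdef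
  set Q := inTangentCoordinates 𝓘(ℝ, E) 𝓘(ℝ, V) id s (mfderiv 𝓘(ℝ, E) 𝓘(ℝ, V) s) x₀ with hQdef
  have hPc : ∀ x ∈ (chartAt E x₀).source, P x = (mvfderiv 𝓘(ℝ, E) Φ x : E →L[ℝ] V) ∘L K' x :=
    hcoord Φ
  have hQc : ∀ x ∈ (chartAt E x₀).source, Q x = (mvfderiv 𝓘(ℝ, E) s x : E →L[ℝ] V) ∘L K' x :=
    hcoord s
  obtain ⟨e, he⟩ := h
  have : CompleteSpace E := FiniteDimensional.complete ℝ E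
  have hK0 : K' x₀ = ContinuousLinearMap.id ℝ E := by
    ext1 v
    exact (tangentBundleCore 𝓘(ℝ, E) M).coordChange_self (achart E x₀) x₀ (mem_chart_source E x₀) v
  let e' : E ≃L[ℝ] V := e
  have hP0 : P x₀ = (e' : E →L[ℝ] V) := by
    rw [hPc x₀ (mem_chart_source E x₀), hK0, ← he]
    rfl
  have hinvs : ContDiffAt ℝ ∞ (ContinuousLinearMap.inverse : (E →L[ℝ] V) → V →L[ℝ] E) (P x₀) := by
    rw [hP0]
    exact contDiffAt_map_inverse e'
  have hPinv : ∀ᶠ x in 𝓝 x₀, (P x).IsInvertible := by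
    have : Set.range ((↑) : (E ≃L[ℝ] V) → E →L[ℝ] V) ∈ 𝓝 (P x₀) := hP0 ▸ e'.nhds
    filter_upwards [hP.continuousAt.preimage_mem_nhds this] with x hx
    exact hx
  have hfin : CMDiffAt ∞ (fun x => (P x).inverse ∘L Q x) x₀ :=
    ContMDiffAt.clm_comp (hinvs.contMDiffAt.comp x₀ hP) hQ
  refine hfin.congr_of_eventuallyEq ?_
  filter_upwards [hsrc, hPinv] with x hx hxP
  change inTangentCoordinates 𝓘(ℝ, E) 𝓘(ℝ, E) id id (flatCov Φ Y) x₀ x = _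
  refine (inTangentCoordinates_eq id id _ hx hx).trans ?_
  rw [hQc x hx]
  ext1 v
  apply hxP.injective
  change P x (K x (flatCov Φ Y x (K' x v))) =
    P x ((P x).inverse (mvfderiv 𝓘(ℝ, E) s x (K' x v)))
  rw [hxP.self_apply_inverse, hPc x hx]
  have hinv : (mvfderiv 𝓘(ℝ, E) Φ x).IsInvertible := by
    obtain ⟨f, hf⟩ := hxP
    have hf' : ∀ v, f v = mvfderiv 𝓘(ℝ, E) Φ x (K' x v) := fun v => by
      have := congr($hf v)
      rw [hPc x hx] at this
      exact this
    let k : E ≃L[ℝ] E := ContinuousLinearEquiv.equivOfInverse (K x) (K' x) (hKK' x hx) (hKK x hx)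
    refine ⟨(k.trans f : E ≃L[ℝ] V), ?_⟩
    ext v
    exact (hf' (K x v)).trans (congrArg (mvfderiv 𝓘(ℝ, E) Φ x) (hKK' x hx v))
  exact (congrArg (mvfderiv 𝓘(ℝ, E) Φ x) (hKK' x hx _)).trans (mvfderiv_flatCov hinv Y _)

lemma mvfderiv_bilin_apply {V₁ W : Type*} [NormedAddCommGroup V₁] [NormedSpace ℝ V₁]
    [NormedAddCommGroup W] [NormedSpace ℝ W]
    (B : V₁ →L[ℝ] V →L[ℝ] W) {f : M → V₁} {g : M → V} {x : M} (hf : MDiffAt f x) (hg : MDiffAt g x)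
    (v : TangentSpace 𝓘(ℝ, E) x) :
    mvfderiv 𝓘(ℝ, E) (fun y => B (f y) (g y)) x v =
      B (mvfderiv 𝓘(ℝ, E) f x v) (g x) + B (f x) (mvfderiv 𝓘(ℝ, E) g x v) := by
  set c := extChartAt 𝓘(ℝ, E) x with hc
  have hcs : MDiffAt c.symm (c x) :=
    ((contMDiffOn_extChartAt_symm (n := ω) x).contMDiffAt
      (extChartAt_target_mem_nhds x)).mdifferentiableAt (by simp)
  have hx : c.symm (c x) = x := c.left_inv (mem_extChartAt_source x)
  have hf' : DifferentiableAt ℝ (f ∘ c.symm) (c x) :=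
    (MDifferentiableAt.comp (c x) (by rwa [hx]) hcs).differentiableAt
  have hg' : DifferentiableAt ℝ (g ∘ c.symm) (c x) :=
    (MDifferentiableAt.comp (c x) (by rwa [hx]) hcs).differentiableAt
  have hB : MDiffAt (fun y => B (f y) (g y)) x := by
    have h1 : MDifferentiableAt 𝓘(ℝ, E) 𝓘(ℝ, V →L[ℝ] W) (fun y => B (f y)) x :=
      B.differentiableAt.mdifferentiableAt.comp x hf
    exact h1.clm_apply hg
  rw [mvfderiv_eq_fderiv_comp_extChartAt_symm (mem_extChartAt_source x) hf,
    mvfderiv_eq_fderiv_comp_extChartAt_symm (mem_extChartAt_source x) hg,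
    mvfderiv_eq_fderiv_comp_extChartAt_symm (mem_extChartAt_source x) hB, ← hc]
  have h1 := ((B.hasFDerivAt.comp (c x) hf'.hasFDerivAt).clm_apply hg'.hasFDerivAt).fderiv
  change fderiv ℝ (fun y => B ((f ∘ c.symm) y) ((g ∘ c.symm) y)) (c x) _ = _
  refine congr($h1 _).trans ?_
  simp [hx, add_comm]

end FlatConnection

/-! ### Special complex and symplectic structures from a map to a vector space. -/

section SpecialComplex

lemma two_le_infty : (2 : WithTop ℕ∞) ≤ ∞ := WithTop.coe_le_coe.2 le_top

variable {n : ℕ} {M : Type*} [TopologicalSpace M] [ChartedSpace (Fin n → ℂ) M]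
  [IsManifold 𝓘(ℂ, Fin n → ℂ) ω M]
  {V W : Type*} [NormedAddCommGroup V] [NormedSpace ℝ V] [NormedAddCommGroup W] [NormedSpace ℝ W]
  [NormedSpace ℂ W]

lemma contMDiff_nabla {D : Connection n M} (hD : D.ContMDiffCovariantDerivative ∞)
    {X Y : VField n M} (hX : IsSmoothField X) (hY : IsSmoothField Y) :
    IsSmoothField (nabla D X Y) := by
  have h1 := hD.contMDiff.contMDiff (σ := Y) (by
    intro x _
    exact (hY x).contMDiffWithinAt)
  intro x
  exact ContMDiffAt.clm_bundle_apply (b := fun x => x) (h1.contMDiffAt Filter.univ_mem) (hX x)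

/-- Parallelism expands the three derivatives into six terms w(∇·,·), vanishing torsion expands the
brackets into the same six terms, and alternation matches their signs. -/
lemma isSymplectic_closed_of_isParallel {D : Connection n M} {w : BilinField n M}
    (hw : ∀ (x : M) (u : TangentSpace 𝓘(ℝ, Fin n → ℂ) x), w x u u = 0) (hT : D.torsion = 0)
    (hp : IsParallel D w) {X Y Z : VField n M} (hX : IsSmoothField X) (hY : IsSmoothField Y)
    (hZ : IsSmoothField Z) (x : M) :
    along X (eval w Y Z) x + along Y (eval w Z X) x + along Z (eval w X Y) x
      - eval w (bracket X Y) Z x - eval w (bracket Y Z) X x - eval w (bracket Z X) Y x = 0 := by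
  have hanti : ∀ u v, w x u v = - w x v u := fun u v => by
    have := hw x (u + v)
    simp only [map_add, add_apply, hw] at this
    linarith
  have hd : ∀ {X : VField n M}, IsSmoothField X → MDifferentiableAt 𝓘(ℝ, Fin n → ℂ) 𝓘(ℝ, Fin n → ℂ).tangent
    (fun y => (⟨y, X y⟩ : TangentBundle 𝓘(ℝ, Fin n → ℂ) M)) x := fun h =>
    (h x).mdifferentiableAt (by simp)
  rw [hp X Y Z hX hY hZ, hp Y Z X hY hZ hX, hp Z X Y hZ hX hY]
  rw [CovariantDerivative.torsion_eq_zero_iff] at hT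
  simp only [eval, bracket, nabla, ← hT (hd hX) (hd hY), ← hT (hd hY) (hd hZ), ← hT (hd hZ) (hd hX),
    map_sub, sub_apply]
  rw [hanti (Y x), hanti (Z x), hanti (X x)]
  ring

variable {Φ : M → V} (hΦ : ContMDiff 𝓘(ℝ, Fin n → ℂ) 𝓘(ℝ, V) ∞ Φ)
  (hinv : ∀ x, (mvfderiv 𝓘(ℝ, Fin n → ℂ) Φ x).IsInvertible)

/-- The flat connection pulled back by a local diffeomorphism `Φ` with values in a vector space. -/
def flatConnection (hΦ : ContMDiff 𝓘(ℝ, Fin n → ℂ) 𝓘(ℝ, V) ∞ Φ)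
    (hinv : ∀ x, (mvfderiv 𝓘(ℝ, Fin n → ℂ) Φ x).IsInvertible) : Connection n M where
  toFun := flatCov Φ
  isCovariantDerivativeOnUniv := isCovariantDerivativeOn_flatCov
    (fun x _ => (hΦ x).of_le two_le_infty) (fun x _ => hinv x)

lemma mvfderiv_flatConnection (Y : VField n M) (x : M) (v : TangentSpace 𝓘(ℝ, Fin n → ℂ) x) :
    mvfderiv 𝓘(ℝ, Fin n → ℂ) Φ x (flatConnection hΦ hinv Y x v) =
      mvfderiv 𝓘(ℝ, Fin n → ℂ) (fun y => mvfderiv 𝓘(ℝ, Fin n → ℂ) Φ y (Y y)) x v :=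
  mvfderiv_flatCov (hinv x) Y v

lemma contMDiffCovariantDerivative_flatConnection :
    (flatConnection hΦ hinv).ContMDiffCovariantDerivative ∞ where
  contMDiff := ⟨fun hσ x _ => (contMDiffAt_flatCov (hΦ x) (hinv x)
    ((hσ x trivial).contMDiffAt Filter.univ_mem)).contMDiffWithinAt⟩

lemma contMDiff_mvfderiv_apply {f : M → V} (hf : ContMDiff 𝓘(ℝ, Fin n → ℂ) 𝓘(ℝ, V) ∞ f) {Y : VField n M}
    (hY : IsSmoothField Y) : ContMDiff 𝓘(ℝ, Fin n → ℂ) 𝓘(ℝ, V) ∞ (fun y => mvfderiv 𝓘(ℝ, Fin n → ℂ) f y (Y y)) :=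
  fun x => contMDiffAt_mvfderiv_apply (hf x) (hY x) (by simp)

lemma mvfderiv_bracket {f : M → V} (hf : ContMDiff 𝓘(ℝ, Fin n → ℂ) 𝓘(ℝ, V) ∞ f) {X Y : VField n M} (hX : IsSmoothField X)
    (hY : IsSmoothField Y) (x : M) :
    mvfderiv 𝓘(ℝ, Fin n → ℂ) f x (bracket X Y x) =
      mvfderiv 𝓘(ℝ, Fin n → ℂ) (fun y => mvfderiv 𝓘(ℝ, Fin n → ℂ) f y (Y y)) x (X x) -
        mvfderiv 𝓘(ℝ, Fin n → ℂ) (fun y => mvfderiv 𝓘(ℝ, Fin n → ℂ) f y (X y)) x (Y x) :=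
  mvfderiv_mlieBracket ((hf x).of_le two_le_infty)
    ((hX x).mdifferentiableAt (by simp)) ((hY x).mdifferentiableAt (by simp))

lemma torsion_flatConnection : (flatConnection hΦ hinv).torsion = 0 := by
  rw [CovariantDerivative.torsion_eq_zero_iff]
  intro X Y x hX hY
  apply (hinv x).injective
  rw [map_sub, mvfderiv_flatConnection, mvfderiv_flatConnection]
  exact (mvfderiv_mlieBracket ((hΦ x).of_le two_le_infty) hX hY).symm

/-- After applying dΦ, the curvature identity is the bracket formula for the vector-valued function
dΦ(Z). -/
lemma isFlat_flatConnection : IsFlat (flatConnection hΦ hinv) := by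
  intro X Y Z hX hY hZ
  ext1 x
  apply (hinv x).injective
  change mvfderiv 𝓘(ℝ, Fin n → ℂ) Φ x (_ - _ - _) = mvfderiv 𝓘(ℝ, Fin n → ℂ) Φ x 0
  simp only [map_sub, map_zero, nabla, mvfderiv_flatConnection]
  rw [mvfderiv_bracket (contMDiff_mvfderiv_apply hΦ hZ) hX hY]
  abel

/-- Since dφ is complex linear, dΦ(JY) = ρ(i dφ(Y)). So dΦ sends ∇_X(JY) - ∇_Y(JX) to ρ(i dφ([X,Y]))
by the bracket formula for φ. By vanishing torsion it sends J(∇_X Y - ∇_Y X) = J[X,Y] to the same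
vector. -/
theorem isSpecialComplex_flatConnection {φ : M → W} {ρ : W →L[ℝ] V} (hφ : ContMDiff 𝓘(ℝ, Fin n → ℂ) 𝓘(ℝ, W) ∞ φ)
    (hJ : ∀ x v, mvfderiv 𝓘(ℝ, Fin n → ℂ) φ x (J n x v) =
      Complex.I • mvfderiv 𝓘(ℝ, Fin n → ℂ) φ x v) (hρ : ∀ x, Φ x = ρ (φ x)) :
    IsSpecialComplex (flatConnection hΦ hinv) where
  smooth := contMDiffCovariantDerivative_flatConnection hΦ hinv
  flat := isFlat_flatConnection hΦ hinv
  torsionfree := torsion_flatConnection hΦ hinv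
  dJ_eq_zero X Y hX hY := by
    have hd : ∀ {g : M → W} {x : M}, MDifferentiableAt 𝓘(ℝ, Fin n → ℂ) 𝓘(ℝ, W) g x → ∀ (τ : W →L[ℝ] V)
        (v : TangentSpace 𝓘(ℝ, Fin n → ℂ) x), mvfderiv 𝓘(ℝ, Fin n → ℂ) (fun y => τ (g y)) x v =
          τ (mvfderiv 𝓘(ℝ, Fin n → ℂ) g x v) := fun {g x} hg τ v => by
      have := mvfderiv_comp_fderiv (g := τ) τ.differentiableAt hg v
      rwa [τ.fderiv] at this
    have hdΦ : ∀ x v, mvfderiv 𝓘(ℝ, Fin n → ℂ) Φ x v =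
        ρ (mvfderiv 𝓘(ℝ, Fin n → ℂ) φ x v) := fun x v => by
      rw [← hd ((hφ x).mdifferentiableAt (by simp)) ρ v]
      congr 3
      ext1 y
      exact hρ y
    -- The map for which dΦ ∘ J = τ ∘ dφ.
    let τ : W →L[ℝ] V := ρ ∘L (Complex.I • ContinuousLinearMap.id ℝ W)
    have hJn : ∀ {Y : VField n M}, IsSmoothField Y → ∀ x v, mvfderiv 𝓘(ℝ, Fin n → ℂ)
        (fun y => mvfderiv 𝓘(ℝ, Fin n → ℂ) Φ y (J n y (Y y))) x v =
        τ (mvfderiv 𝓘(ℝ, Fin n → ℂ) (fun y => mvfderiv 𝓘(ℝ, Fin n → ℂ) φ y (Y y)) x v) := by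
      intro Y hY x v
      rw [← hd ((contMDiff_mvfderiv_apply hφ hY x).mdifferentiableAt (by simp))]
      simp only [hdΦ, hJ]
      rfl
    ext1 x
    apply (hinv x).injective
    change mvfderiv 𝓘(ℝ, Fin n → ℂ) Φ x ((_ - _) - (_ - _)) = mvfderiv 𝓘(ℝ, Fin n → ℂ) Φ x 0
    have hT := torsion_flatConnection hΦ hinv
    rw [CovariantDerivative.torsion_eq_zero_iff] at hT
    have hT' : flatConnection hΦ hinv Y x (X x) - flatConnection hΦ hinv X x (Y x) =
      bracket X Y x := hT ((hX x).mdifferentiableAt (by simp)) ((hY x).mdifferentiableAt (by simp))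
    have hdJ : mvfderiv 𝓘(ℝ, Fin n → ℂ) Φ x (J n x (flatConnection hΦ hinv Y x (X x))) -
        mvfderiv 𝓘(ℝ, Fin n → ℂ) Φ x (J n x (flatConnection hΦ hinv X x (Y x))) =
        τ (mvfderiv 𝓘(ℝ, Fin n → ℂ) φ x (bracket X Y x)) := by
      rw [← map_sub, ← map_sub, hT', hdΦ, hJ]
      rfl
    rw [mvfderiv_bracket hφ hX hY, map_sub] at hdJ
    simp only [map_sub, map_zero, nabla, mvfderiv_flatConnection, hJn hX, hJn hY]
    rw [sub_sub_sub_comm, hdJ, sub_self]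

/-- The pullback of a bilinear form by a map to a vector space. -/
def pullbackForm (Φ : M → V) (B : V →L[ℝ] V →L[ℝ] ℝ) : BilinField n M := fun x =>
  let A : (Fin n → ℂ) →L[ℝ] V := mvfderiv 𝓘(ℝ, Fin n → ℂ) Φ x
  (B.bilinearComp A A : (Fin n → ℂ) →L[ℝ] (Fin n → ℂ) →L[ℝ] ℝ)

omit [IsManifold 𝓘(ℂ, Fin n → ℂ) ω M] in
lemma pullbackForm_apply (Φ : M → V) (B : V →L[ℝ] V →L[ℝ] ℝ) (x : M)
    (u v : TangentSpace 𝓘(ℝ, Fin n → ℂ) x) : pullbackForm Φ B x u v =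
      B (mvfderiv 𝓘(ℝ, Fin n → ℂ) Φ x u) (mvfderiv 𝓘(ℝ, Fin n → ℂ) Φ x v) := rfl

lemma isParallel_pullbackForm (B : V →L[ℝ] V →L[ℝ] ℝ) :
    IsParallel (flatConnection hΦ hinv) (pullbackForm Φ B) := by
  intro X Y Z hX hY hZ x
  refine (mvfderiv_bilin_apply B ((contMDiff_mvfderiv_apply hΦ hY x).mdifferentiableAt (by simp))
    ((contMDiff_mvfderiv_apply hΦ hZ x).mdifferentiableAt (by simp)) (X x)).trans ?_
  simp only [eval, nabla, pullbackForm_apply, mvfderiv_flatConnection]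

include hΦ hinv in
lemma isSymplectic_pullbackForm {B : V →L[ℝ] V →L[ℝ] ℝ} (hB : ∀ u, B u u = 0)
    (hB' : ∀ u, (∀ v, B u v = 0) → u = 0) : IsSymplectic (n := n) (pullbackForm Φ B) where
  alternating x u := hB _
  smooth X Y hX hY := by
    intro x
    have h1 := contMDiff_mvfderiv_apply hΦ hX x
    have h2 := contMDiff_mvfderiv_apply hΦ hY x
    have h3 : ContMDiffAt 𝓘(ℝ, Fin n → ℂ) 𝓘(ℝ, V →L[ℝ] ℝ) ∞
        (fun y => B (mvfderiv 𝓘(ℝ, Fin n → ℂ) Φ y (X y))) x :=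
      B.contMDiff.contMDiffAt.comp x h1
    exact h3.clm_apply h2
  nondegenerate x u hu := by
    apply (hinv x).injective
    rw [map_zero]
    refine hB' _ fun v => ?_
    obtain ⟨v, rfl⟩ := (hinv x).surjective v
    exact hu v
  closed X Y Z hX hY hZ x := isSymplectic_closed_of_isParallel (fun x u => hB _)
    (torsion_flatConnection hΦ hinv) (isParallel_pullbackForm hΦ hinv B) hX hY hZ x

lemma isAffineFun_flatConnection (l : V →L[ℝ] ℝ) :
    IsAffineFun (flatConnection hΦ hinv) (fun x => l (Φ x)) := by
  refine ⟨l.contMDiff.comp hΦ, fun X Y hX hY x => ?_⟩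
  have hd : ∀ {g : M → V} {x : M}, MDifferentiableAt 𝓘(ℝ, Fin n → ℂ) 𝓘(ℝ, V) g x →
      ∀ (v : TangentSpace 𝓘(ℝ, Fin n → ℂ) x), dReal (n := n) (fun y => l (g y)) x v =
        l (mvfderiv 𝓘(ℝ, Fin n → ℂ) g x v) := fun {g x} hg v => by
    have := mvfderiv_comp_fderiv (g := l) l.differentiableAt hg v
    rw [l.fderiv] at this
    exact this
  have h1 : along Y (fun x => l (Φ x)) =
      fun x => l (mvfderiv 𝓘(ℝ, Fin n → ℂ) Φ x (Y x)) := by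
    ext1 x
    exact hd ((hΦ x).mdifferentiableAt (by simp)) _
  rw [h1, along, along, hd ((contMDiff_mvfderiv_apply hΦ hY x).mdifferentiableAt (by simp)),
    hd ((hΦ x).mdifferentiableAt (by simp)), nabla, mvfderiv_flatConnection]

end SpecialComplex

/-! ### Cauchy's formula on polydiscs and Osgood's lemma. -/

section Osgood

open MeasureTheory Set Metric Complex

/-- Cauchy's integral formula on a polydisc. -/
theorem torusIntegral_prod_sub_inv_mul {R : ℝ} (hR : 0 < R) : ∀ {n : ℕ} {c w : Fin n → ℂ}
    {f : (Fin n → ℂ) → ℂ}, (∀ z ∈ closedBall c R, DifferentiableAt ℂ f z) → w ∈ ball c R →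
    torusIntegral (fun ζ => (∏ i, (ζ i - w i)⁻¹) * f ζ) c (fun _ => R) =
      (2 * Real.pi * I) ^ n * f w
  | 0, c, w, f, hf, hw => by
    simp [Subsingleton.elim c w]
  | n + 1, c, w, f, hf, hw => by
    have hmem : ∀ θ, torusMap c (fun _ => R) θ ∈ closedBall c R := fun θ => by
      rw [mem_closedBall, dist_pi_le_iff hR.le]
      intro i
      simp [torusMap, dist_eq_norm, abs_of_pos hR]
    have hne : ∀ (x : ℂ) (i : Fin (n + 1)), ‖x - c i‖ = R → x - w i ≠ 0 := fun x i hx h => by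
      have h1 := (dist_pi_lt_iff hR).1 (mem_ball.1 hw) i
      rw [sub_eq_zero] at h
      rw [← h, dist_eq_norm, hx] at h1
      exact h1.false
    have hcont : Continuous fun θ : Fin (n + 1) → ℝ => torusMap c (fun _ => R) θ := by
      unfold torusMap
      fun_prop
    have hint : TorusIntegrable (fun ζ => (∏ i, (ζ i - w i)⁻¹) * f ζ) c (fun _ => R) := by
      refine (Continuous.continuousOn ?_).integrableOn_compact isCompact_Icc
      refine (continuous_finsetProd _ fun i _ => ?_).mul ?_
      · refine Continuous.inv₀ (by fun_prop) fun θ => hne _ i ?_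
        simp [torusMap, abs_of_pos hR]
      · exact continuous_iff_continuousAt.2 fun θ =>
          ContinuousAt.comp (f := fun θ => torusMap c (fun _ => R) θ)
            (hf _ (hmem θ)).continuousAt hcont.continuousAt
    have hcons : ∀ x ∈ closedBall (c 0) R, ∀ y ∈ closedBall (c ∘ Fin.succ) R,
        (Fin.cons x y : Fin (n + 1) → ℂ) ∈ closedBall c R := fun x hx y hy => by
      rw [mem_closedBall, dist_pi_le_iff hR.le] at hy ⊢
      intro i
      refine Fin.cases ?_ (fun j => ?_) i
      · simpa using hx
      · simpa using hy j
    have hw' : w ∘ Fin.succ ∈ ball (c ∘ Fin.succ) R := by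
      rw [mem_ball, dist_pi_lt_iff hR] at hw ⊢
      exact fun i => hw i.succ
    have hw0 : w 0 ∈ ball (c 0) R := (dist_pi_lt_iff hR).1 (mem_ball.1 hw) 0
    have hdiff1 : ∀ y, Differentiable ℂ (fun x : ℂ => (Fin.cons x y : Fin (n + 1) → ℂ)) := by
      intro y
      rw [differentiable_pi]
      intro i
      refine Fin.cases ?_ (fun j => ?_) i
      · simp
      · simp
    have hdiff2 : ∀ x, Differentiable ℂ (fun y => (Fin.cons x y : Fin (n + 1) → ℂ)) := by
      intro x
      rw [differentiable_pi]
      intro i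
      refine Fin.cases ?_ (fun j => ?_) i
      · simp
      · simpa using differentiable_apply j
    have hd : ∀ x ∈ closedBall (c 0) R, DifferentiableAt ℂ
        (fun x => (2 * Real.pi * I) ^ n * f (Fin.cons x (w ∘ Fin.succ))) x := fun x hx => by
      have h1 : DifferentiableAt ℂ (fun x => f (Fin.cons x (w ∘ Fin.succ))) x :=
        DifferentiableAt.comp (g := f) (f := fun x => (Fin.cons x (w ∘ Fin.succ) : Fin (n + 1) → ℂ))
          x (hf _ (hcons x hx _ (ball_subset_closedBall hw'))) (hdiff1 _ x)
      exact h1.const_mul _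
    rw [torusIntegral_succ hint]
    -- With the first variable fixed, the inner integral is Cauchy's formula in `n` variables by
    -- recursion. The remaining circle integral is the one-variable formula.
    have key : ∀ x ∈ sphere (c 0) R,
        torusIntegral (fun y => (∏ i, ((Fin.cons x y : Fin (n + 1) → ℂ) i - w i)⁻¹) *
          f (Fin.cons x y)) (c ∘ Fin.succ) ((fun _ => R) ∘ Fin.succ) =
        (x - w 0)⁻¹ • ((2 * Real.pi * I) ^ n * f (Fin.cons x (w ∘ Fin.succ))) := fun x hx => by
      rw [smul_eq_mul, ← torusIntegral_prod_sub_inv_mul hR (c := c ∘ Fin.succ)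
        (f := fun y => f (Fin.cons x y)) (fun y hy => DifferentiableAt.comp y (hf _ (hcons x (sphere_subset_closedBall hx) y hy))
          (hdiff2 x y)) hw', ← torusIntegral_const_mul]
      congr 1
      ext y
      rw [Fin.prod_univ_succ]
      simp [mul_assoc]
    rw [circleIntegral.integral_congr hR.le key,
      circleIntegral_sub_inv_smul_of_differentiable_on_off_countable countable_empty hw0]
    · rw [smul_eq_mul, ← mul_assoc, ← pow_succ', show (Fin.cons (w 0) (w ∘ Fin.succ) : Fin (n + 1) → ℂ) = w
        from Fin.cons_self_tail w]
    · exact fun x hx => (hd x hx).continuousAt.continuousWithinAt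
    · exact fun x hx => hd x (ball_subset_closedBall hx.1)

/-- **Osgood's lemma**: a complex differentiable function of several variables is analytic. -/
theorem analyticAt_of_eventually_differentiableAt_scalar {n : ℕ} {f : (Fin n → ℂ) → ℂ}
    {c : Fin n → ℂ} (hf : ∀ᶠ z in 𝓝 c, DifferentiableAt ℂ f z) : AnalyticAt ℂ f c := by
  obtain ⟨R, hR, hfR⟩ := nhds_basis_closedBall.mem_iff.1 hf
  -- The Cauchy kernel is treated as a map κ into a Banach algebra of functions of the angles. There
  -- it is a product of inverses of elements affine in `z`, hence analytic, because inversion is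
  -- analytic at units. Cauchy's formula then writes `f` as a continuous linear functional of κ.
  let 𝔸 := BoundedContinuousFunction (Fin n → ℝ) ℂ
  let S : Set (Fin n → ℝ) := Icc 0 fun _ => 2 * Real.pi
  let e : Fin n → 𝔸 := fun i => BoundedContinuousFunction.ofNormedAddCommGroup
    (fun θ => R * exp (θ i * I)) (by fun_prop) R (fun θ => by simp [abs_of_pos hR])
  let e' : Fin n → 𝔸 := fun i => BoundedContinuousFunction.ofNormedAddCommGroup
    (fun θ => (R * exp (θ i * I))⁻¹)
    (Continuous.inv₀ (by fun_prop) fun θ => by simp [hR.ne']) R⁻¹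
    (fun θ => by simp [abs_of_pos hR])
  have hR' : (R : ℂ) ≠ 0 := by exact_mod_cast hR.ne'
  let u : Fin n → 𝔸ˣ := fun i => ⟨e i, e' i, by
    ext θ
    exact mul_inv_cancel₀ (mul_ne_zero hR' (exp_ne_zero _)), by
    ext θ
    exact inv_mul_cancel₀ (mul_ne_zero hR' (exp_ne_zero _))⟩
  let κ : (Fin n → ℂ) → 𝔸 := fun z => ∏ i, Ring.inverse (e i + algebraMap ℂ 𝔸 (c i - z i))
  -- The product is the Jacobian factor of the parametrization of the torus by angles.
  let weight : (Fin n → ℝ) → ℂ := fun θ => (∏ i, R * exp (θ i * I) * I) *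
    f (torusMap c (fun _ => R) θ)
  have hmem : ∀ θ, torusMap c (fun _ => R) θ ∈ closedBall c R := fun θ => by
    rw [mem_closedBall, dist_pi_le_iff hR.le]
    intro i
    simp [torusMap, dist_eq_norm, abs_of_pos hR]
  have hcont : Continuous fun θ : Fin n → ℝ => torusMap c (fun _ => R) θ := by
    unfold torusMap
    fun_prop
  have hweight : Continuous weight := by
    refine Continuous.mul (by fun_prop) ?_
    exact continuous_iff_continuousAt.2 fun θ =>
      ContinuousAt.comp (f := fun θ => torusMap c (fun _ => R) θ)
        (hfR (hmem θ)).continuousAt hcont.continuousAt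
  obtain ⟨C, hC⟩ := isCompact_Icc.exists_bound_of_continuousOn (s := S) hweight.continuousOn
  have hint : ∀ g : 𝔸, IntegrableOn (fun θ => weight θ * g θ) S := fun g =>
    (hweight.mul g.continuous).continuousOn.integrableOn_compact isCompact_Icc
  let l : 𝔸 →L[ℂ] ℂ := LinearMap.mkContinuous
    { toFun := fun g => ∫ θ in S, weight θ * g θ
      map_add' := fun g h => by
        rw [← integral_add (hint g) (hint h)]
        congr 1
        ext θ
        exact mul_add _ _ _
      map_smul' := fun a g => by
        rw [RingHom.id_apply, ← integral_smul]
        congr 1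
        ext θ
        exact mul_left_comm _ _ _ } (C * (volume S).toReal) fun g => by
      have := norm_setIntegral_le_of_norm_le_const (μ := volume) (s := S) (C := C * ‖g‖)
        (f := fun θ => weight θ * g θ) isCompact_Icc.measure_lt_top (fun θ hθ => by
          rw [norm_mul]
          exact mul_le_mul (hC θ hθ) (g.norm_coe_le_norm θ) (norm_nonneg _)
            ((norm_nonneg _).trans (hC θ hθ)))
      refine this.trans_eq ?_
      rw [Measure.real]
      ring
  have hκ : AnalyticAt ℂ κ c := by
    refine Finset.analyticAt_fun_prod _ fun i _ => ?_
    have h1 : AnalyticAt ℂ (fun z : Fin n → ℂ => e i + algebraMap ℂ 𝔸 (c i - z i)) c := by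
      refine analyticAt_const.add ?_
      have : AnalyticAt ℂ (fun z : Fin n → ℂ => c i - z i) c :=
        analyticAt_const.sub ((ContinuousLinearMap.proj (R := ℂ) i).analyticAt c)
      exact ((Algebra.linearMap ℂ 𝔸).mkContinuous 1 (fun x => by
        simp [norm_algebraMap']) |>.analyticAt _).comp this
    have h2 : e i + algebraMap ℂ 𝔸 (c i - c i) = u i := by simp [u]
    exact AnalyticAt.fun_comp (by rw [h2]; exact analyticAt_inverse (u i)) h1
  have hfin : AnalyticAt ℂ (fun z => ((2 * Real.pi * I) ^ n)⁻¹ * l (κ z)) c :=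
    analyticAt_const.mul ((l.analyticAt _).comp hκ)
  refine hfin.congr ?_
  -- `Ring.inverse` is a genuine inverse only at units, and these elements stay units for `z` near
  -- `c`.
  have hunit : ∀ᶠ z in 𝓝 c, ∀ i, IsUnit (e i + algebraMap ℂ 𝔸 (c i - z i)) := by
    rw [Filter.eventually_all]
    intro i
    have h1 : ContinuousAt (fun z : Fin n → ℂ => e i + algebraMap ℂ 𝔸 (c i - z i)) c := by
      refine continuousAt_const.add ?_
      exact (continuous_algebraMap ℂ 𝔸).continuousAt.comp
        (continuousAt_const.sub (continuous_apply i).continuousAt)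
    refine h1.eventually (Units.isOpen.mem_nhds ?_)
    have h2 : e i + algebraMap ℂ 𝔸 (c i - c i) = u i := by simp [u]
    exact (h2 ▸ (u i).isUnit : IsUnit (e i + algebraMap ℂ 𝔸 (c i - c i)))
  filter_upwards [hunit, ball_mem_nhds c hR] with z hz hzR
  have h1 := torusIntegral_prod_sub_inv_mul hR hfR hzR
  rw [inv_mul_eq_iff_eq_mul₀ (pow_ne_zero _ (by simp [Real.pi_ne_zero])), ← h1]
  change ∫ θ in S, weight θ * κ z θ = _
  refine setIntegral_congr_fun measurableSet_Icc fun θ _ => ?_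
  have hk : κ z θ = ∏ i, (torusMap c (fun _ => R) θ i - z i)⁻¹ := by
    have h2 : κ z θ = ∏ i, (Ring.inverse (e i + algebraMap ℂ 𝔸 (c i - z i)) : 𝔸) θ := by
      have := congrFun (BoundedContinuousFunction.coe_prod Finset.univ
        fun i => (Ring.inverse (e i + algebraMap ℂ 𝔸 (c i - z i)) : 𝔸)) θ
      rw [Finset.prod_apply] at this
      exact this
    rw [h2]
    refine Finset.prod_congr rfl fun i _ => ?_
    have h3 := congrArg (fun g : 𝔸 => g θ) (Ring.mul_inverse_cancel _ (hz i))
    have h4 : (e i + algebraMap ℂ 𝔸 (c i - z i)) θ = torusMap c (fun _ => R) θ i - z i := by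
      have h5 : (algebraMap ℂ 𝔸 (c i - z i)) θ = c i - z i := by
        rw [BoundedContinuousFunction.algebraMap_apply]
        simp
      change R * exp (θ i * I) + (algebraMap ℂ 𝔸 (c i - z i)) θ = c i + R * exp (θ i * I) - z i
      rw [h5]
      ring
    refine eq_inv_of_mul_eq_one_right ?_
    rw [← h4]
    exact h3
  simp only [hk, weight, smul_eq_mul]
  ring

theorem analyticAt_of_eventually_differentiableAt {n : ℕ} {ι : Type*} [Fintype ι]
    {f : (Fin n → ℂ) → ι → ℂ} {c : Fin n → ℂ} (hf : ∀ᶠ z in 𝓝 c, DifferentiableAt ℂ f z) :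
    AnalyticAt ℂ f c := by
  refine analyticAt_pi_iff.2 fun i => analyticAt_of_eventually_differentiableAt_scalar ?_
  filter_upwards [hf] with z hz
  exact differentiableAt_pi.1 hz i

end Osgood

/-! ### Calculus on open subsets of a vector space. -/

section OpenSubsets

open TopologicalSpace

variable {E V : Type*} [NormedAddCommGroup E] [NormedSpace ℝ E]
  [NormedAddCommGroup V] [NormedSpace ℝ V]

lemma hasMFDerivAt_subtype_val (U : Opens E) (x : U) :
    HasMFDerivAt 𝓘(ℝ, E) 𝓘(ℝ, E) (Subtype.val : U → E) x (ContinuousLinearMap.id ℝ E) := by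
  refine ⟨continuous_subtype_val.continuousAt, ?_⟩
  have h1 : writtenInExtChartAt 𝓘(ℝ, E) 𝓘(ℝ, E) x (Subtype.val : U → E) =ᶠ[𝓝 (x : E)] id := by
    have := Opens.chartAt_subtype_val_symm_eventuallyEq (H := E) U (x := x)
    exact this.symm
  have h2 : extChartAt 𝓘(ℝ, E) x x = (x : E) := rfl
  rw [h2]
  exact ((hasFDerivAt_id (x : E)).congr_of_eventuallyEq h1).hasFDerivWithinAt

lemma mvfderiv_comp_subtype_val (U : Opens E) {g : E → V} {x : U}
    (hg : DifferentiableAt ℝ g x) (v : E) :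
    mvfderiv 𝓘(ℝ, E) (fun y : U => g y) x v = fderiv ℝ g x v := by
  have h1 := mvfderiv_comp_fderiv (f := (Subtype.val : U → E)) (g := g) hg
    (hasMFDerivAt_subtype_val U x).mdifferentiableAt v
  refine h1.trans ?_
  change fderiv ℝ g x (mfderiv 𝓘(ℝ, E) 𝓘(ℝ, E) (Subtype.val : U → E) x v) = _
  rw [(hasMFDerivAt_subtype_val U x).mfderiv]
  rfl

/-- Constant vector fields on an open subset of a vector space are smooth. -/
lemma contMDiff_const_field [CompleteSpace E] (U : Opens E) (u : E) :
    ContMDiff 𝓘(ℝ, E) 𝓘(ℝ, E).tangent ∞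
      (fun x => (⟨x, u⟩ : TangentBundle 𝓘(ℝ, E) U)) := by
  have hval : ContMDiff 𝓘(ℝ, E) 𝓘(ℝ, E) ∞ (Subtype.val : U → E) := contMDiff_subtype_val
  have h2 : ContMDiff 𝓘(ℝ, E) 𝓘(ℝ, E).tangent ∞
      (fun x : E => (⟨x, u⟩ : TangentBundle 𝓘(ℝ, E) E)) :=
    contMDiff_vectorSpace_iff_contDiff.2 contDiff_const
  have h3 := ContMDiff.mpullback_vectorField (n := ∞) (m := ∞) h2 hval (fun x => by
    rw [(hasMFDerivAt_subtype_val U x).mfderiv]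
    exact ⟨ContinuousLinearEquiv.refl ℝ E, rfl⟩) (by simp)
  refine h3.congr fun x => ?_
  have h4 : (mfderiv 𝓘(ℝ, E) 𝓘(ℝ, E) (Subtype.val : U → E) x).inverse u = u := by
    rw [(hasMFDerivAt_subtype_val U x).mfderiv]
    exact congr($(ContinuousLinearMap.inverse_id (R := ℝ) (M := E)) u)
  exact (congrArg (Bundle.TotalSpace.mk x) h4).symm

end OpenSubsets

/-! ### The special Kähler structure induced by dF, and its uniqueness. -/

section LocalModel

open TopologicalSpace

variable {n : ℕ} {U : Opens (Fin n → ℂ)} {F : (Fin n → ℂ) → ℂ}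

/-- The real part of a point of `T*ℂⁿ`. -/
def rePart (n : ℕ) : ((Fin n → ℂ) × (Fin n → ℂ)) →L[ℝ] ((Fin n → ℝ) × (Fin n → ℝ)) :=
  let r : (Fin n → ℂ) →L[ℝ] (Fin n → ℝ) :=
    ContinuousLinearMap.pi fun i => Complex.reCLM ∘L ContinuousLinearMap.proj i
  r.prodMap r

/-- Twice the standard symplectic form of `T*ℝⁿ`. -/
def stdForm (n : ℕ) : ((Fin n → ℝ) × (Fin n → ℝ)) →L[ℝ] ((Fin n → ℝ) × (Fin n → ℝ)) →L[ℝ] ℝ :=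
  let x (i : Fin n) : ((Fin n → ℝ) × (Fin n → ℝ)) →L[ℝ] ℝ :=
    ContinuousLinearMap.proj i ∘L ContinuousLinearMap.fst ℝ _ _
  let y (i : Fin n) : ((Fin n → ℝ) × (Fin n → ℝ)) →L[ℝ] ℝ :=
    ContinuousLinearMap.proj i ∘L ContinuousLinearMap.snd ℝ _ _
  (2 : ℝ) • ∑ i, ((x i).smulRight (y i) - (y i).smulRight (x i))

set_option synthInstance.maxHeartbeats 200000 in
lemma stdForm_apply (p q : (Fin n → ℝ) × (Fin n → ℝ)) :
    stdForm n p q = 2 * ∑ i, (p.1 i * q.2 i - q.1 i * p.2 i) := by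
  simp [stdForm, sum_apply, mul_comm]

lemma stdForm_self (p : (Fin n → ℝ) × (Fin n → ℝ)) : stdForm n p p = 0 := by
  simp [stdForm_apply]

lemma eq_zero_of_stdForm_eq_zero {p : (Fin n → ℝ) × (Fin n → ℝ)}
    (h : ∀ q, stdForm n p q = 0) : p = 0 := by
  ext i
  · simpa [stdForm_apply, Pi.single_apply] using h (0, Pi.single i 1)
  · simpa [stdForm_apply, Pi.single_apply] using h (Pi.single i 1, 0)

lemma analyticAt_partialC {z : Fin n → ℂ} (hF : AnalyticAt ℂ F z) (i : Fin n) :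
    AnalyticAt ℂ (partialC F i) z :=
  ((ContinuousLinearMap.apply ℂ ℂ (Pi.single i (1 : ℂ) : Fin n → ℂ)).analyticAt _).comp hF.fderiv

lemma fderiv_eq_sum_partialC (z u : Fin n → ℂ) :
    fderiv ℂ F z u = ∑ j, u j * partialC F j z := by
  conv_lhs => rw [pi_eq_sum_univ' u, map_sum]
  simp only [partialC, map_smul, smul_eq_mul]

lemma partialC_comm {z : Fin n → ℂ} (hF : AnalyticAt ℂ F z) (i j : Fin n) :
    partialC (partialC F i) j z = partialC (partialC F j) i z := by
  have h1 : ∀ i, HasFDerivAt (partialC F i) ((ContinuousLinearMap.apply ℂ ℂ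
      (Pi.single i (1 : ℂ) : Fin n → ℂ)) ∘L fderiv ℂ (fderiv ℂ F) z) z := fun i =>
    ((ContinuousLinearMap.apply ℂ ℂ (Pi.single i (1 : ℂ) : Fin n → ℂ)).hasFDerivAt).comp z
      hF.fderiv.differentiableAt.hasFDerivAt
  have h2 : IsSymmSndFDerivAt ℂ F z := (hF.contDiffAt (n := 2)).isSymmSndFDerivAt (by simp)
  rw [partialC, partialC, (h1 i).fderiv, (h1 j).fderiv]
  exact h2 _ _

/-- The extension of `dSection U F` to `ℂⁿ`. -/
def gradGraph (F : (Fin n → ℂ) → ℂ) (z : Fin n → ℂ) : (Fin n → ℂ) × (Fin n → ℂ) :=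
  (z, fun i => partialC F i z)

/-- The differential of `gradGraph F`. -/
def gradGraphDeriv (F : (Fin n → ℂ) → ℂ) (z : Fin n → ℂ) :
    (Fin n → ℂ) →L[ℂ] (Fin n → ℂ) × (Fin n → ℂ) :=
  (ContinuousLinearMap.id ℂ _).prod (ContinuousLinearMap.pi fun i => fderiv ℂ (partialC F i) z)

lemma hasFDerivAt_gradGraph {z : Fin n → ℂ} (hF : AnalyticAt ℂ F z) :
    HasFDerivAt (gradGraph F) (gradGraphDeriv F z) z :=
  (hasFDerivAt_id z).prodMk (hasFDerivAt_pi.2 fun i =>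
    (analyticAt_partialC hF i).differentiableAt.hasFDerivAt)

lemma analyticAt_gradGraph {z : Fin n → ℂ} (hF : AnalyticAt ℂ F z) :
    AnalyticAt ℂ (gradGraph F) z :=
  analyticAt_id.prod (AnalyticAt.pi fun i => analyticAt_partialC hF i)

/-- A vector killed by dx is purely imaginary, say u = iv with v real. Then dy(u) = -Im(∂²F) v, and
this vanishes only for v = 0. -/
lemma injective_re_gradGraphDeriv {z : Fin n → ℂ}
    (h : IsUnit (Matrix.of fun i j : Fin n => (partialC (partialC F i) j z).im)) {u : Fin n → ℂ}
    (hu : rePart n (gradGraphDeriv F z u) = 0) : u = 0 := by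
  have h1 : ∀ i, (u i).re = 0 := fun i => congrFun (congrArg Prod.fst hu) i
  have h2 : ∀ i, (fderiv ℂ (partialC F i) z u).re = 0 := fun i => congrFun (congrArg Prod.snd hu) i
  have h3 : (Matrix.of fun i j : Fin n => (partialC (partialC F i) j z).im).mulVec
      (fun j => (u j).im) = 0 := by
    ext i
    have := h2 i
    rw [fderiv_eq_sum_partialC, Complex.re_sum] at this
    simp only [Complex.mul_re, h1, zero_mul, zero_sub, Finset.sum_neg_distrib, neg_eq_zero] at this
    simpa [Matrix.mulVec, dotProduct, mul_comm] using this
  have h4 := Matrix.mulVec_injective_of_isUnit h (h3.trans (Matrix.mulVec_zero _).symm)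
  ext i
  exact Complex.ext (h1 i) (congrFun h4 i)

/-- Multiplication by i replaces real parts by minus imaginary parts, so the difference of the two
sides is -2 times the real part of Σ dzⁱ ∧ dwᵢ. That form vanishes on the tangent space of the graph
of dF because the Hessian is symmetric. -/
lemma stdForm_gradGraphDeriv_I_smul {z : Fin n → ℂ} (hF : AnalyticAt ℂ F z) (u v : Fin n → ℂ) :
    stdForm n (rePart n (gradGraphDeriv F z (Complex.I • u)))
      (rePart n (gradGraphDeriv F z (Complex.I • v))) =
    stdForm n (rePart n (gradGraphDeriv F z u)) (rePart n (gradGraphDeriv F z v)) := by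
  have h1 : ∑ i, u i * fderiv ℂ (partialC F i) z v = ∑ i, v i * fderiv ℂ (partialC F i) z u := by
    simp only [fderiv_eq_sum_partialC, Finset.mul_sum]
    rw [Finset.sum_comm]
    refine Finset.sum_congr rfl fun i _ => Finset.sum_congr rfl fun j _ => ?_
    rw [partialC_comm hF]
    ring
  have h2 := congrArg Complex.re h1
  rw [Complex.re_sum, Complex.re_sum, ← sub_eq_zero, ← Finset.sum_sub_distrib] at h2
  rw [stdForm_apply, stdForm_apply, ← sub_eq_zero, ← mul_sub, ← Finset.sum_sub_distrib,
    mul_eq_zero]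
  right
  rw [← neg_eq_zero, ← Finset.sum_neg_distrib, ← h2]
  refine Finset.sum_congr rfl fun i _ => ?_
  simp only [rePart, gradGraphDeriv, map_smul]
  simp [Complex.mul_re]
  ring

lemma isInvertible_re_gradGraphDeriv {z : Fin n → ℂ}
    (h : IsUnit (Matrix.of fun i j : Fin n => (partialC (partialC F i) j z).im)) :
    (rePart n ∘L (gradGraphDeriv F z).restrictScalars ℝ).IsInvertible := by
  set A := rePart n ∘L (gradGraphDeriv F z).restrictScalars ℝ with hA
  have hinj : Function.Injective A :=
    (injective_iff_map_eq_zero A).2 fun u hu => injective_re_gradGraphDeriv h hu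
  have hfin : Module.finrank ℝ (Fin n → ℂ) = Module.finrank ℝ ((Fin n → ℝ) × (Fin n → ℝ)) := by
    simp [Module.finrank_pi_fintype, Complex.finrank_real_complex]
    ring
  let e := LinearEquiv.ofInjectiveOfFinrankEq (A : (Fin n → ℂ) →ₗ[ℝ] _) hinj hfin
  exact ⟨e.toContinuousLinearEquiv, by ext1; rfl⟩

namespace IsNondegenerateHolomorphic

lemma analyticAt (hF : IsNondegenerateHolomorphic U F) {z : Fin n → ℂ} (hz : z ∈ U) :
    AnalyticAt ℂ F z := by
  refine analyticAt_of_eventually_differentiableAt_scalar ?_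
  filter_upwards [U.isOpen.mem_nhds hz] with w hw
  exact hF.holomorphic.differentiableAt (U.isOpen.mem_nhds hw)

lemma hasFDerivAt_re (hF : IsNondegenerateHolomorphic U F) {z : Fin n → ℂ} (hz : z ∈ U) :
    HasFDerivAt (𝕜 := ℝ) (fun z => rePart n (gradGraph F z))
      (rePart n ∘L (gradGraphDeriv F z).restrictScalars ℝ) z :=
  (rePart n).hasFDerivAt.comp z ((hasFDerivAt_gradGraph (hF.analyticAt hz)).restrictScalars ℝ)

lemma contMDiff_dSection (hF : IsNondegenerateHolomorphic U F) :
    ContMDiff 𝓘(ℝ, Fin n → ℂ) 𝓘(ℝ, (Fin n → ℂ) × (Fin n → ℂ)) ∞ (dSection U F) := fun x =>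
  ContMDiffAt.comp (g := gradGraph F) (f := (Subtype.val : U → Fin n → ℂ)) x
    (((analyticAt_gradGraph (hF.analyticAt x.2)).contDiffAt (n := ∞)).restrict_scalars ℝ).contMDiffAt
    (contMDiff_subtype_val (n := ∞) (I := 𝓘(ℝ, Fin n → ℂ)) x)

lemma contMDiff_re (hF : IsNondegenerateHolomorphic U F) :
    ContMDiff 𝓘(ℝ, Fin n → ℂ) 𝓘(ℝ, (Fin n → ℝ) × (Fin n → ℝ)) ∞
      (fun x => rePart n (dSection U F x)) :=
  (rePart n).contMDiff.comp hF.contMDiff_dSection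

lemma mvfderiv_dSection (hF : IsNondegenerateHolomorphic U F) (x : U) (v : Fin n → ℂ) :
    mvfderiv 𝓘(ℝ, Fin n → ℂ) (dSection U F) x v = gradGraphDeriv F x v := by
  have h1 := (hasFDerivAt_gradGraph (hF.analyticAt x.2)).restrictScalars ℝ
  refine (mvfderiv_comp_subtype_val U h1.differentiableAt v).trans ?_
  rw [h1.fderiv]
  rfl

lemma mvfderiv_re (hF : IsNondegenerateHolomorphic U F) (x : U) :
    (mvfderiv 𝓘(ℝ, Fin n → ℂ) (fun x => rePart n (dSection U F x)) x :
      (Fin n → ℂ) →L[ℝ] _) = rePart n ∘L (gradGraphDeriv F x).restrictScalars ℝ := by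
  ext1 v
  have h1 := hF.hasFDerivAt_re x.2
  refine (mvfderiv_comp_subtype_val U h1.differentiableAt v).trans ?_
  rw [h1.fderiv]
  rfl

lemma isInvertible_mvfderiv_re (hF : IsNondegenerateHolomorphic U F) (x : U) :
    (mvfderiv 𝓘(ℝ, Fin n → ℂ) (fun x => rePart n (dSection U F x)) x).IsInvertible := by
  have := isInvertible_re_gradGraphDeriv (hF.nondegenerate x x.2)
  rw [← hF.mvfderiv_re x] at this
  exact this

lemma dReal_x (hF : IsNondegenerateHolomorphic U F) (x : U) (v : Fin n → ℂ) (i : Fin n) :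
    dReal (n := n) (fun q => ((dSection U F q).1 i).re) x v =
      (rePart n (gradGraphDeriv F x v)).1 i := by
  have h1 := (((ContinuousLinearMap.proj (R := ℝ) (φ := fun _ : Fin n => ℝ) i) ∘L
    ContinuousLinearMap.fst ℝ (Fin n → ℝ) (Fin n → ℝ)).hasFDerivAt).comp (x : Fin n → ℂ)
      (hF.hasFDerivAt_re x.2)
  refine (mvfderiv_comp_subtype_val U h1.differentiableAt v).trans ?_
  rw [h1.fderiv]
  rfl

lemma dReal_y (hF : IsNondegenerateHolomorphic U F) (x : U) (v : Fin n → ℂ) (i : Fin n) :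
    dReal (n := n) (fun q => ((dSection U F q).2 i).re) x v =
      (rePart n (gradGraphDeriv F x v)).2 i := by
  have h1 := (((ContinuousLinearMap.proj (R := ℝ) (φ := fun _ : Fin n => ℝ) i) ∘L
    ContinuousLinearMap.snd ℝ (Fin n → ℝ) (Fin n → ℝ)).hasFDerivAt).comp (x : Fin n → ℂ)
      (hF.hasFDerivAt_re x.2)
  refine (mvfderiv_comp_subtype_val U h1.differentiableAt v).trans ?_
  rw [h1.fderiv]
  rfl

/-- The connection induced by `dF`. -/
def connection (hF : IsNondegenerateHolomorphic U F) : Connection n U :=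
  flatConnection hF.contMDiff_re hF.isInvertible_mvfderiv_re

end IsNondegenerateHolomorphic

/-- The symplectic form induced by `dF`. -/
def inducedForm (U : Opens (Fin n → ℂ)) (F : (Fin n → ℂ) → ℂ) : BilinField n U :=
  pullbackForm (fun x => rePart n (dSection U F x)) (stdForm n)

namespace IsNondegenerateHolomorphic

lemma inducedForm_apply (hF : IsNondegenerateHolomorphic U F) (x : U) (u v : Fin n → ℂ) :
    inducedForm U F x u v = stdForm n (rePart n (gradGraphDeriv F x u))
      (rePart n (gradGraphDeriv F x v)) := by
  have h1 := hF.mvfderiv_re x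
  exact congrArg₂ (fun a b => stdForm n a b) congr($h1 u) congr($h1 v)

theorem isInducedBy (hF : IsNondegenerateHolomorphic U F) :
    IsInducedBy (dSection U F) hF.connection (inducedForm U F) where
  immersion x u h1 h2 := by
    refine injective_re_gradGraphDeriv (hF.nondegenerate x x.2) ?_
    ext i
    · exact (hF.dReal_x x u i).symm.trans (h1 i)
    · exact (hF.dReal_y x u i).symm.trans (h2 i)
  affine_x i := isAffineFun_flatConnection hF.contMDiff_re hF.isInvertible_mvfderiv_re
    ((ContinuousLinearMap.proj (R := ℝ) (φ := fun _ : Fin n => ℝ) i) ∘L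
      ContinuousLinearMap.fst ℝ (Fin n → ℝ) (Fin n → ℝ))
  affine_y i := isAffineFun_flatConnection hF.contMDiff_re hF.isInvertible_mvfderiv_re
    ((ContinuousLinearMap.proj (R := ℝ) (φ := fun _ : Fin n => ℝ) i) ∘L
      ContinuousLinearMap.snd ℝ (Fin n → ℝ) (Fin n → ℝ))
  form x u v := by
    refine (hF.inducedForm_apply x u v).trans ?_
    rw [stdForm_apply]
    refine congrArg (2 * ·) (Finset.sum_congr rfl fun i _ => ?_)
    refine (congrArg₂ (· - ·) (congrArg₂ (· * ·) (hF.dReal_x x u i) (hF.dReal_y x v i))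
      (congrArg₂ (· * ·) (hF.dReal_x x v i) (hF.dReal_y x u i))).symm

theorem isSpecialKahler (hF : IsNondegenerateHolomorphic U F) :
    IsSpecialKahler hF.connection (inducedForm U F) where
  specialComplex := isSpecialComplex_flatConnection _ _ (φ := dSection U F) (ρ := rePart n)
    hF.contMDiff_dSection (fun x v => by
      refine (hF.mvfderiv_dSection x _).trans ?_
      refine ((gradGraphDeriv F x).map_smul Complex.I v).trans ?_
      exact congrArg (Complex.I • ·) (hF.mvfderiv_dSection x v).symm) fun x => rfl
  symplectic := isSymplectic_pullbackForm hF.contMDiff_re hF.isInvertible_mvfderiv_re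
    stdForm_self fun _ => eq_zero_of_stdForm_eq_zero
  parallel := isParallel_pullbackForm _ _ _
  invariant x u v := by
    refine (hF.inducedForm_apply x _ _).trans ?_
    refine (stdForm_gradGraphDeriv_I_smul (hF.analyticAt x.2) u v).trans ?_
    exact (hF.inducedForm_apply x u v).symm

end IsNondegenerateHolomorphic

/-- ∇df = 0 determines df(∇_u Y), with `u` extended to a constant field, and the 2n differentials
separate tangent vectors. Only smooth `Y` can be compared: affineness tests nothing else, and the
values of a covariant derivative on nondifferentiable sections are arbitrary. -/
theorem IsInducedBy.unique {φ : U → (Fin n → ℂ) × (Fin n → ℂ)} {D D' : Connection n U}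
    {w w' : BilinField n U} (h : IsInducedBy φ D w) (h' : IsInducedBy φ D' w') :
    w' = w ∧ ∀ Y : VField n U, IsSmoothField Y → D' Y = D Y := by
  constructor
  · ext x u v
    rw [h.form, h'.form]
  · intro Y hY
    ext1 x
    refine ContinuousLinearMap.ext fun u => ?_
    have key : ∀ {f : U → ℝ}, IsAffineFun D f → IsAffineFun D' f →
        dReal (n := n) f x (D' Y x u - D Y x u) = 0 := fun {f} hf hf' => by
      have hX : IsSmoothField (n := n) (M := U) (fun _ => u) := contMDiff_const_field U u
      have h1 := hf.2 (fun _ => u) Y hX hY x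
      have h2 := hf'.2 (fun _ => u) Y hX hY x
      rw [map_sub, sub_eq_zero]
      exact h2.symm.trans h1
    exact sub_eq_zero.1 (h.immersion x _ (fun i => key (h.affine_x i) (h'.affine_x i))
      fun i => key (h.affine_y i) (h'.affine_y i))

end LocalModel

/-! ### Coordinate fields and Christoffel symbols. -/

section Christoffel

open Set VectorField

lemma contDiffAt_clm_of_apply {D E F : Type*} [NormedAddCommGroup D] [NormedSpace ℝ D]
    [NormedAddCommGroup E] [NormedSpace ℝ E] [NormedAddCommGroup F] [NormedSpace ℝ F]
    [FiniteDimensional ℝ E] {f : D → E →L[ℝ] F} {x : D} {k : ℕ∞ω}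
    (h : ∀ v, ContDiffAt ℝ k (fun y => f y v) x) : ContDiffAt ℝ k f x := by
  let d := Module.finrank ℝ E
  have hd : d = Module.finrank ℝ (Fin d → ℝ) := (Module.finrank_fin_fun ℝ).symm
  let e₁ := ContinuousLinearEquiv.ofFinrankEq hd
  let e₂ := (e₁.arrowCongr (1 : F ≃L[ℝ] F)).trans (ContinuousLinearEquiv.piRing (Fin d))
  rw [← Function.id_comp f, ← e₂.symm_comp_self]
  exact e₂.symm.contDiff.contDiffAt.comp x (contDiffAt_pi.mpr fun i => h _)

variable {E : Type*} [NormedAddCommGroup E] [NormedSpace ℝ E] [FiniteDimensional ℝ E]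
  {M : Type*} [TopologicalSpace M] [ChartedSpace E M]

/-- The coordinate vector field of a chart at `p` with coordinate expression `u`, cut off by a bump
function so that it is globally defined. -/
def coordField (p : M) (u : E) : (x : M) → TangentSpace 𝓘(ℝ, E) x :=
  (Classical.arbitrary (SmoothBumpFunction 𝓘(ℝ, E) p) : M → ℝ) •
    mpullback 𝓘(ℝ, E) 𝓘(ℝ, E) (extChartAt 𝓘(ℝ, E) p) (fun _ => u)

variable [IsManifold 𝓘(ℝ, E) ω M]

omit [FiniteDimensional ℝ E] in
lemma contMDiffAt_extChartAt_of_mem {p y : M} (hy : y ∈ (extChartAt 𝓘(ℝ, E) p).source) {k : ℕ∞ω} :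
    ContMDiffAt 𝓘(ℝ, E) 𝓘(ℝ, E) k (extChartAt 𝓘(ℝ, E) p) y :=
  (contMDiffAt_extChartAt' (n := ω) (by simpa using hy)).of_le le_top

omit [FiniteDimensional ℝ E] in
lemma isInvertible_mvfderiv_extChartAt {p y : M} (hy : y ∈ (extChartAt 𝓘(ℝ, E) p).source) :
    (mvfderiv 𝓘(ℝ, E) (extChartAt 𝓘(ℝ, E) p) y).IsInvertible :=
  isInvertible_mfderiv_extChartAt hy

/-- Flatness, parallelism and the other conditions are tested on global smooth fields only, so
coordinate fields must be cut off. In a Hausdorff manifold the closed support of the bump function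
stays inside the chart domain. -/
lemma contMDiff_coordField [T2Space M] (p : M) (u : E) :
    ContMDiff 𝓘(ℝ, E) 𝓘(ℝ, E).tangent ∞
      (fun y => (⟨y, coordField p u y⟩ : TangentBundle 𝓘(ℝ, E) M)) := by
  have : IsManifold 𝓘(ℝ, E) ∞ M := IsManifold.of_le (n := ω) le_top
  have : CompleteSpace E := FiniteDimensional.complete ℝ E
  refine ContMDiffOn.smul_section_of_tsupport (F := E) (I := 𝓘(ℝ, E))
    (V := fun x : M => TangentSpace 𝓘(ℝ, E) x) (u := (extChartAt 𝓘(ℝ, E) p).source) ?_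
    (isOpen_extChartAt_source p) ?_ ?_
  · exact (Classical.arbitrary (SmoothBumpFunction 𝓘(ℝ, E) p)).contMDiff.contMDiffOn
  · exact (Classical.arbitrary (SmoothBumpFunction 𝓘(ℝ, E) p)).tsupport_subset_extChartAt_source
  · intro y hy
    have h2 : ContMDiff 𝓘(ℝ, E) 𝓘(ℝ, E).tangent ∞
        (fun x : E => (⟨x, u⟩ : TangentBundle 𝓘(ℝ, E) E)) :=
      contMDiff_vectorSpace_iff_contDiff.2 contDiff_const
    exact (ContMDiffAt.mpullback_vectorField_preimage (n := ∞) (m := ∞) (h2 _)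
      (contMDiffAt_extChartAt_of_mem hy) (isInvertible_mfderiv_extChartAt hy)
      (by simp)).contMDiffWithinAt

lemma eventually_mvfderiv_coordField (p : M) : ∀ᶠ y in 𝓝 p, ∀ u,
    mvfderiv 𝓘(ℝ, E) (extChartAt 𝓘(ℝ, E) p) y (coordField p u y) = u := by
  filter_upwards [(Classical.arbitrary (SmoothBumpFunction 𝓘(ℝ, E) p)).eventuallyEq_one,
    extChartAt_source_mem_nhds (I := 𝓘(ℝ, E)) p] with y hy hys u
  have h1 : coordField p u y = (1 : ℝ) •
      (mfderiv 𝓘(ℝ, E) 𝓘(ℝ, E) (extChartAt 𝓘(ℝ, E) p) y).inverse u :=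
    congrArg (fun r : ℝ => r • (mfderiv 𝓘(ℝ, E) 𝓘(ℝ, E) (extChartAt 𝓘(ℝ, E) p) y).inverse u) hy
  rw [h1, one_smul]
  exact (isInvertible_mfderiv_extChartAt hys).self_apply_inverse _

/-- The difference between a covariant derivative and the flat one of the chart at `p`. -/
def flatDifference {cov : ((x : M) → TangentSpace 𝓘(ℝ, E) x) →
      ((x : M) → TangentSpace 𝓘(ℝ, E) x →L[ℝ] TangentSpace 𝓘(ℝ, E) x)}
    (h : IsCovariantDerivativeOn E cov univ) (p y : M) : E →L[ℝ] E →L[ℝ] E :=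
  IsCovariantDerivativeOn.difference
    (h.mono (subset_univ (extChartAt 𝓘(ℝ, E) p).source))
    (isCovariantDerivativeOn_flatCov (fun _ hx => contMDiffAt_extChartAt_of_mem hx)
      fun _ hx => isInvertible_mvfderiv_extChartAt hx) y

lemma flatDifference_apply {cov : ((x : M) → TangentSpace 𝓘(ℝ, E) x) →
      ((x : M) → TangentSpace 𝓘(ℝ, E) x →L[ℝ] TangentSpace 𝓘(ℝ, E) x)}
    (h : IsCovariantDerivativeOn E cov univ) {p y : M}
    (hy : y ∈ (extChartAt 𝓘(ℝ, E) p).source) {Y : (x : M) → TangentSpace 𝓘(ℝ, E) x}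
    (hY : MDiffAt (T% Y) y) (v : TangentSpace 𝓘(ℝ, E) y) :
    flatDifference h p y (Y y) v = cov Y y v - flatCov (extChartAt 𝓘(ℝ, E) p) Y y v :=
  congr($(IsCovariantDerivativeOn.difference_apply
    (h.mono (subset_univ (extChartAt 𝓘(ℝ, E) p).source))
    (isCovariantDerivativeOn_flatCov (fun _ hx => contMDiffAt_extChartAt_of_mem hx)
      fun _ hx => isInvertible_mvfderiv_extChartAt hx) hy hY) v)

/-- The Christoffel symbol at `y` of a covariant derivative in the chart at `p`. -/
def christoffelAt {cov : ((x : M) → TangentSpace 𝓘(ℝ, E) x) →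
      ((x : M) → TangentSpace 𝓘(ℝ, E) x →L[ℝ] TangentSpace 𝓘(ℝ, E) x)}
    (h : IsCovariantDerivativeOn E cov univ) (p y : M) : E →L[ℝ] E →L[ℝ] E :=
  let A : E →L[ℝ] E := mvfderiv 𝓘(ℝ, E) (extChartAt 𝓘(ℝ, E) p) y
  -- The difference tensor takes the section first; `flip` puts the direction of differentiation
  -- first.
  (ContinuousLinearMap.compL ℝ E E E A ∘L
    ((flatDifference h p y).bilinearComp A.inverse A.inverse)).flip

/-- The Christoffel symbol of a covariant derivative in the chart at `p`, as a field of bilinear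
maps on the target of the chart. -/
def christoffel {cov : ((x : M) → TangentSpace 𝓘(ℝ, E) x) →
      ((x : M) → TangentSpace 𝓘(ℝ, E) x →L[ℝ] TangentSpace 𝓘(ℝ, E) x)}
    (h : IsCovariantDerivativeOn E cov univ) (p : M) (z : E) : E →L[ℝ] E →L[ℝ] E :=
  christoffelAt h p ((extChartAt 𝓘(ℝ, E) p).symm z)

/-- The classical formula ∇_v Y = v(Y) + Γ(v, Y) in coordinates. It needs `Y` differentiable only at
the point, since the difference of two covariant derivatives is a tensor. -/
lemma mvfderiv_cov_eq_christoffel {cov : ((x : M) → TangentSpace 𝓘(ℝ, E) x) →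
      ((x : M) → TangentSpace 𝓘(ℝ, E) x →L[ℝ] TangentSpace 𝓘(ℝ, E) x)}
    (h : IsCovariantDerivativeOn E cov univ) {p y : M}
    (hy : y ∈ (extChartAt 𝓘(ℝ, E) p).source) {Y : (x : M) → TangentSpace 𝓘(ℝ, E) x}
    (hY : MDiffAt (T% Y) y) (v : TangentSpace 𝓘(ℝ, E) y) :
    mvfderiv 𝓘(ℝ, E) (extChartAt 𝓘(ℝ, E) p) y (cov Y y v) =
      mvfderiv 𝓘(ℝ, E) (fun x => mvfderiv 𝓘(ℝ, E) (extChartAt 𝓘(ℝ, E) p) x (Y x)) y v +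
      christoffel h p (extChartAt 𝓘(ℝ, E) p y)
        (mvfderiv 𝓘(ℝ, E) (extChartAt 𝓘(ℝ, E) p) y v)
        (mvfderiv 𝓘(ℝ, E) (extChartAt 𝓘(ℝ, E) p) y (Y y)) := by
  have hinv := isInvertible_mvfderiv_extChartAt hy
  have hyy := (extChartAt 𝓘(ℝ, E) p).left_inv hy
  have h1 := flatDifference_apply h hy hY v
  rw [← mvfderiv_flatCov hinv, ← sub_eq_iff_eq_add', ← map_sub, ← h1, christoffel, hyy]
  have h3 : ∀ u, (mvfderiv 𝓘(ℝ, E) (extChartAt 𝓘(ℝ, E) p) y).inverse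
      (mvfderiv 𝓘(ℝ, E) (extChartAt 𝓘(ℝ, E) p) y u) = u := hinv.inverse_apply_self
  exact congrArg (mvfderiv 𝓘(ℝ, E) (extChartAt 𝓘(ℝ, E) p) y)
    (congrArg₂ (fun a b => flatDifference h p y a b) (h3 (Y y)) (h3 v)).symm

end Christoffel

/-! ### The special complex conditions as identities for Γ. -/

section ChartData

open Set VectorField

variable {n : ℕ} {M : Type*} [TopologicalSpace M] [ChartedSpace (Fin n → ℂ) M]

/-- In the preferred chart at `y`, where `J` is multiplication by i, the complex derivative of `f`
with scalars restricted is its real derivative. -/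
lemma mvfderiv_J {W : Type*} [NormedAddCommGroup W] [NormedSpace ℂ W] {f : M → W} {y : M}
    (hf : MDifferentiableAt 𝓘(ℂ, Fin n → ℂ) 𝓘(ℂ, W) f y) (v : TangentSpace 𝓘(ℝ, Fin n → ℂ) y) :
    mvfderiv 𝓘(ℝ, Fin n → ℂ) f y (J n y v) = Complex.I • mvfderiv 𝓘(ℝ, Fin n → ℂ) f y v := by
  let L : (Fin n → ℂ) →L[ℂ] W := mfderiv 𝓘(ℂ, Fin n → ℂ) 𝓘(ℂ, W) f y
  have h1 : HasFDerivWithinAt (writtenInExtChartAt 𝓘(ℂ, Fin n → ℂ) 𝓘(ℂ, W) y f) L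
    (range 𝓘(ℂ, Fin n → ℂ)) (extChartAt 𝓘(ℂ, Fin n → ℂ) y y) := hf.hasMFDerivAt.2
  have h2 : HasMFDerivAt 𝓘(ℝ, Fin n → ℂ) 𝓘(ℝ, W) f y (L.restrictScalars ℝ) :=
    ⟨hf.continuousAt, h1.restrictScalars ℝ⟩
  have h3 : ∀ v, mvfderiv 𝓘(ℝ, Fin n → ℂ) f y v = L v := fun v => congr($(h2.mfderiv) v)
  rw [h3, h3]
  exact L.map_smul Complex.I v

variable [IsManifold 𝓘(ℂ, Fin n → ℂ) ω M]

lemma mvfderiv_extChartAt_J {p y : M} (hy : y ∈ (extChartAt 𝓘(ℝ, Fin n → ℂ) p).source)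
    (v : TangentSpace 𝓘(ℝ, Fin n → ℂ) y) :
    mvfderiv 𝓘(ℝ, Fin n → ℂ) (extChartAt 𝓘(ℝ, Fin n → ℂ) p) y (J n y v) =
      Complex.I • mvfderiv 𝓘(ℝ, Fin n → ℂ) (extChartAt 𝓘(ℝ, Fin n → ℂ) p) y v :=
  mvfderiv_J ((contMDiffAt_extChartAt' (I := 𝓘(ℂ, Fin n → ℂ)) (n := ω)
    (by simpa using hy)).mdifferentiableAt (by simp)) v

-- Allows local identities between functions of the coordinates to be checked at points of `M`,
-- where coordinate fields can be used.
omit [IsManifold 𝓘(ℂ, Fin n → ℂ) ω M] in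
lemma eventually_nhds_chart {p : M} {P : (Fin n → ℂ) → Prop}
    (h : ∀ᶠ y in 𝓝 p, P (extChartAt 𝓘(ℝ, Fin n → ℂ) p y)) :
    ∀ᶠ z in 𝓝 (extChartAt 𝓘(ℝ, Fin n → ℂ) p p), P z := by
  have h1 := (continuousAt_extChartAt_symm (I := 𝓘(ℝ, Fin n → ℂ)) p).eventually
    (p := fun y => P (extChartAt 𝓘(ℝ, Fin n → ℂ) p y)) (by rwa [extChartAt_to_inv])
  filter_upwards [h1, extChartAt_target_mem_nhds (I := 𝓘(ℝ, Fin n → ℂ)) p] with z hz hz'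
  rwa [(extChartAt 𝓘(ℝ, Fin n → ℂ) p).right_inv hz'] at hz

variable [T2Space M]

lemma isSmoothField_coordField (p : M) (u : Fin n → ℂ) :
    IsSmoothField (coordField p u : VField n M) := contMDiff_coordField p u

omit [T2Space M] in
lemma IsSmoothField.mdifferentiableAt {X : VField n M} (hX : IsSmoothField X) (y : M) :
    MDifferentiableAt 𝓘(ℝ, Fin n → ℂ) 𝓘(ℝ, Fin n → ℂ).tangent
      (fun y => (⟨y, X y⟩ : TangentBundle 𝓘(ℝ, Fin n → ℂ) M)) y :=
  (hX y).mdifferentiableAt (by simp)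

/-- Near `p`, the coordinate vector fields at `p` have constant coordinates. -/
def IsCoordPoint (p y : M) : Prop :=
  y ∈ (extChartAt 𝓘(ℝ, Fin n → ℂ) p).source ∧ ∀ᶠ y' in 𝓝 y, ∀ u : Fin n → ℂ,
    mvfderiv 𝓘(ℝ, Fin n → ℂ) (extChartAt 𝓘(ℝ, Fin n → ℂ) p) y' (coordField p u y') = u

omit [T2Space M] in
variable (n) in
lemma eventually_isCoordPoint (p : M) : ∀ᶠ y in 𝓝 p, IsCoordPoint (n := n) p y := by
  filter_upwards [extChartAt_source_mem_nhds (I := 𝓘(ℝ, Fin n → ℂ)) p,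
    eventually_eventually_nhds.2 (eventually_mvfderiv_coordField (E := Fin n → ℂ) p)] with y h1 h2
  exact ⟨h1, h2⟩

namespace IsCoordPoint

variable {p y : M} (h : IsCoordPoint (n := n) p y)
include h

omit [IsManifold 𝓘(ℂ, Fin n → ℂ) ω M] [T2Space M] in
lemma eventually : ∀ᶠ y' in 𝓝 y, IsCoordPoint (n := n) p y' := by
  filter_upwards [(isOpen_extChartAt_source (I := 𝓘(ℝ, Fin n → ℂ)) p).mem_nhds h.1,
    eventually_eventually_nhds.2 h.2] with y h1 h2
  exact ⟨h1, h2⟩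

omit [IsManifold 𝓘(ℂ, Fin n → ℂ) ω M] [T2Space M] in
lemma apply (u : Fin n → ℂ) :
    mvfderiv 𝓘(ℝ, Fin n → ℂ) (extChartAt 𝓘(ℝ, Fin n → ℂ) p) y (coordField p u y) = u :=
  h.2.self_of_nhds u

omit [IsManifold 𝓘(ℂ, Fin n → ℂ) ω M] [T2Space M] in
lemma mvfderiv_apply (u : Fin n → ℂ) :
    mvfderiv 𝓘(ℝ, Fin n → ℂ) (fun y => mvfderiv 𝓘(ℝ, Fin n → ℂ)
      (extChartAt 𝓘(ℝ, Fin n → ℂ) p) y (coordField p u y)) y = 0 := by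
  have h1 : (fun y => mvfderiv 𝓘(ℝ, Fin n → ℂ) (extChartAt 𝓘(ℝ, Fin n → ℂ) p) y
      (coordField p u y)) =ᶠ[𝓝 y] fun _ => u := by
    filter_upwards [h.2] with y' hy' using hy' u
  rw [mvfderiv_congr h1]
  exact mvfderiv_const u

omit [T2Space M] in
lemma ext {u v : TangentSpace 𝓘(ℝ, Fin n → ℂ) y}
    (huv : mvfderiv 𝓘(ℝ, Fin n → ℂ) (extChartAt 𝓘(ℝ, Fin n → ℂ) p) y u =
      mvfderiv 𝓘(ℝ, Fin n → ℂ) (extChartAt 𝓘(ℝ, Fin n → ℂ) p) y v) : u = v :=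
  (isInvertible_mvfderiv_extChartAt h.1).injective huv

lemma bracket_eq_zero (u v : Fin n → ℂ) :
    bracket (coordField p u : VField n M) (coordField p v) y = 0 := by
  refine h.ext ?_
  rw [bracket, mvfderiv_mlieBracket (contMDiffAt_extChartAt_of_mem h.1)
    ((isSmoothField_coordField p u).mdifferentiableAt y)
    ((isSmoothField_coordField p v).mdifferentiableAt y), h.mvfderiv_apply, h.mvfderiv_apply,
    map_zero]
  exact sub_self 0

omit [T2Space M] in
lemma J_coordField (u : Fin n → ℂ) :
    ∀ᶠ y' in 𝓝 y, J n y' (coordField p u y') = coordField p (Complex.I • u) y' := by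
  filter_upwards [h.eventually] with y' h'
  refine h'.ext ?_
  rw [h'.apply, mvfderiv_extChartAt_J h'.1, h'.apply]

variable (D : Connection n M)

lemma cov_coordField (u : Fin n → ℂ) (v : TangentSpace 𝓘(ℝ, Fin n → ℂ) y) :
    mvfderiv 𝓘(ℝ, Fin n → ℂ) (extChartAt 𝓘(ℝ, Fin n → ℂ) p) y (D (coordField p u) y v) =
      christoffel D.isCovariantDerivativeOnUniv p (extChartAt 𝓘(ℝ, Fin n → ℂ) p y)
        (mvfderiv 𝓘(ℝ, Fin n → ℂ) (extChartAt 𝓘(ℝ, Fin n → ℂ) p) y v) u := by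
  rw [mvfderiv_cov_eq_christoffel D.isCovariantDerivativeOnUniv h.1
    ((isSmoothField_coordField p u).mdifferentiableAt y), h.mvfderiv_apply, h.apply]
  exact zero_add _

lemma nabla_coordField (u v : Fin n → ℂ) :
    mvfderiv 𝓘(ℝ, Fin n → ℂ) (extChartAt 𝓘(ℝ, Fin n → ℂ) p) y
      (nabla D (coordField p u) (coordField p v) y) =
      christoffel D.isCovariantDerivativeOnUniv p (extChartAt 𝓘(ℝ, Fin n → ℂ) p y) u v := by
  rw [nabla, h.cov_coordField, h.apply]

end IsCoordPoint

/-- Each component Γ(u,v) is the coordinate expression of ∇_u ∂_v for cut-off coordinate fields,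
which is smooth. -/
lemma contDiffAt_christoffel {D : Connection n M} (hD : D.ContMDiffCovariantDerivative ∞) (p : M) :
    ContDiffAt ℝ ∞ (christoffel D.isCovariantDerivativeOnUniv p)
      (extChartAt 𝓘(ℝ, Fin n → ℂ) p p) := by
  refine contDiffAt_clm_of_apply fun u => contDiffAt_clm_of_apply fun v => ?_
  have hX := contMDiff_nabla hD (isSmoothField_coordField p u) (isSmoothField_coordField p v)
  have h1 : ContMDiffAt 𝓘(ℝ, Fin n → ℂ) 𝓘(ℝ, Fin n → ℂ) ∞ (fun y =>
      mvfderiv 𝓘(ℝ, Fin n → ℂ) (extChartAt 𝓘(ℝ, Fin n → ℂ) p) y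
        (nabla D (coordField p u) (coordField p v) y)) p :=
    contMDiffAt_mvfderiv_apply (k := ∞)
      (contMDiffAt_extChartAt_of_mem (mem_extChartAt_source p)) (hX p) (by simp)
  have h2 : ContMDiffAt 𝓘(ℝ, Fin n → ℂ) 𝓘(ℝ, Fin n → ℂ) ∞ (extChartAt 𝓘(ℝ, Fin n → ℂ) p).symm
      (extChartAt 𝓘(ℝ, Fin n → ℂ) p p) :=
    ((contMDiffOn_extChartAt_symm (n := ω) p).contMDiffAt
      (extChartAt_target_mem_nhds p)).of_le le_top
  have h3 := ContMDiffAt.comp (extChartAt 𝓘(ℝ, Fin n → ℂ) p p)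
    (by rwa [(extChartAt 𝓘(ℝ, Fin n → ℂ) p).left_inv (mem_extChartAt_source p)]) h2
  refine h3.contDiffAt.congr_of_eventuallyEq ?_
  refine eventually_nhds_chart ?_
  filter_upwards [eventually_isCoordPoint n p] with y hy
  rw [Function.comp_apply, (extChartAt 𝓘(ℝ, Fin n → ℂ) p).left_inv hy.1, hy.nabla_coordField]

variable {D : Connection n M}

lemma christoffel_symm (hD : D.torsion = 0) (p : M) :
    ∀ᶠ z in 𝓝 (extChartAt 𝓘(ℝ, Fin n → ℂ) p p), ∀ u v,
      christoffel D.isCovariantDerivativeOnUniv p z u v =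
        christoffel D.isCovariantDerivativeOnUniv p z v u := by
  refine eventually_nhds_chart ?_
  filter_upwards [eventually_isCoordPoint n p] with y hy u v
  rw [← hy.nabla_coordField, ← hy.nabla_coordField, ← sub_eq_zero, ← map_sub]
  rw [CovariantDerivative.torsion_eq_zero_iff] at hD
  have h1 := hD ((isSmoothField_coordField p u).mdifferentiableAt y)
    ((isSmoothField_coordField p v).mdifferentiableAt y)
  have h2 := hy.bracket_eq_zero u v
  exact (congrArg _ (h1.trans h2)).trans (map_zero _)

/-- On coordinate fields d^∇J = 0 says that Γ(u,iv) - iΓ(u,v) is symmetric in u and v, and the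
second term is already symmetric by vanishing torsion. This is what makes β ∘ i closed for a
parallel coframe β. -/
lemma christoffel_I_smul (hD : IsSpecialComplex D) (p : M) :
    ∀ᶠ z in 𝓝 (extChartAt 𝓘(ℝ, Fin n → ℂ) p p), ∀ u v,
      christoffel D.isCovariantDerivativeOnUniv p z u (Complex.I • v) =
        christoffel D.isCovariantDerivativeOnUniv p z v (Complex.I • u) := by
  filter_upwards [christoffel_symm hD.torsionfree p, eventually_nhds_chart (n := n) (p := p)
    (P := fun z => ∀ u v, christoffel D.isCovariantDerivativeOnUniv p z u (Complex.I • v) -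
        Complex.I • christoffel D.isCovariantDerivativeOnUniv p z u v -
      (christoffel D.isCovariantDerivativeOnUniv p z v (Complex.I • u) -
        Complex.I • christoffel D.isCovariantDerivativeOnUniv p z v u) = 0) (by
    filter_upwards [eventually_isCoordPoint n p] with y hy u v
    have key : ∀ u v, mvfderiv 𝓘(ℝ, Fin n → ℂ) (extChartAt 𝓘(ℝ, Fin n → ℂ) p) y
        (nablaJ D (coordField p u) (coordField p v) y) =
        christoffel D.isCovariantDerivativeOnUniv p (extChartAt 𝓘(ℝ, Fin n → ℂ) p y) u
            (Complex.I • v) -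
          Complex.I • christoffel D.isCovariantDerivativeOnUniv p
            (extChartAt 𝓘(ℝ, Fin n → ℂ) p y) u v := fun u v => by
      have h1 := hy.J_coordField v
      -- The two fields agree only near `y`, where the bump function is 1; locality of the covariant
      -- derivative suffices.
      have h2 : D (fun y => J n y (coordField p v y)) y = D (coordField p (Complex.I • v)) y := by
        refine D.isCovariantDerivativeOnUniv.congr_of_eventuallyEq ?_
          ((isSmoothField_coordField p (Complex.I • v)).mdifferentiableAt y) Filter.univ_mem h1
        refine ((isSmoothField_coordField p
          (Complex.I • v)).mdifferentiableAt y).congr_of_eventuallyEq ?_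
        filter_upwards [h1] with y' hy'
        rw [hy']
      rw [nablaJ, map_sub, mvfderiv_extChartAt_J hy.1, hy.nabla_coordField]
      congr 1
      rw [← hy.nabla_coordField, nabla, nabla, h2]
    rw [← key, ← key, ← map_sub]
    exact (congrArg _ (congrFun (hD.dJ_eq_zero _ _ (isSmoothField_coordField p u)
      (isSmoothField_coordField p v)) y)).trans (map_zero _))] with z h1 h2 u v
  have h3 := h2 u v
  rw [h1 v u] at h3
  rw [sub_sub_sub_cancel_right, sub_eq_zero] at h3
  exact h3

-- Flatness on three coordinate fields: their brackets vanish near `p`, and ∇_u ∇_v ∂_t has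
-- coordinates (∂_u Γ(v) + Γ(u)Γ(v)) t. This is the integrability condition of dA = AΓ.
set_option synthInstance.maxHeartbeats 200000 in
lemma christoffel_curvature (hD : IsSpecialComplex D) (p : M) :
    ∀ᶠ z in 𝓝 (extChartAt 𝓘(ℝ, Fin n → ℂ) p p), ∀ u v,
      fderiv ℝ (christoffel D.isCovariantDerivativeOnUniv p) z u v +
        christoffel D.isCovariantDerivativeOnUniv p z u *
          christoffel D.isCovariantDerivativeOnUniv p z v =
      fderiv ℝ (christoffel D.isCovariantDerivativeOnUniv p) z v u +
        christoffel D.isCovariantDerivativeOnUniv p z v *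
          christoffel D.isCovariantDerivativeOnUniv p z u := by
  have hdiff : ∀ᶠ z in 𝓝 (extChartAt 𝓘(ℝ, Fin n → ℂ) p p),
      DifferentiableAt ℝ (christoffel D.isCovariantDerivativeOnUniv p) z := by
    have h1 := (contDiffAt_christoffel hD.smooth p).of_le (m := 1) (by exact_mod_cast le_top)
    filter_upwards [h1.eventually (by simp)] with z hz
    exact hz.differentiableAt (by simp)
  have hdiff' := ((continuousAt_extChartAt (I := 𝓘(ℝ, Fin n → ℂ)) p).eventually hdiff)
  refine eventually_nhds_chart ?_
  filter_upwards [eventually_isCoordPoint n p, hdiff'] with y hy hyd u v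
  refine ContinuousLinearMap.ext fun t => ?_
  set Γ := christoffel D.isCovariantDerivativeOnUniv p with hΓ
  have key : ∀ u v, mvfderiv 𝓘(ℝ, Fin n → ℂ) (extChartAt 𝓘(ℝ, Fin n → ℂ) p) y
      (nabla D (coordField p u) (nabla D (coordField p v) (coordField p t)) y) =
      (fderiv ℝ Γ (extChartAt 𝓘(ℝ, Fin n → ℂ) p y) u v +
        Γ (extChartAt 𝓘(ℝ, Fin n → ℂ) p y) u * Γ (extChartAt 𝓘(ℝ, Fin n → ℂ) p y) v) t := by
    intro u v
    have hX := contMDiff_nabla hD.smooth (isSmoothField_coordField p v)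
      (isSmoothField_coordField p t)
    rw [nabla, mvfderiv_cov_eq_christoffel D.isCovariantDerivativeOnUniv hy.1
      (hX.mdifferentiableAt y), hy.nabla_coordField, hy.apply]
    have h1 : (fun y => mvfderiv 𝓘(ℝ, Fin n → ℂ) (extChartAt 𝓘(ℝ, Fin n → ℂ) p) y
        (nabla D (coordField p v) (coordField p t) y)) =ᶠ[𝓝 y]
        (fun z => Γ z v t) ∘ extChartAt 𝓘(ℝ, Fin n → ℂ) p := by
      filter_upwards [hy.eventually] with y' hy'
      rw [hy'.nabla_coordField]
      rfl
    have h2 : HasFDerivAt (fun z => Γ z v t) _ (extChartAt 𝓘(ℝ, Fin n → ℂ) p y) :=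
      (hyd.hasFDerivAt.clm_apply (hasFDerivAt_const v _)).clm_apply (hasFDerivAt_const t _)
    rw [mvfderiv_congr h1, mvfderiv_comp_fderiv h2.differentiableAt
      ((contMDiffAt_extChartAt_of_mem (k := ω) hy.1).mdifferentiableAt (by simp)), h2.fderiv,
      hy.apply]
    simp
    rfl
  rw [← key, ← key, ← sub_eq_zero, ← map_sub]
  have h1 := congrFun (hD.flat (coordField p u) (coordField p v) (coordField p t)
    (isSmoothField_coordField p u) (isSmoothField_coordField p v) (isSmoothField_coordField p t)) y
  have h2 : nabla D (bracket (coordField p u) (coordField p v)) (coordField p t) y = 0 := by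
    rw [nabla, hy.bracket_eq_zero, map_zero]
  have h3 : nabla D (coordField p u) (nabla D (coordField p v) (coordField p t)) y -
      nabla D (coordField p v) (nabla D (coordField p u) (coordField p t)) y -
      nabla D (bracket (coordField p u) (coordField p v)) (coordField p t) y = 0 := h1
  rw [h2, sub_zero] at h3
  rw [h3, map_zero]

end ChartData

/-! ### The symplectic form in a chart. -/

section FormInChart

open Set VectorField

variable {n : ℕ} {M : Type*} [TopologicalSpace M] [ChartedSpace (Fin n → ℂ) M]

/-- A field of bilinear forms at the point `y`, read in the chart at `p`. -/
def formInChartAt (w : BilinField n M) (p y : M) : (Fin n → ℂ) →L[ℝ] (Fin n → ℂ) →L[ℝ] ℝ :=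
  let A : (Fin n → ℂ) →L[ℝ] (Fin n → ℂ) :=
    mvfderiv 𝓘(ℝ, Fin n → ℂ) (extChartAt 𝓘(ℝ, Fin n → ℂ) p) y
  let w' : (Fin n → ℂ) →L[ℝ] (Fin n → ℂ) →L[ℝ] ℝ := w y
  w'.bilinearComp A.inverse A.inverse

/-- A field of bilinear forms read in the chart at `p`. -/
def formInChart (w : BilinField n M) (p : M) (z : Fin n → ℂ) :
    (Fin n → ℂ) →L[ℝ] (Fin n → ℂ) →L[ℝ] ℝ :=
  formInChartAt w p ((extChartAt 𝓘(ℝ, Fin n → ℂ) p).symm z)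

variable [IsManifold 𝓘(ℂ, Fin n → ℂ) ω M]

lemma formInChart_apply (w : BilinField n M) {p y : M}
    (hy : y ∈ (extChartAt 𝓘(ℝ, Fin n → ℂ) p).source) (u v : TangentSpace 𝓘(ℝ, Fin n → ℂ) y) :
    formInChart w p (extChartAt 𝓘(ℝ, Fin n → ℂ) p y)
      (mvfderiv 𝓘(ℝ, Fin n → ℂ) (extChartAt 𝓘(ℝ, Fin n → ℂ) p) y u)
      (mvfderiv 𝓘(ℝ, Fin n → ℂ) (extChartAt 𝓘(ℝ, Fin n → ℂ) p) y v) = w y u v := by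
  rw [formInChart, (extChartAt 𝓘(ℝ, Fin n → ℂ) p).left_inv hy]
  have h3 : ∀ u, (mvfderiv 𝓘(ℝ, Fin n → ℂ) (extChartAt 𝓘(ℝ, Fin n → ℂ) p) y).inverse
      (mvfderiv 𝓘(ℝ, Fin n → ℂ) (extChartAt 𝓘(ℝ, Fin n → ℂ) p) y u) = u :=
    (isInvertible_mvfderiv_extChartAt hy).inverse_apply_self
  exact congrArg₂ (fun a b => w y a b) (h3 u) (h3 v)

lemma formInChart_self {w : BilinField n M} (hw : IsSymplectic w) (p : M) (z u : Fin n → ℂ) :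
    formInChart w p z u u = 0 :=
  hw.alternating _ _

lemma eq_zero_of_formInChart_eq_zero {w : BilinField n M} (hw : IsSymplectic w) {p : M}
    {z : Fin n → ℂ} (hz : z ∈ (extChartAt 𝓘(ℝ, Fin n → ℂ) p).target) {u : Fin n → ℂ}
    (h : ∀ v, formInChart w p z u v = 0) : u = 0 := by
  obtain ⟨y, hys, rfl⟩ : ∃ y ∈ (extChartAt 𝓘(ℝ, Fin n → ℂ) p).source,
      extChartAt 𝓘(ℝ, Fin n → ℂ) p y = z :=
    ⟨_, (extChartAt 𝓘(ℝ, Fin n → ℂ) p).map_target hz,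
      (extChartAt 𝓘(ℝ, Fin n → ℂ) p).right_inv hz⟩
  obtain ⟨u, rfl⟩ := (isInvertible_mvfderiv_extChartAt hys).surjective u
  rw [hw.nondegenerate y u fun v => ?_, map_zero]
  rw [← formInChart_apply w hys]
  exact h _

lemma formInChart_I_smul {w : BilinField n M} (hw : ∀ (x : M)
      (u v : TangentSpace 𝓘(ℝ, Fin n → ℂ) x), w x (J n x u) (J n x v) = w x u v) {p : M}
    {z : Fin n → ℂ} (hz : z ∈ (extChartAt 𝓘(ℝ, Fin n → ℂ) p).target) (u v : Fin n → ℂ) :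
    formInChart w p z (Complex.I • u) (Complex.I • v) = formInChart w p z u v := by
  obtain ⟨y, hys, rfl⟩ : ∃ y ∈ (extChartAt 𝓘(ℝ, Fin n → ℂ) p).source,
      extChartAt 𝓘(ℝ, Fin n → ℂ) p y = z :=
    ⟨_, (extChartAt 𝓘(ℝ, Fin n → ℂ) p).map_target hz,
      (extChartAt 𝓘(ℝ, Fin n → ℂ) p).right_inv hz⟩
  obtain ⟨u, rfl⟩ := (isInvertible_mvfderiv_extChartAt hys).surjective u
  obtain ⟨v, rfl⟩ := (isInvertible_mvfderiv_extChartAt hys).surjective v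
  rw [← mvfderiv_extChartAt_J hys, ← mvfderiv_extChartAt_J hys, formInChart_apply w hys,
    formInChart_apply w hys, hw]

variable [T2Space M]

omit [T2Space M] in
lemma IsCoordPoint.formInChart_eq_eval {p y : M} (h : IsCoordPoint (n := n) p y)
    (w : BilinField n M) (u v : Fin n → ℂ) :
    formInChart w p (extChartAt 𝓘(ℝ, Fin n → ℂ) p y) u v =
      eval w (coordField p u) (coordField p v) y := by
  rw [eval, ← formInChart_apply w h.1, h.apply, h.apply]

lemma contDiffAt_formInChart {w : BilinField n M} (hw : IsSymplectic w) (p : M) :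
    ContDiffAt ℝ ∞ (formInChart w p) (extChartAt 𝓘(ℝ, Fin n → ℂ) p p) := by
  refine contDiffAt_clm_of_apply fun u => contDiffAt_clm_of_apply fun v => ?_
  have h1 := hw.smooth _ _ (isSmoothField_coordField p u) (isSmoothField_coordField p v) p
  have h2 : ContMDiffAt 𝓘(ℝ, Fin n → ℂ) 𝓘(ℝ, Fin n → ℂ) ∞ (extChartAt 𝓘(ℝ, Fin n → ℂ) p).symm
      (extChartAt 𝓘(ℝ, Fin n → ℂ) p p) :=
    ((contMDiffOn_extChartAt_symm (n := ω) p).contMDiffAt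
      (extChartAt_target_mem_nhds p)).of_le le_top
  have h3 := ContMDiffAt.comp (extChartAt 𝓘(ℝ, Fin n → ℂ) p p)
    (by rwa [(extChartAt 𝓘(ℝ, Fin n → ℂ) p).left_inv (mem_extChartAt_source p)]) h2
  refine h3.contDiffAt.congr_of_eventuallyEq ?_
  refine eventually_nhds_chart ?_
  filter_upwards [eventually_isCoordPoint n p] with y hy
  rw [Function.comp_apply, (extChartAt 𝓘(ℝ, Fin n → ℂ) p).left_inv hy.1, hy.formInChart_eq_eval]

-- Parallelism evaluated on coordinate fields, whose covariant derivatives are given by Γ.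
set_option synthInstance.maxHeartbeats 200000 in
lemma fderiv_formInChart {D : Connection n M} {w : BilinField n M} (hw : IsSymplectic w)
    (hp : IsParallel D w) (p : M) :
    ∀ᶠ z in 𝓝 (extChartAt 𝓘(ℝ, Fin n → ℂ) p p), ∀ u v t,
      fderiv ℝ (formInChart w p) z u v t =
        formInChart w p z (christoffel D.isCovariantDerivativeOnUniv p z u v) t +
        formInChart w p z v (christoffel D.isCovariantDerivativeOnUniv p z u t) := by
  have hdiff : ∀ᶠ z in 𝓝 (extChartAt 𝓘(ℝ, Fin n → ℂ) p p),
      DifferentiableAt ℝ (formInChart w p) z := by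
    have h1 := (contDiffAt_formInChart hw p).of_le (m := 1) (by exact_mod_cast le_top)
    filter_upwards [h1.eventually (by simp)] with z hz
    exact hz.differentiableAt (by simp)
  have hdiff' := ((continuousAt_extChartAt (I := 𝓘(ℝ, Fin n → ℂ)) p).eventually hdiff)
  refine eventually_nhds_chart ?_
  filter_upwards [eventually_isCoordPoint n p, hdiff'] with y hy hyd u v t
  have h1 : eval w (coordField p v) (coordField p t) =ᶠ[𝓝 y]
      (fun z => formInChart w p z v t) ∘ extChartAt 𝓘(ℝ, Fin n → ℂ) p := by
    filter_upwards [hy.eventually] with y' hy'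
    exact (hy'.formInChart_eq_eval w v t).symm
  have h2 : HasFDerivAt (fun z => formInChart w p z v t) _ (extChartAt 𝓘(ℝ, Fin n → ℂ) p y) :=
    (hyd.hasFDerivAt.clm_apply (hasFDerivAt_const v _)).clm_apply (hasFDerivAt_const t _)
  have h3 := hp (coordField p u) (coordField p v) (coordField p t) (isSmoothField_coordField p u)
    (isSmoothField_coordField p v) (isSmoothField_coordField p t) y
  have h4 : along (coordField p u) (eval w (coordField p v) (coordField p t)) y =
      fderiv ℝ (formInChart w p) (extChartAt 𝓘(ℝ, Fin n → ℂ) p y) u v t := by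
    change mvfderiv 𝓘(ℝ, Fin n → ℂ) (eval w (coordField p v) (coordField p t)) y _ = _
    rw [mvfderiv_congr h1, mvfderiv_comp_fderiv h2.differentiableAt
      ((contMDiffAt_extChartAt_of_mem (k := ω) hy.1).mdifferentiableAt (by simp)), h2.fderiv,
      hy.apply]
    simp
  rw [← h4, h3, eval, eval, ← formInChart_apply w hy.1, ← formInChart_apply w hy.1,
    hy.nabla_coordField, hy.nabla_coordField, hy.apply, hy.apply]

end FormInChart

/-! ### Darboux coordinates adapted to a complex structure. -/

section LinearAlgebra

open Matrix

/-- Darboux coordinates adapted to a complex structure: the common kernel `L` of the `x i` is a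
Lagrangian subspace with `L ∩ i L = 0`. -/
theorem exists_adapted_darboux_basis {n : ℕ} (Ω : (Fin n → ℂ) →L[ℝ] (Fin n → ℂ) →L[ℝ] ℝ)
    (halt : ∀ u, Ω u u = 0) (hinv : ∀ u v, Ω (Complex.I • u) (Complex.I • v) = Ω u v) :
    ∃ x y : Fin n → (Fin n → ℂ) →L[ℝ] ℝ,
      (∀ u v, Ω u v = 2 * ∑ i, (x i u * y i v - x i v * y i u)) ∧
      ∀ u, (∀ i, x i u = 0) → (∀ i, x i (Complex.I • u) = 0) → u = 0 := by
  have hanti : ∀ u v, Ω u v = - Ω v u := fun u v => by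
    have := halt (u + v)
    simp only [map_add, _root_.add_apply, halt] at this
    linarith
  have hI : ∀ u v, Ω (Complex.I • u) v = - Ω u (Complex.I • v) := fun u v => by
    have := hinv u (Complex.I • v)
    rw [smul_smul, Complex.I_mul_I, neg_one_smul, map_neg] at this
    linarith
  -- By invariance, Ω(u, iv) + iΩ(u, v) is a Hermitian form with imaginary part Ω.
  let L : (Fin n → ℂ) → (Fin n → ℂ) →ₗ[ℂ] ℂ := fun u =>
    { toFun := fun v => ⟨Ω u (Complex.I • v), Ω u v⟩
      map_add' := fun v w => by
        apply Complex.ext <;> simp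
      map_smul' := fun c v => by
        have h1 : c • v = c.re • v + c.im • (Complex.I • v) := by
          ext i
          apply Complex.ext
          · simp
            ring
          · simp
        have h2 : Complex.I • c • v = c.re • (Complex.I • v) - c.im • v := by
          ext i
          apply Complex.ext
          · simp
            ring
          · simp
        rw [h2, h1]
        apply Complex.ext <;> simp }
  have hLim : ∀ u v, (L u v).im = Ω u v := fun u v => rfl
  have hLstar : ∀ u v, L u v = star (L v u) := fun u v => by
    apply Complex.ext
    · change Ω u (Complex.I • v) = Ω v (Complex.I • u)
      rw [hanti v, hI, neg_neg]
    · exact hanti u v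
  have hsum : ∀ u v, L u v = ∑ k, v k * L u (Pi.single k 1) := fun u v => by
    conv_lhs => rw [pi_eq_sum_univ' v, map_sum]
    simp only [map_smul, smul_eq_mul]
  let A : Matrix (Fin n) (Fin n) ℂ := Matrix.of fun j k => L (Pi.single j 1) (Pi.single k 1)
  have hA : A.IsHermitian := by
    ext j k
    exact (hLstar _ _).symm
  have hLA : ∀ u v, L u v = star u ⬝ᵥ (A *ᵥ v) := fun u v => by
    have h1 : ∀ k, L u (Pi.single k 1) = ∑ j, star (u j) * A j k := fun k => by
      rw [hLstar, hsum, star_sum]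
      refine Finset.sum_congr rfl fun j _ => ?_
      rw [star_mul', ← hLstar]
      rfl
    rw [hsum]
    simp only [h1, dotProduct, mulVec, Finset.mul_sum, Pi.star_apply]
    rw [Finset.sum_comm]
    refine Finset.sum_congr rfl fun i _ => Finset.sum_congr rfl fun j _ => ?_
    ring
  obtain ⟨U, d, hU, hAU⟩ : ∃ (U : Matrix (Fin n) (Fin n) ℂ) (d : Fin n → ℝ), U * star U = 1 ∧
      A = U * Matrix.diagonal (fun i => (d i : ℂ)) * star U := by
    refine ⟨hA.eigenvectorUnitary, hA.eigenvalues, Unitary.coe_mul_star_self _, ?_⟩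
    have h := hA.spectral_theorem
    rwa [Unitary.conjStarAlgAut_apply] at h
  let a : Fin n → (Fin n → ℂ) →L[ℝ] ℂ := fun i =>
    LinearMap.toContinuousLinearMap
      (((LinearMap.proj i) ∘ₗ (star U).mulVecLin).restrictScalars ℝ)
  have ha : ∀ i u, a i u = ((star U) *ᵥ u) i := fun i u => rfl
  have haI : ∀ i u, a i (Complex.I • u) = Complex.I * a i u := fun i u => by
    rw [ha, ha, mulVec_smul]
    rfl
  -- In unitary coordinates `a` the form is Ω = Σ dᵢ Re aᵢ ∧ Im aᵢ; the 1/2 offsets the factor 2 in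
  -- the normalization and the sign the order of the factors. Signs of the eigenvalues play no role.
  -- If xᵢ kills both `u` and `iu`, then Im aᵢ(u) = Re aᵢ(u) = 0.
  refine ⟨fun i => Complex.imCLM ∘L a i, fun i => (-(d i) / 2) • (Complex.reCLM ∘L a i), ?_, ?_⟩
  · intro u v
    have h1 : L u v = ∑ i, star (a i u) * (d i * a i v) := by
      rw [hLA, hAU, ← mulVec_mulVec, ← mulVec_mulVec, dotProduct_mulVec]
      have h2 : star u ᵥ* U = star (star U *ᵥ u) := by
        rw [star_mulVec, star_eq_conjTranspose, conjTranspose_conjTranspose]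
      rw [h2]
      refine Finset.sum_congr rfl fun i _ => ?_
      rw [mulVec_diagonal]
      rfl
    rw [← hLim, h1, Complex.im_sum, Finset.mul_sum]
    refine Finset.sum_congr rfl fun i _ => ?_
    simp
    ring
  · intro u h1 h2
    have h3 : (star U) *ᵥ u = 0 := by
      ext i
      refine Complex.ext ?_ (h1 i)
      have := h2 i
      simpa [haI, ha] using this
    rw [← one_mulVec u, ← hU, ← mulVec_mulVec, h3, mulVec_zero]

end LinearAlgebra

/-! ### Parallel Darboux coframes and their holomorphic primitives. -/

section ParallelCoframe

open Set Metric

set_option synthInstance.maxHeartbeats 200000 in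
/-- Near a point, a parallel family of bilinear forms is the pullback of its value at the point by
any parallel frame. -/
theorem eventually_eq_of_parallel {E : Type*} [NormedAddCommGroup E] [NormedSpace ℝ E]
    [CompleteSpace E] {Γ : E → E →L[ℝ] E →L[ℝ] E} {Ω : E → E →L[ℝ] E →L[ℝ] ℝ} {z₀ : E}
    (hΩ : ∀ᶠ z in 𝓝 z₀, DifferentiableAt ℝ Ω z)
    (hpar : ∀ᶠ z in 𝓝 z₀, ∀ u v t,
      fderiv ℝ Ω z u v t = Ω z (Γ z u v) t + Ω z v (Γ z u t))
    {A : E → E →L[ℝ] E} (hA₀ : A z₀ = 1)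
    (hA : ∀ᶠ z in 𝓝 z₀, HasFDerivAt A (ContinuousLinearMap.mul ℝ (E →L[ℝ] E) (A z) ∘L Γ z) z) :
    ∀ᶠ z in 𝓝 z₀, ∀ u v, Ω z u v = Ω z₀ (A z u) (A z v) := by
  have hunit : ∀ᶠ z in 𝓝 z₀, IsUnit (A z) := by
    have h1 : {f : E →L[ℝ] E | IsUnit f} ∈ 𝓝 (A z₀) := by
      rw [hA₀]
      exact Units.isOpen.mem_nhds isUnit_one
    exact hA.self_of_nhds.continuousAt h1
  obtain ⟨r, hr, hball⟩ := eventually_nhds_iff_ball.1 ((hΩ.and hpar).and (hA.and hunit))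
  -- From dA = AΓ the vectors A⁻¹a satisfy d(A⁻¹a) = -Γ A⁻¹a, so they are parallel fields. A
  -- parallel form is constant on them.
  have hder : ∀ z ∈ ball z₀ r, ∀ a b, HasFDerivAt
      (fun z => Ω z (Ring.inverse (A z) a) (Ring.inverse (A z) b)) (0 : E →L[ℝ] ℝ) z := by
    intro z hz a b
    obtain ⟨⟨h1, h2⟩, h3, ⟨B, hB⟩⟩ := hball z hz
    have h4 : HasFDerivAt (fun z => Ring.inverse (A z)) _ z :=
      (hB ▸ hasFDerivAt_ringInverse (𝕜 := ℝ) B).comp z h3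
    have h7 : ∀ w : E, (↑B⁻¹ : E →L[ℝ] E) (A z w) = w := fun w => by
      rw [← hB]
      exact congr($(B.inv_mul) w)
    have h8 : Ring.inverse (A z) = ↑B⁻¹ := by rw [← hB, Ring.inverse_unit]
    have h5 : ∀ a, ∃ D : E →L[ℝ] E, HasFDerivAt (fun z => Ring.inverse (A z) a) D z ∧
        ∀ u, D u = -Γ z u (Ring.inverse (A z) a) := fun a => by
      refine ⟨_, h4.clm_apply (hasFDerivAt_const a z), fun u => ?_⟩
      rw [h8]
      refine Eq.trans (b := (↑B⁻¹ : E →L[ℝ] E) (0 : E) +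
        -(↑B⁻¹ : E →L[ℝ] E) (A z (Γ z u ((↑B⁻¹ : E →L[ℝ] E) a)))) rfl ?_
      rw [h7, map_zero, zero_add]
    obtain ⟨Da, ha, hDa⟩ := h5 a
    obtain ⟨Db, hb, hDb⟩ := h5 b
    refine ((h1.hasFDerivAt.clm_apply ha).clm_apply hb).congr_fderiv ?_
    ext u
    refine Eq.trans (b := Ω z (Ring.inverse (A z) a) (Db u) +
      (Ω z (Da u) (Ring.inverse (A z) b) +
        fderiv ℝ Ω z u (Ring.inverse (A z) a) (Ring.inverse (A z) b))) rfl ?_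
    rw [h2, hDa, hDb, map_neg, map_neg, _root_.neg_apply, _root_.zero_apply]
    ring
  have hz₀ : z₀ ∈ ball z₀ r := mem_ball_self hr
  filter_upwards [ball_mem_nhds z₀ hr] with z hz u v
  have h1 := (convex_ball z₀ r).is_const_of_fderivWithin_eq_zero (𝕜 := ℝ)
    (f := fun y => Ω y (Ring.inverse (A y) (A z u)) (Ring.inverse (A y) (A z v)))
    (fun y hy => (hder y hy _ _).differentiableAt.differentiableWithinAt)
    (fun y hy => by
      rw [fderivWithin_of_isOpen isOpen_ball hy]
      exact (hder y hy _ _).fderiv) hz hz₀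
  simp only [hA₀, Ring.inverse_one] at h1
  obtain ⟨B, hB⟩ := (hball z hz).2.2
  have h7 : ∀ w : E, Ring.inverse (A z) (A z w) = w := fun w => by
    rw [← hB, Ring.inverse_unit]
    exact congr($(B.inv_mul) w)
  rwa [h7, h7] at h1

variable {n : ℕ}

/-- Parallel Darboux coframes, adapted to the complex structure at the base point. -/
theorem exists_parallel_darboux_coframe
    {Γ : (Fin n → ℂ) → (Fin n → ℂ) →L[ℝ] (Fin n → ℂ) →L[ℝ] (Fin n → ℂ)}
    {Ω : (Fin n → ℂ) → (Fin n → ℂ) →L[ℝ] (Fin n → ℂ) →L[ℝ] ℝ} {z₀ : Fin n → ℂ}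
    (hΓ : ContDiffAt ℝ ∞ Γ z₀)
    (hcurv : ∀ᶠ z in 𝓝 z₀, ∀ u v,
      fderiv ℝ Γ z u v + Γ z u * Γ z v = fderiv ℝ Γ z v u + Γ z v * Γ z u)
    (hΩ : ∀ᶠ z in 𝓝 z₀, DifferentiableAt ℝ Ω z)
    (hpar : ∀ᶠ z in 𝓝 z₀, ∀ u v t,
      fderiv ℝ Ω z u v t = Ω z (Γ z u v) t + Ω z v (Γ z u t))
    (halt : ∀ u, Ω z₀ u u = 0)
    (hinv : ∀ u v, Ω z₀ (Complex.I • u) (Complex.I • v) = Ω z₀ u v) :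
    ∃ β : (Fin n → ℂ) → (Fin n → ℂ) →L[ℝ] (Fin n → ℝ) × (Fin n → ℝ),
      (∀ᶠ z in 𝓝 z₀, DifferentiableAt ℝ β z ∧ ∀ u v, fderiv ℝ β z u v = β z (Γ z u v)) ∧
      (∀ᶠ z in 𝓝 z₀, ∀ u v, Ω z u v = stdForm n (β z u) (β z v)) ∧
      ∀ u, (β z₀ u).1 = 0 → (β z₀ (Complex.I • u)).1 = 0 → u = 0 := by
  obtain ⟨A, hA₀, hA⟩ := exists_hasFDerivAt_of_curvature_eq_zero
    (hΓ.of_le two_le_infty) hcurv (1 : (Fin n → ℂ) →L[ℝ] (Fin n → ℂ))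
  obtain ⟨x, y, hxy, hx⟩ := exists_adapted_darboux_basis (Ω z₀) halt hinv
  let P : (Fin n → ℂ) →L[ℝ] (Fin n → ℝ) × (Fin n → ℝ) :=
    (ContinuousLinearMap.pi x).prod (ContinuousLinearMap.pi y)
  have hP : ∀ u v, Ω z₀ u v = stdForm n (P u) (P v) := fun u v => by
    rw [hxy, stdForm_apply]
    rfl
  -- Darboux coordinates at `z₀` composed with the parallel frame: parallel because `P` is constant,
  -- and adapted at `z₀` because `A z₀ = 1`.
  refine ⟨fun z => P ∘L A z, ?_, ?_, fun u h1 h2 => hx u ?_ ?_⟩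
  · filter_upwards [hA] with z hz
    have h1 := ((ContinuousLinearMap.compL ℝ _ _ _ P).hasFDerivAt).comp z hz
    refine ⟨h1.differentiableAt, fun u v => ?_⟩
    rw [show fderiv ℝ (fun z => P ∘L A z) z = _ from h1.fderiv]
    rfl
  · filter_upwards [eventually_eq_of_parallel hΩ hpar hA₀ hA] with z hz u v
    rw [hz, hP]
    rfl
  · intro i
    simp only [hA₀] at h1
    exact congrFun h1 i
  · intro i
    simp only [hA₀] at h2
    exact congrFun h2 i

/-- A real one-form `β` such that `β` and `β ∘ i` are closed is locally the real part of the
differential of a holomorphic map. -/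
theorem exists_holomorphic_primitive
    {β : (Fin n → ℂ) → (Fin n → ℂ) →L[ℝ] (Fin n → ℝ) × (Fin n → ℝ)} {z₀ : Fin n → ℂ}
    (hβ : ∀ᶠ z in 𝓝 z₀, DifferentiableAt ℝ β z)
    (hsymm : ∀ᶠ z in 𝓝 z₀, ∀ u v, fderiv ℝ β z u v = fderiv ℝ β z v u)
    (hI : ∀ᶠ z in 𝓝 z₀, ∀ u v, fderiv ℝ β z u (Complex.I • v) = fderiv ℝ β z v (Complex.I • u)) :
    ∃ ζ : (Fin n → ℂ) → (Fin n → ℂ) × (Fin n → ℂ), ∀ᶠ z in 𝓝 z₀,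
      DifferentiableAt ℂ ζ z ∧ ∀ u, rePart n (fderiv ℂ ζ z u) = β z u := by
  obtain ⟨r, hr, hball⟩ := eventually_nhds_iff_ball.1 (hβ.and (hsymm.and hI))
  let ι : (Fin n → ℝ) →L[ℝ] (Fin n → ℂ) :=
    ContinuousLinearMap.pi fun i => Complex.ofRealCLM ∘L ContinuousLinearMap.proj i
  let κ : (Fin n → ℝ) × (Fin n → ℝ) →L[ℝ] (Fin n → ℂ) × (Fin n → ℂ) := ι.prodMap ι
  let j : (Fin n → ℂ) →L[ℝ] (Fin n → ℂ) :=
    Complex.I • ContinuousLinearMap.id ℝ (Fin n → ℂ)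
  let j' : (Fin n → ℂ) × (Fin n → ℂ) →L[ℝ] (Fin n → ℂ) × (Fin n → ℂ) :=
    Complex.I • ContinuousLinearMap.id ℝ _
  -- `T f` is the complex-linear map with real part `f`. It involves both `f` and f ∘ i, so
  -- closedness of `T β` uses closedness of β and of β ∘ i.
  let T : ((Fin n → ℂ) →L[ℝ] (Fin n → ℝ) × (Fin n → ℝ)) →L[ℝ]
      ((Fin n → ℂ) →L[ℝ] (Fin n → ℂ) × (Fin n → ℂ)) :=
    ContinuousLinearMap.compL ℝ _ _ _ κ -
      (ContinuousLinearMap.compL ℝ _ _ _ (j' ∘L κ)) ∘L (ContinuousLinearMap.compL ℝ _ _ _).flip j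
  have hT : ∀ f u, T f u = κ (f u) - Complex.I • κ (f (Complex.I • u)) := fun f u => rfl
  have hder : ∀ z ∈ ball z₀ r, HasFDerivAt (fun z => T (β z)) (T ∘L fderiv ℝ β z) z := fun z hz =>
    T.hasFDerivAt.comp z (hball z hz).1.hasFDerivAt
  obtain ⟨ζ, hζ⟩ := (convex_ball z₀ r).exists_forall_hasFDerivAt_of_fderiv_symmetric isOpen_ball
    (fun z hz => (hder z hz).differentiableAt.differentiableWithinAt)
    (fun z hz u v => by
      rw [(hder z hz).fderiv]
      change T (fderiv ℝ β z u) v = T (fderiv ℝ β z v) u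
      rw [hT, hT, (hball z hz).2.1 u v, (hball z hz).2.2 u v])
  refine ⟨ζ, ?_⟩
  filter_upwards [ball_mem_nhds z₀ hr] with z hz
  have hlin : ∀ u, T (β z) (Complex.I • u) = Complex.I • T (β z) u := fun u => by
    rw [hT, hT, smul_smul, Complex.I_mul_I, smul_sub, smul_smul, Complex.I_mul_I, neg_one_smul,
      neg_one_smul, map_neg, map_neg]
    module
  let b : (Fin n → ℂ) →L[ℂ] (Fin n → ℂ) × (Fin n → ℂ) :=
    { toFun := T (β z)
      map_add' := map_add _
      map_smul' := fun c u => by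
        have h1 : ∀ (V : Type) [AddCommGroup V] [Module ℂ V] (x : V),
            c • x = c.re • x + c.im • (Complex.I • x) := fun V _ _ x => by
          conv_lhs => rw [← Complex.re_add_im c, add_smul, mul_smul]
          rfl
        rw [RingHom.id_apply, h1 _ u, h1 _ (T (β z) u), map_add, map_smul, map_smul, hlin]
      cont := (T (β z)).cont }
  have hb : HasFDerivAt ζ b z := hasFDerivAt_of_restrictScalars ℝ (hζ z hz) rfl
  refine ⟨hb.differentiableAt, fun u => ?_⟩
  rw [hb.fderiv]
  change rePart n (κ (β z u) - Complex.I • κ (β z (Complex.I • u))) = β z u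
  ext i <;> simp [rePart, κ, ι]

end ParallelCoframe

/-! ### From a parallel coframe to a holomorphic prepotential. -/

section Prepotential

open Set Metric TopologicalSpace

variable {n : ℕ}

/-- A local biholomorphism, with convex domain and small range, inverting a given map. -/
theorem exists_local_parametrization {Z : (Fin n → ℂ) → Fin n → ℂ} {z₀ : Fin n → ℂ}
    (hZ : AnalyticAt ℂ Z z₀) (hinj : ∀ u, fderiv ℂ Z z₀ u = 0 → u = 0) {N : Set (Fin n → ℂ)}
    (hN : N ∈ 𝓝 z₀) :
    ∃ e : OpenPartialHomeomorph (Fin n → ℂ) (Fin n → ℂ), z₀ ∈ e.target ∧ e.target ⊆ N ∧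
      Convex ℝ e.source ∧ (∀ q ∈ e.source, ContDiffAt ℂ ω e q) ∧
      (∀ z ∈ e.target, ContDiffAt ℂ ω e.symm z) ∧ ⇑e.symm = Z := by
  let f' : (Fin n → ℂ) ≃L[ℂ] (Fin n → ℂ) := (LinearEquiv.ofInjectiveEndo
    (fderiv ℂ Z z₀ : (Fin n → ℂ) →ₗ[ℂ] (Fin n → ℂ))
    ((injective_iff_map_eq_zero _).2 hinj)).toContinuousLinearEquiv
  have hf' : HasFDerivAt Z (f' : (Fin n → ℂ) →L[ℂ] (Fin n → ℂ)) z₀ :=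
    hZ.differentiableAt.hasFDerivAt.congr_fderiv (by ext1 u; rfl)
  have hZc : ContDiffAt ℂ ω Z z₀ := hZ.contDiffAt
  let e₀ := hZc.toOpenPartialHomeomorph Z hf' (by simp)
  have hz₀ : z₀ ∈ e₀.source := hZc.mem_toOpenPartialHomeomorph_source hf' (by simp)
  have hZz₀ : Z z₀ ∈ e₀.target := e₀.map_source hz₀
  have hinv : e₀.symm (Z z₀) = z₀ := e₀.left_inv hz₀
  have hs : ContDiffAt ℂ ω e₀.symm (Z z₀) :=
    e₀.contDiffAt_symm hZz₀ (by rw [hinv]; exact hf') (by rw [hinv]; exact hZc)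
  have hev : ∀ᶠ q in 𝓝 (Z z₀), q ∈ e₀.target ∧ ContDiffAt ℂ ω e₀.symm q ∧
      e₀.symm q ∈ N ∧ ContDiffAt ℂ ω Z (e₀.symm q) := by
    refine Filter.Eventually.and (e₀.open_target.mem_nhds hZz₀) ((hs.eventually (by simp)).and ?_)
    have h1 := hs.continuousAt
    rw [ContinuousAt, hinv] at h1
    exact h1.eventually (p := fun z => z ∈ N ∧ ContDiffAt ℂ ω Z z)
      (Filter.Eventually.and hN (hZc.eventually (by simp)))
  obtain ⟨r, hr, hball⟩ := eventually_nhds_iff_ball.1 hev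
  -- Restricting to a ball makes the domain convex, as the primitive of Σ wᵢ dzⁱ requires.
  let e := e₀.symm.restrOpen (ball (Z z₀) r) isOpen_ball
  have hsource : e.source = ball (Z z₀) r :=
    inter_eq_right.2 fun q hq => (hball q hq).1
  have htarget : ∀ z ∈ e.target, ∃ q ∈ ball (Z z₀) r, e₀.symm q = z := fun z hz =>
    ⟨e.symm z, hsource ▸ e.map_target hz, e.right_inv hz⟩
  refine ⟨e, ?_, fun z hz => ?_, ?_, fun q hq => ?_, fun z hz => ?_, rfl⟩
  · have h1 : Z z₀ ∈ e.source := hsource ▸ mem_ball_self hr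
    rw [← hinv]
    exact e.map_source h1
  · obtain ⟨q, hq, rfl⟩ := htarget z hz
    exact (hball q hq).2.2.1
  · rw [hsource]
    exact convex_ball _ _
  · rw [hsource] at hq
    exact (hball q hq).2.1
  · obtain ⟨q, hq, rfl⟩ := htarget z hz
    exact (hball q hq).2.2.2

/-- Each hypothesis says that the real part of Σ dzⁱ ∧ dwᵢ vanishes on a pair. The second is the
first for `ip` in place of `p`, and gives the imaginary part. -/
lemma sum_mul_comm_of_stdForm {p q : (Fin n → ℂ) × (Fin n → ℂ)}
    (h1 : stdForm n (rePart n (Complex.I • p)) (rePart n (Complex.I • q)) =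
      stdForm n (rePart n p) (rePart n q))
    (h2 : stdForm n (rePart n (Complex.I • Complex.I • p)) (rePart n (Complex.I • q)) =
      stdForm n (rePart n (Complex.I • p)) (rePart n q)) :
    ∑ i, p.1 i * q.2 i = ∑ i, q.1 i * p.2 i := by
  simp only [stdForm_apply, mul_eq_mul_left_iff, OfNat.ofNat_ne_zero, or_false] at h1 h2
  rw [← sub_eq_zero, ← Finset.sum_sub_distrib] at h1 h2 ⊢
  apply Complex.ext
  · rw [Complex.re_sum, Complex.zero_re, ← neg_eq_zero, ← Finset.sum_neg_distrib, ← h1]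
    refine Finset.sum_congr rfl fun i _ => ?_
    simp [rePart]
    ring
  · rw [Complex.im_sum, Complex.zero_im, ← h2]
    refine Finset.sum_congr rfl fun i _ => ?_
    simp [rePart]
    ring

/-- A holomorphic Lagrangian section of `T*ℂⁿ` over a convex set is the graph of a differential. -/
theorem exists_eq_gradGraph {s : Set (Fin n → ℂ)} (hs : Convex ℝ s) (hso : IsOpen s)
    {g : (Fin n → ℂ) → (Fin n → ℂ) × (Fin n → ℂ)}
    (hg : ∀ q ∈ s, DifferentiableAt ℂ g q) (hg1 : ∀ q ∈ s, (g q).1 = q)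
    (hsymm : ∀ q ∈ s, ∀ u v, ∑ i, u i * (fderiv ℂ g q v).2 i = ∑ i, v i * (fderiv ℂ g q u).2 i) :
    ∃ F : (Fin n → ℂ) → ℂ, DifferentiableOn ℂ F s ∧ ∀ q ∈ s, gradGraph F q = g q := by
  -- `Q (g q).2` is the one-form Σ wᵢ dzⁱ at `q`. The symmetry hypothesis is its closedness.
  let Q : (Fin n → ℂ) →L[ℂ] (Fin n → ℂ) →L[ℂ] ℂ :=
    ∑ i, (ContinuousLinearMap.proj (R := ℂ) (φ := fun _ : Fin n => ℂ) i).smulRight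
      (ContinuousLinearMap.proj (R := ℂ) (φ := fun _ : Fin n => ℂ) i)
  have hQ : ∀ w u, Q w u = ∑ i, u i * w i := fun w u => by
    simp [Q, sum_apply, mul_comm]
  have hder : ∀ q ∈ s, HasFDerivAt (fun q => Q (g q).2)
      (Q ∘L ContinuousLinearMap.snd ℂ _ _ ∘L fderiv ℂ g q) q := fun q hq =>
    Q.hasFDerivAt.comp q (hg q hq).hasFDerivAt.snd
  obtain ⟨F, hF⟩ := hs.exists_forall_hasFDerivAt_of_fderiv_symmetric hso
    (fun q hq => ((hder q hq).restrictScalars ℝ).differentiableAt.differentiableWithinAt)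
    (fun q hq u v => by
      rw [((hder q hq).restrictScalars ℝ).fderiv]
      change Q (fderiv ℂ g q u).2 v = Q (fderiv ℂ g q v).2 u
      rw [hQ, hQ, hsymm q hq])
  refine ⟨F, fun q hq => (hF q hq).differentiableAt.differentiableWithinAt, fun q hq => ?_⟩
  refine Prod.ext (hg1 q hq).symm ?_
  ext i
  change fderiv ℂ F q _ = _
  rw [(hF q hq).fderiv, hQ]
  simp [Pi.single_apply]

/-- If a real vector v is killed by Im ∂²F, then iv is killed by both dx and dy. -/
lemma isUnit_of_injective_re_gradGraphDeriv {F : (Fin n → ℂ) → ℂ} {z : Fin n → ℂ}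
    (h : ∀ u, rePart n (gradGraphDeriv F z u) = 0 → u = 0) :
    IsUnit (Matrix.of fun i j : Fin n => (partialC (partialC F i) j z).im) := by
  refine Matrix.mulVec_injective_iff_isUnit.1 fun v w hvw => ?_
  rw [← sub_eq_zero, ← Matrix.mulVec_sub] at hvw
  have h1 := h (fun j => Complex.I * ((v - w) j : ℝ)) (Prod.ext ?_ ?_)
  · rw [← sub_eq_zero]
    ext j
    simpa [← Complex.ofReal_sub] using congrFun h1 j
  · ext i
    simp [rePart, gradGraphDeriv]
  · ext i
    change (fderiv ℂ (partialC F i) z _).re = 0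
    have h2 := congrFun hvw i
    rw [fderiv_eq_sum_partialC, Complex.re_sum, ← neg_eq_zero, ← Finset.sum_neg_distrib]
    refine Eq.trans (Finset.sum_congr rfl fun j _ => ?_) h2
    simp [mul_comm]

/-- A closed coframe of type `(1,1)` comes from a holomorphic prepotential. -/
theorem exists_prepotential
    {β : (Fin n → ℂ) → (Fin n → ℂ) →L[ℝ] (Fin n → ℝ) × (Fin n → ℝ)} {z₀ : Fin n → ℂ}
    (hβ : ∀ᶠ z in 𝓝 z₀, DifferentiableAt ℝ β z)
    (hsymm : ∀ᶠ z in 𝓝 z₀, ∀ u v, fderiv ℝ β z u v = fderiv ℝ β z v u)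
    (hI : ∀ᶠ z in 𝓝 z₀, ∀ u v, fderiv ℝ β z u (Complex.I • v) = fderiv ℝ β z v (Complex.I • u))
    (hinv : ∀ᶠ z in 𝓝 z₀, ∀ u v, stdForm n (β z (Complex.I • u)) (β z (Complex.I • v)) =
      stdForm n (β z u) (β z v))
    (hinj : ∀ᶠ z in 𝓝 z₀, ∀ u, β z u = 0 → u = 0)
    (h₀ : ∀ u, (β z₀ u).1 = 0 → (β z₀ (Complex.I • u)).1 = 0 → u = 0)
    {N : Set (Fin n → ℂ)} (hN : N ∈ 𝓝 z₀) :
    ∃ (e : OpenPartialHomeomorph (Fin n → ℂ) (Fin n → ℂ)) (F : (Fin n → ℂ) → ℂ),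
      z₀ ∈ e.target ∧ e.target ⊆ N ∧ (∀ q ∈ e.source, ContDiffAt ℂ ω e q) ∧
      (∀ z ∈ e.target, ContDiffAt ℂ ω e.symm z) ∧
      IsNondegenerateHolomorphic ⟨e.source, e.open_source⟩ F ∧
      ∀ q ∈ e.source, ∀ u, rePart n (gradGraphDeriv F q u) = β (e q) (fderiv ℂ e q u) := by
  obtain ⟨ζ, hζ⟩ := exists_holomorphic_primitive hβ hsymm hI
  have hZ : AnalyticAt ℂ (fun z => (ζ z).1) z₀ := by
    refine analyticAt_of_eventually_differentiableAt ?_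
    filter_upwards [hζ] with z hz using hz.1.fst
  have hZ0 : ∀ u, fderiv ℂ (fun z => (ζ z).1) z₀ u = (fderiv ℂ ζ z₀ u).1 := fun u => by
    rw [show fderiv ℂ (fun z => (ζ z).1) z₀ = _ from hζ.self_of_nhds.1.hasFDerivAt.fst.fderiv]
    rfl
  -- If the complex-linear dz kills `u`, it also kills `iu`; taking real parts puts both in the
  -- kernel of the x-part of β, and adaptedness at `z₀` applies.
  have hZinj : ∀ u, fderiv ℂ (fun z => (ζ z).1) z₀ u = 0 → u = 0 := fun u hu => by
    rw [hZ0] at hu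
    refine h₀ u ?_ ?_
    · rw [← hζ.self_of_nhds.2]
      change (fun i => ((fderiv ℂ ζ z₀ u).1 i).re) = 0
      rw [hu]
      rfl
    · rw [← hζ.self_of_nhds.2, map_smul]
      change (fun i => (Complex.I * (fderiv ℂ ζ z₀ u).1 i).re) = 0
      rw [hu]
      ext i
      simp
  obtain ⟨e, hz₀, heN, hconv, he, hes, heZ⟩ := exists_local_parametrization hZ hZinj
    (Filter.inter_mem hN (hζ.and (hinv.and hinj)))
  have hgood := fun q (hq : q ∈ e.source) => (heN (e.map_source hq)).2
  have hed : ∀ q ∈ e.source, DifferentiableAt ℂ e q := fun q hq =>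
    (he q hq).differentiableAt (by simp)
  have hder : ∀ q ∈ e.source, HasFDerivAt (fun q => ζ (e q))
      (fderiv ℂ ζ (e q) ∘L fderiv ℂ e q) q := fun q hq =>
    (hgood q hq).1.1.hasFDerivAt.comp q (hed q hq).hasFDerivAt
  have hre : ∀ q ∈ e.source, ∀ u, rePart n (fderiv ℂ (fun q => ζ (e q)) q u) =
      β (e q) (fderiv ℂ e q u) := fun q hq u => by
    rw [(hder q hq).fderiv]
    exact (hgood q hq).1.2 _
  have hfst : ∀ q ∈ e.source, (ζ (e q)).1 = q := fun q hq => by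
    rw [← congrFun heZ (e q)]
    exact e.left_inv hq
  have hdfst : ∀ q ∈ e.source, ∀ u, (fderiv ℂ (fun q => ζ (e q)) q u).1 = u := fun q hq u => by
    have h1 : HasFDerivAt (fun q => (ζ (e q)).1) _ q :=
      (hder q hq).differentiableAt.hasFDerivAt.fst
    have h2 : HasFDerivAt (fun q => (ζ (e q)).1) (ContinuousLinearMap.id ℂ _) q :=
      (hasFDerivAt_id q).congr_of_eventuallyEq
        (Filter.eventually_of_mem (e.open_source.mem_nhds hq) hfst)
    exact congr($(h1.unique h2) u)
  have hstd : ∀ q ∈ e.source, ∀ u v,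
      stdForm n (rePart n (Complex.I • fderiv ℂ (fun q => ζ (e q)) q u))
        (rePart n (Complex.I • fderiv ℂ (fun q => ζ (e q)) q v)) =
      stdForm n (rePart n (fderiv ℂ (fun q => ζ (e q)) q u))
        (rePart n (fderiv ℂ (fun q => ζ (e q)) q v)) := fun q hq u v => by
    rw [← map_smul, ← map_smul, hre q hq, hre q hq, hre q hq, hre q hq,
      (fderiv ℂ e q).map_smul, (fderiv ℂ e q).map_smul, (hgood q hq).2.1]
  -- In the coordinate `z` the map ζ is a section q ↦ (q, w(q)), and (1,1)-invariance together with
  -- complex linearity of dζ makes it Lagrangian.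
  obtain ⟨F, hF, hFg⟩ := exists_eq_gradGraph hconv e.open_source
    (fun q hq => (hder q hq).differentiableAt) hfst (fun q hq u v => by
      have h1 := sum_mul_comm_of_stdForm (hstd q hq u v)
        (by rw [← map_smul, hstd q hq])
      rwa [hdfst q hq, hdfst q hq] at h1)
  have hFan : ∀ q ∈ e.source, AnalyticAt ℂ F q := fun q hq =>
    analyticAt_of_eventually_differentiableAt_scalar <|
      Filter.eventually_of_mem (e.open_source.mem_nhds hq) fun q' hq' =>
        hF.differentiableAt (e.open_source.mem_nhds hq')
  have hGrad : ∀ q ∈ e.source, gradGraphDeriv F q = fderiv ℂ (fun q => ζ (e q)) q :=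
    fun q hq => (hasFDerivAt_gradGraph (hFan q hq)).unique
      ((hder q hq).differentiableAt.hasFDerivAt.congr_of_eventuallyEq
        (Filter.eventually_of_mem (e.open_source.mem_nhds hq) hFg))
  refine ⟨e, F, hz₀, fun z hz => (heN hz).1, he, hes, ⟨hF, fun q hq => ?_⟩, fun q hq u => ?_⟩
  · refine isUnit_of_injective_re_gradGraphDeriv fun u hu => ?_
    rw [hGrad q hq, hre q hq] at hu
    rw [← hdfst q hq u, (hder q hq).fderiv, ContinuousLinearMap.comp_apply,
      (hgood q hq).2.2 _ hu, map_zero]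
    rfl
  · rw [hGrad q hq, hre q hq]

end Prepotential

/-! ### Parametrizations by a local biholomorphism and a chart. -/

section ChartParametrization

open Set TopologicalSpace

variable {n : ℕ} {M : Type*} [TopologicalSpace M] [ChartedSpace (Fin n → ℂ) M]

/-- A parametrization of an open subset of `M`: a local biholomorphism of `ℂⁿ` followed by the
inverse of a chart. -/
def chartParam (e : OpenPartialHomeomorph (Fin n → ℂ) (Fin n → ℂ)) (p : M)
    (x : (⟨e.source, e.open_source⟩ : Opens (Fin n → ℂ))) : M :=
  (extChartAt 𝓘(ℝ, Fin n → ℂ) p).symm (e x)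

variable {e : OpenPartialHomeomorph (Fin n → ℂ) (Fin n → ℂ)} {p : M}

lemma chartParam_mem_source (he : e.target ⊆ (extChartAt 𝓘(ℝ, Fin n → ℂ) p).target)
    (x : (⟨e.source, e.open_source⟩ : Opens (Fin n → ℂ))) :
    chartParam e p x ∈ (extChartAt 𝓘(ℝ, Fin n → ℂ) p).source :=
  (extChartAt 𝓘(ℝ, Fin n → ℂ) p).map_target (he (e.map_source x.2))

lemma extChartAt_chartParam (he : e.target ⊆ (extChartAt 𝓘(ℝ, Fin n → ℂ) p).target)
    (x : (⟨e.source, e.open_source⟩ : Opens (Fin n → ℂ))) :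
    extChartAt 𝓘(ℝ, Fin n → ℂ) p (chartParam e p x) = e x :=
  (extChartAt 𝓘(ℝ, Fin n → ℂ) p).right_inv (he (e.map_source x.2))

lemma injective_chartParam (he : e.target ⊆ (extChartAt 𝓘(ℝ, Fin n → ℂ) p).target) :
    Function.Injective (chartParam e p) := fun x y hxy => by
  have h1 := congrArg (extChartAt 𝓘(ℝ, Fin n → ℂ) p) hxy
  rw [extChartAt_chartParam he, extChartAt_chartParam he] at h1
  exact Subtype.ext (e.injOn x.2 y.2 h1)

variable [IsManifold 𝓘(ℂ, Fin n → ℂ) ω M]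

lemma isLocalDiffeomorph_chartParam (he : e.target ⊆ (extChartAt 𝓘(ℝ, Fin n → ℂ) p).target)
    (hc : ∀ q ∈ e.source, ContDiffAt ℂ ω e q) (hcs : ∀ z ∈ e.target, ContDiffAt ℂ ω e.symm z) :
    IsLocalDiffeomorph 𝓘(ℂ, Fin n → ℂ) 𝓘(ℂ, Fin n → ℂ) ω (chartParam e p) := fun x => by
  -- The parametrization as one partial homeomorphism, whose source is the entire open set; hence
  -- the same inverse serves every point.
  let O := ((⟨e.source, e.open_source⟩ : Opens (Fin n → ℂ)).openPartialHomeomorphSubtypeCoe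
    ⟨x⟩).trans (e.trans (chartAt (Fin n → ℂ) p).symm)
  have htarget : e.target ⊆ (chartAt (Fin n → ℂ) p).target := by simpa using he
  have hO : O.source = univ := eq_univ_of_forall fun y => by
    simp only [O, mfld_simps]
    exact ⟨y.2, htarget (e.map_source y.2)⟩
  have hOt : ∀ y ∈ O.target, y ∈ (chartAt (Fin n → ℂ) p).source ∧
      chartAt (Fin n → ℂ) p y ∈ e.target := fun y hy => by
    simp only [O, mfld_simps] at hy
    exact hy.1
  refine ⟨⟨O.toPartialEquiv, O.open_source, O.open_target, ?_, ?_⟩, hO ▸ mem_univ x, fun y _ => ?_⟩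
  · have h1 : ContMDiffOn 𝓘(ℂ, Fin n → ℂ) 𝓘(ℂ, Fin n → ℂ) ω
        (fun y : (⟨e.source, e.open_source⟩ : Opens (Fin n → ℂ)) =>
          (chartAt (Fin n → ℂ) p).symm (e y)) O.source := fun y _ => by
      have h2 : ContMDiffAt 𝓘(ℂ, Fin n → ℂ) 𝓘(ℂ, Fin n → ℂ) ω (chartAt (Fin n → ℂ) p).symm (e y) :=
        contMDiffOn_chart_symm.contMDiffAt
          ((chartAt (Fin n → ℂ) p).open_target.mem_nhds (htarget (e.map_source y.2)))
      exact ((h2.comp (y : Fin n → ℂ) (hc y y.2).contMDiffAt).comp y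
        (contMDiff_subtype_val y)).contMDiffWithinAt
    exact h1
  · have h1 : ∀ y ∈ O.target, ContMDiffWithinAt 𝓘(ℂ, Fin n → ℂ) 𝓘(ℂ, Fin n → ℂ) ω
        (fun y => e.symm (chartAt (Fin n → ℂ) p y)) O.target y := fun y hy => by
      have h2 : ContMDiffAt 𝓘(ℂ, Fin n → ℂ) 𝓘(ℂ, Fin n → ℂ) ω (chartAt (Fin n → ℂ) p) y :=
        contMDiffOn_chart.contMDiffAt ((chartAt (Fin n → ℂ) p).open_source.mem_nhds (hOt y hy).1)
      exact (((hcs _ (hOt y hy).2).contMDiffAt).comp y h2).contMDiffWithinAt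
    have h3 : ∀ y ∈ O.target, (O.symm y : Fin n → ℂ) = e.symm (chartAt (Fin n → ℂ) p y) :=
      fun y hy => by
      have h4 : (chartAt (Fin n → ℂ) p).symm (e (O.symm y)) = y := O.right_inv hy
      have h5 := (chartAt (Fin n → ℂ) p).right_inv (htarget (e.map_source (O.symm y).2))
      rw [h4] at h5
      rw [h5]
      exact (e.left_inv (O.symm y).2).symm
    intro y hy
    exact (ChartedSpace.liftPropWithinAt_subtypeVal_comp_iff ..).1
      ((h1 y hy).congr h3 (h3 y hy))
  · rfl

lemma contMDiff_chartParam (he : e.target ⊆ (extChartAt 𝓘(ℝ, Fin n → ℂ) p).target)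
    (hc : ∀ q ∈ e.source, ContDiffAt ℂ ω e q) :
    ContMDiff 𝓘(ℝ, Fin n → ℂ) 𝓘(ℝ, Fin n → ℂ) ω (chartParam e p) := fun x => by
  have h2 : ContMDiffAt 𝓘(ℝ, Fin n → ℂ) 𝓘(ℝ, Fin n → ℂ) ω
      (extChartAt 𝓘(ℝ, Fin n → ℂ) p).symm (e x) :=
    (contMDiffOn_extChartAt_symm p).contMDiffAt
      ((isOpen_extChartAt_target p).mem_nhds (he (e.map_source x.2)))
  exact (h2.comp (x : Fin n → ℂ) ((hc x x.2).restrict_scalars ℝ).contMDiffAt).comp x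
    (contMDiff_subtype_val x)

/-- The chart undoes its own inverse, so the composite with the parametrization is `e` restricted to
an open set. -/
lemma mvfderiv_extChartAt_mfderiv_chartParam
    (he : e.target ⊆ (extChartAt 𝓘(ℝ, Fin n → ℂ) p).target)
    (hc : ∀ q ∈ e.source, ContDiffAt ℂ ω e q)
    (x : (⟨e.source, e.open_source⟩ : Opens (Fin n → ℂ))) (u : Fin n → ℂ) :
    mvfderiv 𝓘(ℝ, Fin n → ℂ) (extChartAt 𝓘(ℝ, Fin n → ℂ) p) (chartParam e p x)
      (mfderiv 𝓘(ℝ, Fin n → ℂ) 𝓘(ℝ, Fin n → ℂ) (chartParam e p) x u) = fderiv ℂ e x u := by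
  have h1 := ((hc x x.2).differentiableAt (by simp)).hasFDerivAt.restrictScalars ℝ
  have h2 := mfderiv_comp_apply (I := 𝓘(ℝ, Fin n → ℂ)) (I' := 𝓘(ℝ, Fin n → ℂ)) x
    ((contMDiffAt_extChartAt_of_mem (k := 1) (chartParam_mem_source he x)).mdifferentiableAt
      (by simp)) ((contMDiff_chartParam he hc x).mdifferentiableAt (by simp)) u
  refine h2.symm.trans ?_
  rw [show (extChartAt 𝓘(ℝ, Fin n → ℂ) p) ∘ chartParam e p =
      fun x : (⟨e.source, e.open_source⟩ : Opens (Fin n → ℂ)) => e x from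
    funext (extChartAt_chartParam he)]
  refine (mvfderiv_comp_subtype_val _ h1.differentiableAt u).trans ?_
  rw [h1.fderiv]
  rfl

end ChartParametrization

/-! ### Local identification of special Kähler manifolds. -/

section LocalStructure

open Set TopologicalSpace VectorField

variable {n : ℕ} {M : Type*} [TopologicalSpace M] [ChartedSpace (Fin n → ℂ) M]
  [IsManifold 𝓘(ℂ, Fin n → ℂ) ω M]

omit [IsManifold 𝓘(ℂ, Fin n → ℂ) ω M] in
lemma isInvertible_of_forall_eq_zero {A : (Fin n → ℂ) →L[ℝ] (Fin n → ℂ)}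
    (h : ∀ u, A u = 0 → u = 0) : A.IsInvertible :=
  ⟨(LinearEquiv.ofInjectiveEndo (A : (Fin n → ℂ) →ₗ[ℝ] (Fin n → ℂ))
    ((injective_iff_map_eq_zero _).2 h)).toContinuousLinearEquiv, by ext1; rfl⟩

/-- The derivative along `v` of a parallel coframe evaluated on a vector field `Y` is its value on
`∇_v Y`. -/
lemma mvfderiv_parallelCoframe_apply {V : Type*} [NormedAddCommGroup V] [NormedSpace ℝ V]
    (D : Connection n M) {p y : M} (hy : y ∈ (extChartAt 𝓘(ℝ, Fin n → ℂ) p).source)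
    {β : (Fin n → ℂ) → (Fin n → ℂ) →L[ℝ] V}
    (hβ : DifferentiableAt ℝ β (extChartAt 𝓘(ℝ, Fin n → ℂ) p y))
    (hpar : ∀ u v, fderiv ℝ β (extChartAt 𝓘(ℝ, Fin n → ℂ) p y) u v =
      β (extChartAt 𝓘(ℝ, Fin n → ℂ) p y)
        (christoffel D.isCovariantDerivativeOnUniv p (extChartAt 𝓘(ℝ, Fin n → ℂ) p y) u v))
    {Y : VField n M} (hY : IsSmoothField Y) (v : TangentSpace 𝓘(ℝ, Fin n → ℂ) y) :
    MDifferentiableAt 𝓘(ℝ, Fin n → ℂ) 𝓘(ℝ, V) (fun y => β (extChartAt 𝓘(ℝ, Fin n → ℂ) p y)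
      (mvfderiv 𝓘(ℝ, Fin n → ℂ) (extChartAt 𝓘(ℝ, Fin n → ℂ) p) y (Y y))) y ∧
    mvfderiv 𝓘(ℝ, Fin n → ℂ) (fun y => β (extChartAt 𝓘(ℝ, Fin n → ℂ) p y)
      (mvfderiv 𝓘(ℝ, Fin n → ℂ) (extChartAt 𝓘(ℝ, Fin n → ℂ) p) y (Y y))) y v =
    β (extChartAt 𝓘(ℝ, Fin n → ℂ) p y)
      (mvfderiv 𝓘(ℝ, Fin n → ℂ) (extChartAt 𝓘(ℝ, Fin n → ℂ) p) y (D Y y v)) := by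
  have hc := contMDiffAt_extChartAt_of_mem (k := 2) hy
  have hcd : MDifferentiableAt 𝓘(ℝ, Fin n → ℂ) 𝓘(ℝ, Fin n → ℂ)
      (extChartAt 𝓘(ℝ, Fin n → ℂ) p) y := hc.mdifferentiableAt (by simp)
  have h1 : MDifferentiableAt 𝓘(ℝ, Fin n → ℂ) 𝓘(ℝ, (Fin n → ℂ) →L[ℝ] V)
      (fun y => β (extChartAt 𝓘(ℝ, Fin n → ℂ) p y)) y := hβ.mdifferentiableAt.comp y hcd
  have h2 := mdifferentiableAt_mvfderiv_apply hc (hY.mdifferentiableAt y)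
  refine ⟨h1.clm_apply h2, ?_⟩
  have h3 := mvfderiv_bilin_apply (ContinuousLinearMap.id ℝ ((Fin n → ℂ) →L[ℝ] V)) h1 h2 v
  refine h3.trans ?_
  -- The product rule gives the derivative of β plus β of the derivative of the coordinates of `Y`.
  -- Parallelism writes the first as β(Γ(v, Y)), and together they are β(∇_v Y).
  have h4 := mvfderiv_comp_fderiv hβ hcd v
  have h5 := mvfderiv_cov_eq_christoffel D.isCovariantDerivativeOnUniv hy (hY.mdifferentiableAt y) v
  refine Eq.trans ?_ (congrArg (β (extChartAt 𝓘(ℝ, Fin n → ℂ) p y)) h5).symm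
  rw [map_add, ← hpar, add_comm]
  exact congrArg₂ _ rfl congr($h4 _)

variable {e : OpenPartialHomeomorph (Fin n → ℂ) (Fin n → ℂ)} {p : M} {F : (Fin n → ℂ) → ℂ}
  {β : (Fin n → ℂ) → (Fin n → ℂ) →L[ℝ] (Fin n → ℝ) × (Fin n → ℝ)}

/-- A holomorphic prepotential of a parallel Darboux coframe identifies the special Kähler
structures. -/
theorem isOpenIsomorphism_chartParam {D : Connection n M} {w : BilinField n M}
    (he : e.target ⊆ (extChartAt 𝓘(ℝ, Fin n → ℂ) p).target)
    (hc : ∀ q ∈ e.source, ContDiffAt ℂ ω e q) (hcs : ∀ z ∈ e.target, ContDiffAt ℂ ω e.symm z)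
    (hF : IsNondegenerateHolomorphic ⟨e.source, e.open_source⟩ F)
    (hFβ : ∀ q ∈ e.source, ∀ u, rePart n (gradGraphDeriv F q u) = β (e q) (fderiv ℂ e q u))
    (hβ : ∀ z ∈ e.target, DifferentiableAt ℝ β z)
    (hpar : ∀ z ∈ e.target, ∀ u v, fderiv ℝ β z u v =
      β z (christoffel D.isCovariantDerivativeOnUniv p z u v))
    (hw : ∀ z ∈ e.target, ∀ u v, formInChart w p z u v = stdForm n (β z u) (β z v)) :
    IsOpenIsomorphism hF.connection (inducedForm ⟨e.source, e.open_source⟩ F) D w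
      (chartParam e p) := by
  -- The differential of the real part of dF is the pullback of the coframe β, so both connections
  -- can be compared after applying β.
  have hdΨ : ∀ (x : (⟨e.source, e.open_source⟩ : Opens (Fin n → ℂ)))
      (u : TangentSpace 𝓘(ℝ, Fin n → ℂ) x),
      mvfderiv 𝓘(ℝ, Fin n → ℂ)
        (fun x => rePart n (dSection ⟨e.source, e.open_source⟩ F x)) x u =
      β (extChartAt 𝓘(ℝ, Fin n → ℂ) p (chartParam e p x))
        (mvfderiv 𝓘(ℝ, Fin n → ℂ) (extChartAt 𝓘(ℝ, Fin n → ℂ) p) (chartParam e p x)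
          (mfderiv 𝓘(ℝ, Fin n → ℂ) 𝓘(ℝ, Fin n → ℂ) (chartParam e p) x u)) := fun x u => by
    have h1 := hF.mvfderiv_re x
    have h2 := congrArg (β (e x)) (mvfderiv_extChartAt_mfderiv_chartParam he hc x u)
    rw [extChartAt_chartParam he]
    exact (congr($h1 u)).trans ((hFβ x x.2 u).trans h2.symm)
  have hψinv : ∀ x, (mfderiv 𝓘(ℝ, Fin n → ℂ) 𝓘(ℝ, Fin n → ℂ) (chartParam e p) x).IsInvertible :=
    fun x => by
    refine isInvertible_of_forall_eq_zero (A := mfderiv 𝓘(ℝ, Fin n → ℂ) 𝓘(ℝ, Fin n → ℂ)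
      (chartParam e p) x) fun u hu => ?_
    refine (hF.isInvertible_mvfderiv_re x).injective
      ((hdΨ x u).trans (Eq.trans ?_ (map_zero _).symm))
    have h1 : ∀ t, t = 0 → β (extChartAt 𝓘(ℝ, Fin n → ℂ) p (chartParam e p x))
        (mvfderiv 𝓘(ℝ, Fin n → ℂ) (extChartAt 𝓘(ℝ, Fin n → ℂ) p) (chartParam e p x) t) = 0 := by
      rintro t rfl
      rw [map_zero]
      exact map_zero (β _)
    exact h1 _ hu
  refine ⟨injective_chartParam he, isLocalDiffeomorph_chartParam he hc hcs, fun Y hY x u => ?_,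
    fun x u v => ?_⟩
  · obtain ⟨h1, h2⟩ := mvfderiv_parallelCoframe_apply D (chartParam_mem_source he x)
      (β := β) (by rw [extChartAt_chartParam he]; exact hβ _ (e.map_source x.2))
      (by rw [extChartAt_chartParam he]; exact hpar _ (e.map_source x.2)) hY
      (mfderiv 𝓘(ℝ, Fin n → ℂ) 𝓘(ℝ, Fin n → ℂ) (chartParam e p) x u)
    have h3 := mfderiv_comp_apply x h1
      ((contMDiff_chartParam he hc x).mdifferentiableAt (by simp)) u
    have h4 : (fun x => mvfderiv 𝓘(ℝ, Fin n → ℂ)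
        (fun x => rePart n (dSection ⟨e.source, e.open_source⟩ F x)) x
        (mpullback 𝓘(ℝ, Fin n → ℂ) 𝓘(ℝ, Fin n → ℂ) (chartParam e p) Y x)) =
        (fun y => β (extChartAt 𝓘(ℝ, Fin n → ℂ) p y)
          (mvfderiv 𝓘(ℝ, Fin n → ℂ) (extChartAt 𝓘(ℝ, Fin n → ℂ) p) y (Y y))) ∘
            chartParam e p := by
      ext1 x
      refine (hdΨ x _).trans ?_
      have h5 := (hψinv x).self_apply_inverse (Y (chartParam e p x))
      exact congrArg (fun t => β (extChartAt 𝓘(ℝ, Fin n → ℂ) p (chartParam e p x))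
        (mvfderiv 𝓘(ℝ, Fin n → ℂ) (extChartAt 𝓘(ℝ, Fin n → ℂ) p) (chartParam e p x) t)) h5
    have h6 := mvfderiv_flatConnection hF.contMDiff_re hF.isInvertible_mvfderiv_re
      (mpullback 𝓘(ℝ, Fin n → ℂ) 𝓘(ℝ, Fin n → ℂ) (chartParam e p) Y) x u
    rw [h4] at h6
    have h7 := (hdΨ x _).symm.trans (h6.trans (h3.trans h2))
    -- Writing ∇Y as an image under dψ allows injectivity of the differential of the real part of dF
    -- to be used in place of injectivity of β.
    obtain ⟨t, ht⟩ := (hψinv x).surjective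
      (D Y (chartParam e p x) (mfderiv 𝓘(ℝ, Fin n → ℂ) 𝓘(ℝ, Fin n → ℂ) (chartParam e p) x u))
    rw [← ht] at h7 ⊢
    have h8 := (hF.isInvertible_mvfderiv_re x).injective
      ((hdΨ x _).trans (h7.trans (hdΨ x t).symm))
    exact congrArg _ h8
  · have h1 := mvfderiv_extChartAt_mfderiv_chartParam he hc x
    refine (hF.inducedForm_apply x u v).trans ?_
    refine (congrArg₂ (fun a b => stdForm n a b) (hFβ x x.2 u) (hFβ x x.2 v)).trans ?_
    refine (hw _ (e.map_source x.2) _ _).symm.trans ?_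
    refine Eq.trans ?_ (formInChart_apply w (chartParam_mem_source he x) _ _)
    rw [extChartAt_chartParam he]
    exact congrArg₂ (fun a b => formInChart w p (e x) a b) (h1 u).symm (h1 v).symm

/-- Every special Kähler manifold is locally given by a holomorphic prepotential. -/
theorem IsSpecialKahler.exists_isOpenIsomorphism [T2Space M] {D : Connection n M}
    {w : BilinField n M} (h : IsSpecialKahler D w) (p : M) :
    ∃ (U : Opens (Fin n → ℂ)) (F : (Fin n → ℂ) → ℂ) (hF : IsNondegenerateHolomorphic U F)
      (ψ : U → M), p ∈ range ψ ∧ IsOpenIsomorphism hF.connection (inducedForm U F) D w ψ := by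
  have hΩs := contDiffAt_formInChart h.symplectic p
  have hΩ : ∀ᶠ z in 𝓝 (extChartAt 𝓘(ℝ, Fin n → ℂ) p p),
      DifferentiableAt ℝ (formInChart w p) z := by
    filter_upwards [(hΩs.of_le (m := 1) (by exact_mod_cast le_top)).eventually (by simp)] with z hz
    exact hz.differentiableAt (by simp)
  have htarget := extChartAt_target_mem_nhds (I := 𝓘(ℝ, Fin n → ℂ)) p
  obtain ⟨β, hβ, hβΩ, hβ₀⟩ := exists_parallel_darboux_coframe
    (contDiffAt_christoffel h.specialComplex.smooth p) (christoffel_curvature h.specialComplex p)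
    hΩ (fderiv_formInChart h.symplectic h.parallel p)
    (formInChart_self h.symplectic p _)
    (formInChart_I_smul h.invariant (mem_of_mem_nhds htarget))
  -- The obligations are, in order: β closed (no torsion), β ∘ i closed (d^∇J = 0), J-invariance of
  -- ω, and injectivity of β (ω nondegenerate).
  obtain ⟨e, F, hp, heN, hc, hcs, hF, hFβ⟩ := exists_prepotential
    (hβ.mono fun z hz => hz.1)
    (by
      filter_upwards [hβ, christoffel_symm h.specialComplex.torsionfree p] with z hz hz' u v
      rw [hz.2, hz.2, hz'])
    (by
      filter_upwards [hβ, christoffel_symm h.specialComplex.torsionfree p,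
        christoffel_I_smul h.specialComplex p] with z hz hz' hz'' u v
      rw [hz.2, hz.2, hz'', hz'])
    (by
      filter_upwards [hβΩ, htarget] with z hz hz' u v
      rw [← hz, ← hz, formInChart_I_smul h.invariant hz'])
    (by
      filter_upwards [hβΩ, htarget] with z hz hz' u hu
      refine eq_zero_of_formInChart_eq_zero h.symplectic hz' fun v => ?_
      rw [hz, hu, map_zero]
      rfl)
    hβ₀ (Filter.inter_mem htarget (hβ.and hβΩ))
  have he : e.target ⊆ (extChartAt 𝓘(ℝ, Fin n → ℂ) p).target := fun z hz => (heN hz).1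
  refine ⟨⟨e.source, e.open_source⟩, F, hF, chartParam e p, ⟨⟨e.symm _, e.map_target hp⟩, ?_⟩,
    isOpenIsomorphism_chartParam he hc hcs hF hFβ (fun z hz => (heN hz).2.1.1)
      (fun z hz => (heN hz).2.1.2) (fun z hz => (heN hz).2.2)⟩
  refine (congrArg _ (e.right_inv hp)).trans ?_
  exact (extChartAt 𝓘(ℝ, Fin n → ℂ) p).left_inv (mem_extChartAt_source p)

end LocalStructure

end SpecialKahler

end

theorem corollary2 (n : ℕ) :
    (∀ (U : TopologicalSpace.Opens (Fin n → ℂ)) (F : (Fin n → ℂ) → ℂ),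
      SpecialKahler.IsNondegenerateHolomorphic U F →
      ∃ (D : SpecialKahler.Connection n U) (w : SpecialKahler.BilinField n U),
        SpecialKahler.IsInducedBy (SpecialKahler.dSection U F) D w ∧
        SpecialKahler.IsSpecialKahler D w ∧
        ∀ (D' : SpecialKahler.Connection n U) (w' : SpecialKahler.BilinField n U),
          SpecialKahler.IsInducedBy (SpecialKahler.dSection U F) D' w' →
          w' = w ∧ ∀ Y : SpecialKahler.VField n U, SpecialKahler.IsSmoothField Y → D' Y = D Y) ∧
    (∀ (M : Type*) [TopologicalSpace M] [T2Space M] [ChartedSpace (Fin n → ℂ) M]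
      [IsManifold 𝓘(ℂ, Fin n → ℂ) ω M]
      (D : SpecialKahler.Connection n M) (w : SpecialKahler.BilinField n M),
      SpecialKahler.IsSpecialKahler D w →
      ∀ p : M, ∃ (U : TopologicalSpace.Opens (Fin n → ℂ)) (F : (Fin n → ℂ) → ℂ),
        SpecialKahler.IsNondegenerateHolomorphic U F ∧
        ∃ (D' : SpecialKahler.Connection n U) (w' : SpecialKahler.BilinField n U),
          SpecialKahler.IsInducedBy (SpecialKahler.dSection U F) D' w' ∧
          SpecialKahler.IsSpecialKahler D' w' ∧
          ∃ ψ : U → M, p ∈ Set.range ψ ∧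
            SpecialKahler.IsOpenIsomorphism D' w' D w ψ) := by
  refine ⟨fun U F hF => ⟨hF.connection, SpecialKahler.inducedForm U F, hF.isInducedBy,
    hF.isSpecialKahler, fun D' w' h' => hF.isInducedBy.unique h'⟩, ?_⟩
  intro M _ _ _ _ D w h p
  obtain ⟨U, F, hF, ψ, hp, hψ⟩ := h.exists_isOpenIsomorphism p
  exact ⟨U, F, hF, hF.connection, SpecialKahler.inducedForm U F, hF.isInducedBy,
    hF.isSpecialKahler, ψ, hp, hψ⟩
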